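/- Let $\pmb\zeta=(\beta,\gamma,\lambda)\in\mathbb{C}^3$ with $\gamma\neq 0$, and let $\Delta\in\mathbb{N}$. For a finite simple graph $G=(V,E)$ and $\tau:V\to\{+,-\}$ let $w(\tau)=\beta^{m_+(\tau)}\gamma^{m_-(\tau)}\lambda^{n_+(\tau)}$, where $m_+(\tau)$ and $m_-(\tau)$ count the edges with both ends $+$, respectively both ends $-$, and $n_+(\tau)$ counts the vertices with spin $+$ (with $0^0=1$). Let $Z_G(\pmb\zeta)=\sum_\tau w(\tau)$. For a configuration $\sigma$ of a set $\Lambda\subseteq V$ of pinned vertices let $Z_G^{\sigma}(\pmb\zeta)$ be the sum of $w(\tau)$ over the $\tau$ that extend $\sigma$, let $Z_{G,v}^{\sigma,+}(\pmb\zeta)$ be the part of that sum with $\tau(v)=+$, and let $p_v^{\sigma}=Z_{G,v}^{\sigma,+}(\pmb\zeta)/Z_G^{\sigma}(\pmb\zeta)$. The configuration $\sigma$ is feasible if it assigns $+$ to no vertex in case $\lambda=0$, and assigns $+$ to no two adjacent vertices in case $\beta=0$. For $\mathbf s=(s_1,s_2,k)\in\mathbb{N}^3$ (where only $s_1=0$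 is considered if $\beta=0$) let $$F_{\pmb\zeta,\mathbf s}(x_1,\dots,x_k)=\lambda\,\beta^{s_1}\gamma^{-s_2}\prod_{i=1}^k\frac{\beta x_i+1}{x_i+\gamma}.$$ Say that $\pmb\zeta$ satisfies complex contraction for $\Delta$ if there are a closed and bounded set $Q\subseteq\mathbb{C}$ with $\lambda\in Q$, $-\gamma\notin Q$, $-1\notin Q$, and an analytic bijection $\varphi:Q\to P$ onto a convex set $P\subseteq\mathbb{C}$ with analytic inverse (analytic on a closed set meaning that there is an analytic extension to a neighbourhood, through which derivatives are taken), such that 1. $F_{\pmb\zeta,\mathbf s}(Q^k)\subseteq Q$ whenever $\|\mathbf s\|_1\le\Delta-1$, and $-1\notin F_{\pmb\zeta,\mathbf s}(Q^k)$ whenever $\|\mathbf s\|_1=\Delta$; 2. there is $\eta>0$ such that $F^{\varphi}_{\pmb\zeta,\mathbf s}(\mathbf x)=\varphi\big(F_{\pmb\zeta,\mathbf s}(\varphi^{-1}(x_1),\dots,\varphi^{-1}(x_k))\big)$ satisfies $\|\nabla F^{\varphi}_{\pmb\zeta,\mathbf s}(\mathbf x)\|_1\le 1-\eta$ whenever $\|\mathbf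 s\|_1\le\Delta-1$ and $\mathbf x\in P^k$. Suppose that $\pmb\zeta$ satisfies complex contraction for $\Delta$. Then the following hold. (a) Strong spatial mixing. There are constants $C,c>0$ such that for every finite graph $G=(V,E)$ of maximum degree at most $\Delta$, every $v\in V$, and all feasible configurations $\sigma$ of $\Lambda_1\subseteq V$ and $\tau$ of $\Lambda_2\subseteq V$ with $v\notin\Lambda_1\cup\Lambda_2$, we have $Z_G^{\sigma}(\pmb\zeta)\neq0$, $Z_G^{\tau}(\pmb\zeta)\neq0$ and $$\big|p_v^{\sigma}-p_v^{\tau}\big|\le C\exp\big(-c\,\mathrm{dist}_G(v,S)\big),$$ where $S\subseteq\Lambda_1\cup\Lambda_2$ is the set of vertices on which $\sigma$ and $\tau$ differ (vertices pinned in exactly one of the two included); the two marginals are equal if $\mathrm{dist}_G(v,S)=\infty$. (b) FPTAS. There is a deterministic algorithm (with $\pmb\zeta$ and $\Delta$ fixed, and running time measured by bit cost) with the following property. Given a graph $G$ on $n$ vertices of maximum degree at most $\Delta$, an integer $m=1/\varepsilon\ge1$, and dyadic approximations of $\beta,\gamma,\lambda$ with error at most $2^{-b}$ for a precision $b$ that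 is a fixed polynomial in $n+m$, it outputs, in time polynomial in $n$ and $1/\varepsilon$, a number $\widehat Z\in\mathbb{Q}(i)$ with $|\widehat Z-Z_G(\pmb\zeta)|\le\varepsilon\,|Z_G(\pmb\zeta)|$. -/

import Mathlib

universe u

noncomputable section

/-! # 2-spin systems, pinnings and marginals -/

/-- The parameter vector `ζ = (β, γ, λ) ∈ ℂ³` of a 2-spin system. -/
structure SpinParams where
  β : ℂ
  γ : ℂ
  lam : ℂ

/-- A configuration of a subset `Λ` of the vertices: `σ v = none` means that `v` is free
(`v ∉ Λ`), `σ v = some true` that `v` is pinned to spin `+`, and `σ v = some false` that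
`v` is pinned to spin `-`. -/
abbrev Pinning (V : Type u) := V → Option Bool

/-- The graphs of degree at most `Δ`, as a family of graphs (only finite vertex types are
considered below). -/
def boundedDegreeGraphs (Δ : ℕ) (V : Type u) : Set (SimpleGraph V) :=
  {G | ∀ v, (G.neighborSet v).ncard ≤ Δ}

/-- The weight `β ^ m₊(τ) * γ ^ m₋(τ) * λ ^ n₊(τ)` of a full configuration `τ`, where `true` is
the spin `+`. -/
def configWeight {V : Type u} (ζ : SpinParams) (G : SimpleGraph V) (τ : V → Bool) : ℂ :=
  ζ.β ^ {e ∈ G.edgeSet | ∀ v ∈ e, τ v = true}.ncard *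
    ζ.γ ^ {e ∈ G.edgeSet | ∀ v ∈ e, τ v = false}.ncard *
      ζ.lam ^ {v | τ v = true}.ncard

/-- The full configuration `τ` agrees with the pinning `σ` on the pinned vertices. -/
abbrev AgreesWith {V : Type u} (τ : V → Bool) (σ : Pinning V) : Prop :=
  ∀ v, σ v = none ∨ σ v = some (τ v)

/-- The partition function `Z_G^σ(ζ)`, over the configurations that agree with `σ`. -/
def pinnedZ {V : Type u} [Fintype V] [DecidableEq V] (ζ : SpinParams) (G : SimpleGraph V)
    (σ : Pinning V) : ℂ :=
  ∑ τ : V → Bool with AgreesWith τ σ, configWeight ζ G τ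

/-- The contribution `Z_{G,v}^{σ,+}(ζ)` of the configurations with `v` assigned to `+`. -/
def pinnedZPlus {V : Type u} [Fintype V] [DecidableEq V] (ζ : SpinParams) (G : SimpleGraph V)
    (σ : Pinning V) (v : V) : ℂ :=
  ∑ τ : V → Bool with AgreesWith τ σ ∧ τ v = true, configWeight ζ G τ

/-- The (complex) marginal `p_v^σ(ζ)`; meaningful when `pinnedZ ζ G σ ≠ 0`. -/
def marginal {V : Type u} [Fintype V] [DecidableEq V] (ζ : SpinParams) (G : SimpleGraph V)
    (σ : Pinning V) (v : V) : ℂ :=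
  pinnedZPlus ζ G σ v / pinnedZ ζ G σ

/-- The partition function `Z_G(ζ)`, without pinned vertices. -/
def partitionZ {V : Type u} [Fintype V] [DecidableEq V] (ζ : SpinParams) (G : SimpleGraph V) : ℂ :=
  ∑ τ : V → Bool, configWeight ζ G τ

/-- Feasible configurations on a subset of the vertices. -/
def Feasible {V : Type u} (ζ : SpinParams) (G : SimpleGraph V) (σ : Pinning V) : Prop :=
  (ζ.lam = 0 → ∀ v, σ v ≠ some true) ∧
    (ζ.β = 0 → ∀ u v, G.Adj u v → ¬(σ u = some true ∧ σ v = some true))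

/-- The set `S` of the vertices on which two configurations differ; a vertex that is free in one
and pinned in the other counts. -/
def differSet {V : Type u} (σ τ : Pinning V) : Set V := {u | σ u ≠ τ u}

/-- `dist_G(v, S)`, equal to `⊤` when no vertex of `S` can be reached from `v` (in particular when
`S` is empty). -/
def distToSet {V : Type u} (G : SimpleGraph V) (v : V) (S : Set V) : ℕ∞ :=
  ⨅ u ∈ S, G.edist v u

/-- Strong spatial mixing of the 2-spin system `ζ` on a family `𝒢` of finite graphs. The bound
`exp (-Ω(dist(v, S)))` is `C * exp (-c * dist(v, S))`, with constants that are uniform over the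
family. It is required for all natural numbers `t ≤ dist(v, S)`, so that the two marginals
coincide when the distance is infinite. -/
def StrongSpatialMixing (ζ : SpinParams) (𝒢 : ∀ V : Type u, Set (SimpleGraph V)) : Prop :=
  ∃ C c : ℝ, 0 < C ∧ 0 < c ∧
    ∀ (V : Type u) [Fintype V] [DecidableEq V], ∀ G ∈ 𝒢 V, ∀ (v : V) (σ τ : Pinning V),
      Feasible ζ G σ → Feasible ζ G τ → σ v = none → τ v = none →
        pinnedZ ζ G σ ≠ 0 ∧ pinnedZ ζ G τ ≠ 0 ∧
          ∀ t : ℕ, (t : ℕ∞) ≤ distToSet G v (differSet σ τ) →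
            ‖marginal ζ G σ v - marginal ζ G τ v‖ ≤ C * Real.exp (-(c * t))

/-! # Complex contraction -/

/-- The recursion function `F_{ζ,s}(x)` for `s = (s₁, s₂, k)`. -/
def recF (ζ : SpinParams) (s₁ s₂ k : ℕ) (x : Fin k → ℂ) : ℂ :=
  ζ.lam * ζ.β ^ s₁ * (ζ.γ ^ s₂)⁻¹ * ∏ i, ((ζ.β * x i + 1) / (x i + ζ.γ))

/-- The 1-norm of the (complex) gradient of `f` at `x`. -/
def gradNorm₁ {k : ℕ} (f : (Fin k → ℂ) → ℂ) (x : Fin k → ℂ) : ℝ :=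
  ∑ i, ‖fderiv ℂ f x (Pi.single i 1)‖

/-- `(s₁, s₂, k)` is a shape for which recursion functions are considered: when `β = 0`, only
those with `s₁ = 0` are. -/
def Admissible (ζ : SpinParams) (s₁ : ℕ) : Prop := ζ.β = 0 → s₁ = 0

/-- Complex contraction for `Δ`. The set `Q` is closed and bounded, `φ` is a bijection from `Q`
onto the convex set `P` with inverse `ψ`, both are analytic (on a neighbourhood of every point of
the closed set), and `φ ∘ F_{ζ,s} ∘ ψ` is the recursion function in the transformed coordinates.
The bound `‖s‖₁ ≤ Δ - 1` is written `‖s‖₁ < Δ`. -/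
def ComplexContraction (ζ : SpinParams) (Δ : ℕ) : Prop :=
  ∃ (Q P : Set ℂ) (φ ψ : ℂ → ℂ),
    IsClosed Q ∧ Bornology.IsBounded Q ∧ ζ.lam ∈ Q ∧ -ζ.γ ∉ Q ∧ -1 ∉ Q ∧
    Convex ℝ P ∧ Set.MapsTo φ Q P ∧ Set.MapsTo ψ P Q ∧ Set.InvOn ψ φ Q P ∧
    AnalyticOnNhd ℂ φ Q ∧ AnalyticOnNhd ℂ ψ P ∧
    (∀ s₁ s₂ k : ℕ, Admissible ζ s₁ → s₁ + s₂ + k < Δ →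
      ∀ x : Fin k → ℂ, (∀ i, x i ∈ Q) → recF ζ s₁ s₂ k x ∈ Q) ∧
    (∀ s₁ s₂ k : ℕ, Admissible ζ s₁ → s₁ + s₂ + k = Δ →
      ∀ x : Fin k → ℂ, (∀ i, x i ∈ Q) → recF ζ s₁ s₂ k x ≠ -1) ∧
    ∃ η : ℝ, 0 < η ∧ ∀ s₁ s₂ k : ℕ, Admissible ζ s₁ → s₁ + s₂ + k < Δ →
      ∀ x : Fin k → ℂ, (∀ i, x i ∈ P) →
        gradNorm₁ (fun y => φ (recF ζ s₁ s₂ k (fun i => ψ (y i)))) x ≤ 1 - η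

/-! # Machine model

Programs are systems of first-order recursive functions that work on integers and pairs, with
call-by-value evaluation and logarithmic (bit-length) cost for integer operations. Copying a value
copies a pointer. A computation of cost `T` builds at most `T` new pairs and writes integers of
total bit length `O(T)`, so that polynomial cost here is the same as polynomial time on a Turing
machine. -/

/-- The data: integers and pairs. -/
inductive Val : Type
  | int (z : ℤ) : Val
  | pair (a b : Val) : Val

/-- The integer operations. -/
inductive ArithOp : Type
  | add | sub | mul | div

/-- The result of an integer operation; the division rounds. -/
def ArithOp.apply : ArithOp → ℤ → ℤ → ℤ
  | .add, x, y => x + y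
  | .sub, x, y => x - y
  | .mul, x, y => x * y
  | .div, x, y => x / y

/-- The number of binary digits of the absolute value. -/
def intSize (z : ℤ) : ℕ := z.natAbs.size

/-- Expressions. Variables are de Bruijn indices into the environment, `letIn a b` evaluates `b`
with the value of `a` as the new variable `0`, and `call f a` applies the `f`-th function of the
program to the value of `a`. -/
inductive Expr : Type
  | var (i : ℕ) : Expr
  | const (z : ℤ) : Expr
  | arith (o : ArithOp) (a b : Expr) : Expr
  | pair (a b : Expr) : Expr
  | fst (a : Expr) : Expr
  | snd (a : Expr) : Expr
  | ifPos (t a b : Expr) : Expr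
  | ifPair (t a b : Expr) : Expr
  | letIn (a b : Expr) : Expr
  | call (f : ℕ) (a : Expr) : Expr

/-- A program: the list of the bodies of its functions. A body sees the argument as its only
variable. -/
abbrev Program := List Expr

/-- `Eval p env e v c`: the expression `e` of the program `p` evaluates in the environment `env`
to the value `v`, with cost `c`. Expressions that get stuck or do not terminate have no value. -/
inductive Eval (p : Program) : List Val → Expr → Val → ℕ → Prop
  | var {env : List Val} {i : ℕ} {v : Val} (h : env[i]? = some v) :
      Eval p env (.var i) v (i + 1)
  | const {env : List Val} (z : ℤ) :
      Eval p env (.const z) (.int z) (intSize z + 1)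
  | arith {env : List Val} {a b : Expr} {x y : ℤ} {c d : ℕ} (o : ArithOp)
      (ha : Eval p env a (.int x) c) (hb : Eval p env b (.int y) d) :
      Eval p env (.arith o a b) (.int (o.apply x y)) (c + d + intSize x + intSize y + 1)
  | pair {env : List Val} {a b : Expr} {v w : Val} {c d : ℕ}
      (ha : Eval p env a v c) (hb : Eval p env b w d) :
      Eval p env (.pair a b) (.pair v w) (c + d + 1)
  | fst {env : List Val} {a : Expr} {v w : Val} {c : ℕ}
      (ha : Eval p env a (.pair v w) c) : Eval p env (.fst a) v (c + 1)
  | snd {env : List Val} {a : Expr} {v w : Val} {c : ℕ}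
      (ha : Eval p env a (.pair v w) c) : Eval p env (.snd a) w (c + 1)
  | ifPosTrue {env : List Val} {t a b : Expr} {x : ℤ} {v : Val} {c d : ℕ}
      (ht : Eval p env t (.int x) c) (hx : 0 < x) (ha : Eval p env a v d) :
      Eval p env (.ifPos t a b) v (c + d + 1)
  | ifPosFalse {env : List Val} {t a b : Expr} {x : ℤ} {v : Val} {c d : ℕ}
      (ht : Eval p env t (.int x) c) (hx : x ≤ 0) (hb : Eval p env b v d) :
      Eval p env (.ifPos t a b) v (c + d + 1)
  | ifPairTrue {env : List Val} {t a b : Expr} {x y v : Val} {c d : ℕ}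
      (ht : Eval p env t (.pair x y) c) (ha : Eval p env a v d) :
      Eval p env (.ifPair t a b) v (c + d + 1)
  | ifPairFalse {env : List Val} {t a b : Expr} {x : ℤ} {v : Val} {c d : ℕ}
      (ht : Eval p env t (.int x) c) (hb : Eval p env b v d) :
      Eval p env (.ifPair t a b) v (c + d + 1)
  | letIn {env : List Val} {a b : Expr} {v w : Val} {c d : ℕ}
      (ha : Eval p env a v c) (hb : Eval p (v :: env) b w d) :
      Eval p env (.letIn a b) w (c + d + 1)
  | call {env : List Val} {a body : Expr} {v w : Val} {f c d : ℕ}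
      (ha : Eval p env a v c) (hf : p[f]? = some body) (hb : Eval p [v] body w d) :
      Eval p env (.call f a) w (c + d + 1)

/-- Evaluation is deterministic, in the value and in the cost. -/
theorem Eval.deterministic {p : Program} {env : List Val} {e : Expr} {v w : Val} {c d : ℕ}
    (h : Eval p env e v c) (h' : Eval p env e w d) : v = w ∧ c = d := by
  induction h generalizing w d with
  | call ha hf hb iha ihb =>
    cases h' with
    | call ha' hf' hb' =>
      obtain ⟨rfl, rfl⟩ := iha ha'
      rw [hf] at hf'; cases hf'
      obtain ⟨rfl, rfl⟩ := ihb hb'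
      exact ⟨rfl, rfl⟩
  | letIn ha hb iha ihb =>
    cases h' with
    | letIn ha' hb' =>
      obtain ⟨rfl, rfl⟩ := iha ha'
      obtain ⟨rfl, rfl⟩ := ihb hb'
      exact ⟨rfl, rfl⟩
  | _ => cases h' <;> grind

/-- The program `p`, started with its function `0` on the input `v`, halts with the output `w` and
has cost `c`. -/
def RunsTo (p : Program) (v w : Val) (c : ℕ) : Prop := Eval p [v] (.call 0 (.var 0)) w c

/-! # Fully polynomial-time approximation schemes -/

/-- Lists as iterated pairs, ended by the integer `0`. -/
def Val.ofList : List Val → Val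
  | [] => .int 0
  | a :: l => .pair a (Val.ofList l)

open Classical in
/-- The adjacency matrix of a graph, as the list of its rows. -/
def Val.ofGraph {n : ℕ} (G : SimpleGraph (Fin n)) : Val :=
  Val.ofList (List.ofFn fun i => Val.ofList (List.ofFn fun j => .int (if G.Adj i j then 1 else 0)))

/-- The pair of integers `(a.1, a.2)` encodes the dyadic approximation `(a.1 + a.2 * I) / 2 ^ b`
of `z`, with error at most `2 ^ (-b)`. -/
def IsDyadicApprox (b : ℕ) (z : ℂ) (a : ℤ × ℤ) : Prop :=
  ‖z - ((a.1 : ℂ) + (a.2 : ℂ) * Complex.I) / 2 ^ b‖ ≤ 1 / 2 ^ b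

/-- A pair of integers as a value. -/
def Val.ofIntPair (a : ℤ × ℤ) : Val := .pair (.int a.1) (.int a.2)

/-- The input `(n, G, m, b, β', γ', λ')` of an approximation algorithm: a graph, the
error parameter `m = 1 / ε`, the precision `b`, and approximations of the parameters. -/
def fptasInput {n : ℕ} (G : SimpleGraph (Fin n)) (m b : ℕ) (β' γ' lam' : ℤ × ℤ) : Val :=
  .pair (.int n) (.pair (Val.ofGraph G) (.pair (.int m) (.pair (.int b)
    (.pair (Val.ofIntPair β') (.pair (Val.ofIntPair γ') (Val.ofIntPair lam'))))))

/-- There is an FPTAS for `Z_G(ζ)` on the graphs `G` of the family `𝒢`, for fixed `ζ ∈ ℂ³`: one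
program which, given a graph with `n` vertices, `m = 1 / ε ≥ 1`, and approximations of `β`, `γ`,
`λ` to polynomially many binary digits, computes a number `(x + y * I) / d` with relative error
at most `ε`, at a cost that is polynomial in `n` and `1 / ε`. -/
def HasFPTAS (ζ : SpinParams) (𝒢 : ∀ V : Type, Set (SimpleGraph V)) : Prop :=
  ∃ (p : Program) (prec time : Polynomial ℕ),
    ∀ (n : ℕ), ∀ G ∈ 𝒢 (Fin n), ∀ m : ℕ, 1 ≤ m → ∀ β' γ' lam' : ℤ × ℤ,
      IsDyadicApprox (prec.eval (n + m)) ζ.β β' →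
      IsDyadicApprox (prec.eval (n + m)) ζ.γ γ' →
      IsDyadicApprox (prec.eval (n + m)) ζ.lam lam' →
        ∃ (x y d : ℤ) (c : ℕ), d ≠ 0 ∧
          RunsTo p (fptasInput G m (prec.eval (n + m)) β' γ' lam')
            (.pair (.int x) (.pair (.int y) (.int d))) c ∧
          c ≤ time.eval (n + m) ∧
          ‖((x : ℂ) + (y : ℂ) * Complex.I) / (d : ℂ) - partitionZ ζ G‖
            ≤ 1 / (m : ℝ) * ‖partitionZ ζ G‖

end

/-! Vertices are removed one at a time, and an edge from a removed vertex to a remaining one becomes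
a half edge pinned to the spin of the removed vertex. If R is the ratio of the + and − contributions
at v, then Z = γ^B · Z⁻ · (1 + R), where B counts the − half edges at v and Z⁻ is the partition
function of the smaller system in which v has spin −. Flipping the half edges that v leaves at its
neighbours from − to +, one by one, expresses R as the recursion function F applied to ratios at the
neighbours in smaller systems (`subZ_telescope`, `nodeRatio_eq_nodeVal_of_ne`). This is Weitz's
self-avoiding walk tree, unfolded as a recursion on vertex sets.

Zero-freeness (`RecInvariant.zeroFree_aux`): below the root the edge to the parent is used up, so at
most Δ − 1 neighbours remain and condition 1 keeps the ratio in Q. The exception is β = 0 with a +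
neighbour: the ratio is then 0, and such a child acts on its parent exactly like a neighbour pinned
to −. At the root there may be Δ neighbours, and the ratio still avoids −1. Hence no factor 1 + R
vanishes.

Mixing: in the coordinate φ the gradient bound makes F a contraction for the sup norm, so truncation
at depth d costs O(ρ^d) (`RecContraction.truncVal_bound`, `RecContraction.exists_rootBound`). The
truncated value only sees a ball around v (`truncVal_congr`), so pinnings that agree on the ball
have a common approximation. Since 1 + R is bounded away from 0 by compactness, this carries over to
p = R / (1 + R).

FPTAS: Z is the product over the vertices of γ^B (1 + R). Logarithmic depth gives each factor a
polynomially small relative error, and a recursion of branching at most Δ and logarithmic depth has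
polynomial size. All arithmetic is exact on fractions of Gaussian integers. Bit lengths and
parameter errors both grow by at most a constant factor per level, so the lengths stay polynomial
(`call_node`, `call_sweep`) and linear precision is enough (`fracVal_spec`, `sweepVal_spec`,
`exists_precision`). -/

/-! # Partition functions with half edges pinned at the vertices -/

section Recursion

set_option linter.unusedSectionVars false

variable {V : Type u} [Fintype V] [DecidableEq V]

/-- The number of edges of `G` with both ends in `S`. -/
noncomputable def inducedEdges (G : SimpleGraph V) (S : Finset V) : ℕ :=
  {e ∈ G.edgeSet | ∀ v ∈ e, v ∈ S}.ncard

theorem inducedEdges_insert (G : SimpleGraph V) [DecidableRel G.Adj] {S : Finset V} {v : V}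
    (hv : v ∉ S) :
    inducedEdges G (insert v S) = inducedEdges G S + (S.filter (G.Adj v)).card := by
  have h : {e ∈ G.edgeSet | ∀ w ∈ e, w ∈ insert v S} =
      {e ∈ G.edgeSet | ∀ w ∈ e, w ∈ S} ∪ (fun y => s(v, y)) '' (S.filter (G.Adj v) : Finset V) := by
    ext e
    induction e with
    | _ x y =>
      simp only [Set.mem_ofPred_eq, SimpleGraph.mem_edgeSet, Sym2.mem_iff, forall_eq_or_imp,
        forall_eq, Finset.mem_insert, Set.mem_union, Set.mem_image, Finset.coe_filter, Sym2.eq_iff]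
      constructor
      · rintro ⟨ha, rfl | hx, rfl | hy⟩
        · exact absurd ha (G.loopless.irrefl _)
        · exact Or.inr ⟨y, ⟨hy, ha⟩, by simp⟩
        · exact Or.inr ⟨x, ⟨hx, ha.symm⟩, by simp⟩
        · exact Or.inl ⟨ha, hx, hy⟩
      · rintro (⟨ha, hx, hy⟩ | ⟨z, ⟨hz, ha⟩, ⟨rfl, rfl⟩ | ⟨rfl, rfl⟩⟩)
        · exact ⟨ha, Or.inr hx, Or.inr hy⟩
        · exact ⟨ha, Or.inl rfl, Or.inr hz⟩
        · exact ⟨ha.symm, Or.inr hz, Or.inl rfl⟩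
  rw [inducedEdges, h, Set.ncard_union_eq, Set.ncard_image_of_injective, Set.ncard_coe_finset]
  · rfl
  · intro x y hxy
    simpa only [Sym2.congr_right] using hxy
  · rw [Set.disjoint_left]
    rintro e ⟨-, he⟩ ⟨y, -, rfl⟩
    exact hv (he v (by simp))

/-- The partition function on the vertices of `U`, where `A v` and `B v` additional neighbours of
`v` are pinned to `+` and to `-`. A configuration is given by its set of vertices of spin `+`. -/
noncomputable def subZ (ζ : SpinParams) (G : SimpleGraph V) (U : Finset V) (A B : V → ℕ) : ℂ :=
  ∑ S ∈ U.powerset, ζ.lam ^ S.card * ζ.β ^ (∑ v ∈ S, A v + inducedEdges G S) *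
    ζ.γ ^ (∑ v ∈ U \ S, B v + inducedEdges G (U \ S))

/-- The indicator function of the neighbourhood of `v`. -/
def adjInd (G : SimpleGraph V) [DecidableRel G.Adj] (v : V) : V → ℕ :=
  fun y => if G.Adj v y then 1 else 0

theorem sum_adjInd (G : SimpleGraph V) [DecidableRel G.Adj] (v : V) (S : Finset V) :
    ∑ y ∈ S, adjInd G v y = (S.filter (G.Adj v)).card := by
  rw [Finset.card_filter]
  rfl

theorem subZ_empty (ζ : SpinParams) (G : SimpleGraph V) (A B : V → ℕ) : subZ ζ G ∅ A B = 1 := by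
  have : inducedEdges G ∅ = 0 := by
    rw [inducedEdges, Set.ncard_eq_zero, Set.eq_empty_iff_forall_notMem]
    intro e
    induction e with
    | _ x y => exact fun h => Finset.notMem_empty x (h.2 x (Sym2.mem_mk_left x y))
  simp [subZ, this]

theorem subZ_congr (ζ : SpinParams) (G : SimpleGraph V) {U : Finset V} {A B A' B' : V → ℕ}
    (hA : ∀ v ∈ U, A v = A' v) (hB : ∀ v ∈ U, B v = B' v) :
    subZ ζ G U A B = subZ ζ G U A' B' := by
  refine Finset.sum_congr rfl fun S hS => ?_
  rw [Finset.mem_powerset] at hS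
  rw [Finset.sum_congr rfl fun v hv => hA v (hS hv),
    Finset.sum_congr rfl fun v hv => hB v (Finset.mem_sdiff.1 hv).1]

/-- Split by the spin of `v`: every neighbour left in `U` inherits a half edge of that spin, while
the half edges at `v` itself are paid for at once. -/
theorem subZ_insert (ζ : SpinParams) (G : SimpleGraph V) [DecidableRel G.Adj] {U : Finset V} {v : V}
    (hv : v ∉ U) (A B : V → ℕ) :
    subZ ζ G (insert v U) A B = ζ.lam * ζ.β ^ A v * subZ ζ G U (A + adjInd G v) B +
      ζ.γ ^ B v * subZ ζ G U A (B + adjInd G v) := by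
  rw [subZ, Finset.sum_powerset_insert hv, add_comm]
  simp only [subZ, Finset.mul_sum]
  congr 1 <;> refine Finset.sum_congr rfl fun S hS => ?_
  · rw [Finset.mem_powerset] at hS
    have hvS : v ∉ S := fun h => hv (hS h)
    have h1 : insert v U \ insert v S = U \ S := by
      ext x
      simp only [Finset.mem_sdiff, Finset.mem_insert]
      grind
    rw [h1, Finset.card_insert_of_notMem hvS, inducedEdges_insert G hvS,
      Finset.sum_insert hvS]
    simp only [Pi.add_apply, Finset.sum_add_distrib, sum_adjInd]
    ring
  · rw [Finset.mem_powerset] at hS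
    have hvS : v ∉ S := fun h => hv (hS h)
    have h1 : insert v U \ S = insert v (U \ S) := Finset.insert_sdiff_of_notMem _ hvS
    have h2 : v ∉ U \ S := fun h => hv (Finset.mem_sdiff.1 h).1
    rw [h1, inducedEdges_insert G h2, Finset.sum_insert h2]
    simp only [Pi.add_apply, Finset.sum_add_distrib, sum_adjInd]
    ring

/-- The ratio of the contributions of spin `+` and spin `-` at a vertex `v ∉ U`, in the partition
function on `insert v U`. -/
noncomputable def nodeRatio (ζ : SpinParams) (G : SimpleGraph V) [DecidableRel G.Adj]
    (U : Finset V) (A B : V → ℕ) (v : V) : ℂ :=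
  ζ.lam * ζ.β ^ A v * subZ ζ G U (A + adjInd G v) B / (ζ.γ ^ B v * subZ ζ G U A (B + adjInd G v))

/-- The source of both applications: nonvanishing reduces to a ratio different from −1, and
iteration turns the partition function into a product of one factor per vertex. -/
theorem subZ_insert_eq (ζ : SpinParams) (G : SimpleGraph V) [DecidableRel G.Adj] {U : Finset V}
    {v : V} (hγ : ζ.γ ≠ 0) (hv : v ∉ U) (A B : V → ℕ) (h : subZ ζ G U A (B + adjInd G v) ≠ 0) :
    subZ ζ G (insert v U) A B =
      ζ.γ ^ B v * subZ ζ G U A (B + adjInd G v) * (1 + nodeRatio ζ G U A B v) := by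
  rw [subZ_insert ζ G hv, nodeRatio]
  field_simp
  ring

/-- The contribution of a free child of value `x` to the recursion. -/
noncomputable def fac (ζ : SpinParams) (x : ℂ) : ℂ := (ζ.β * x + 1) / (x + ζ.γ)

/-- Expand numerator and denominator at `x`. The extra half edge multiplies the + term by β in the
former and the − term by γ in the latter; dividing by the common − contribution gives (βR + 1) / (R
+ γ). -/
theorem subZ_single (ζ : SpinParams) (G : SimpleGraph V) [DecidableRel G.Adj] {U : Finset V}
    {x : V} (hγ : ζ.γ ≠ 0) (hx : x ∈ U) (A B : V → ℕ)
    (h : subZ ζ G (U.erase x) A (B + adjInd G x) ≠ 0) :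
    subZ ζ G U (A + Pi.single x 1) B / subZ ζ G U A (B + Pi.single x 1) =
      fac ζ (nodeRatio ζ G (U.erase x) A B x) := by
  have hx' : x ∉ U.erase x := Finset.notMem_erase x U
  have e : ∀ C : V → ℕ, ∀ y ∈ U.erase x, (C + (Pi.single x 1 : V → ℕ)) y = C y := fun C y hy => by
    simp [(Finset.mem_erase.1 hy).1]
  have e' : ∀ C : V → ℕ, ∀ y ∈ U.erase x,
      (C + (Pi.single x 1 : V → ℕ) + adjInd G x) y = (C + adjInd G x) y := fun C y hy => by
    simp [(Finset.mem_erase.1 hy).1]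
  rw [← Finset.insert_erase hx, subZ_insert ζ G hx', subZ_insert ζ G hx', Finset.insert_erase hx,
    subZ_congr ζ G (e A) (fun _ _ => rfl), subZ_congr ζ G (e' A) (fun _ _ => rfl),
    subZ_congr ζ G (fun _ _ => rfl) (e B), subZ_congr ζ G (fun _ _ => rfl) (e' B),
    nodeRatio, fac]
  simp only [Pi.add_apply, Pi.single_eq_same, pow_succ]
  have h' := mul_ne_zero (pow_ne_zero (B x) hγ) h
  rw [← mul_div_mul_right (ζ.β * _ + 1) (_ + ζ.γ) h', add_mul, add_mul, mul_assoc ζ.β,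
    div_mul_cancel₀ _ h']
  congr 1 <;> ring

/-- One half edge more at the vertices of `J` that come before `x`. -/
def addBefore (e : V → ℕ) (J : Finset V) (x : V) (A : V → ℕ) : V → ℕ :=
  fun y => A y + if y ∈ J ∧ e y < e x then 1 else 0

/-- One half edge more at the vertices of `J` that come after `x`. -/
def addAfter (e : V → ℕ) (J : Finset V) (x : V) (A : V → ℕ) : V → ℕ :=
  fun y => A y + if y ∈ J ∧ e x < e y then 1 else 0

/-- The indicator function of a finite set. -/
def finInd (J : Finset V) : V → ℕ := fun y => if y ∈ J then 1 else 0

/-- The half edges at `J` are flipped from − to + in the order of `e`. When `x` is flipped, earlier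
vertices already carry + and later ones still carry −; the half edge at `x` itself is accounted for
by `fac`. Nonvanishing lets the intermediate partition functions cancel. -/
theorem subZ_telescope (ζ : SpinParams) (G : SimpleGraph V) [DecidableRel G.Adj] {U : Finset V}
    (hγ : ζ.γ ≠ 0) {e : V → ℕ} (he : Function.Injective e) (A : V → ℕ) (J : Finset V) :
    ∀ B : V → ℕ, J ⊆ U →
    (∀ A' B' : V → ℕ, (∀ y ∈ U, A' y + B' y = A y + B y + finInd J y) → subZ ζ G U A' B' ≠ 0) →
    (∀ x ∈ J, subZ ζ G (U.erase x) (addBefore e J x A) (addAfter e J x B + adjInd G x) ≠ 0) →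
    subZ ζ G U (A + finInd J) B / subZ ζ G U A (B + finInd J) =
      ∏ x ∈ J, fac ζ (nodeRatio ζ G (U.erase x) (addBefore e J x A) (addAfter e J x B) x) := by
  induction J using Finset.induction_on_max_value e with
  | empty =>
    intro B _ hZ _
    have h0 : finInd (∅ : Finset V) = 0 := by ext; simp [finInd]
    simp only [h0, add_zero, Finset.prod_empty]
    exact div_self (hZ A B fun y _ => by simp [h0])
  | insert m J' hm hle ih =>
    intro B hJ hZ hc
    have hlt : ∀ x ∈ J', e x < e m := fun x hx =>
      lt_of_le_of_ne (hle x hx) fun h => hm (he h ▸ hx)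
    have hmU : m ∈ U := hJ (Finset.mem_insert_self _ _)
    have hins : finInd (insert m J') = finInd J' + Pi.single m 1 := by
      ext y
      by_cases hy : y = m
      · subst hy; simp [finInd, hm]
      · simp [finInd, hy]
    have haft : ∀ x ∈ J', addAfter e (insert m J') x B = addAfter e J' x (B + Pi.single m 1) := by
      intro x hx
      ext y
      by_cases hy : y = m
      · subst hy; simp [addAfter, hm, hlt x hx]
      · simp [addAfter, hy]
    have hbef : ∀ x ∈ J', addBefore e (insert m J') x A = addBefore e J' x A := by
      intro x hx
      ext y
      by_cases hy : y = m
      · subst hy; simp [addBefore, hm, (hlt x hx).le]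
      · simp [addBefore, hy]
    have haftm : addAfter e (insert m J') m B = B := by
      ext y
      by_cases hy : y = m
      · subst hy; simp [addAfter]
      · simp only [addAfter, Finset.mem_insert, hy, false_or, Nat.add_eq_left, ite_eq_right_iff]
        rintro ⟨h1, h2⟩
        exact absurd (hlt y h1) (by lia)
    have hbefm : addBefore e (insert m J') m A = A + finInd J' := by
      ext y
      by_cases hy : y = m
      · subst hy; simp [addBefore, hm, finInd]
      · have : (y ∈ J' ∧ e y < e m) ↔ y ∈ J' := ⟨And.left, fun h => ⟨h, hlt y h⟩⟩
        simp [addBefore, hy, finInd, this]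
    rw [Finset.prod_insert hm, hbefm, haftm, hins, ← add_assoc]
    -- This is the intermediate term: all of `J'` is flipped and the last vertex `m` is not. It is
    -- the denominator of the factor for `m` and the numerator of the induction hypothesis.
    have h1 : subZ ζ G U (A + finInd J') (B + Pi.single m 1) ≠ 0 :=
      hZ _ _ fun y _ => by simp only [hins, Pi.add_apply]; ring
    have h3 := hc m (Finset.mem_insert_self _ _)
    rw [hbefm, haftm] at h3
    have h2 := ih (B + Pi.single m 1) (fun x hx => hJ (Finset.mem_insert_of_mem hx))
      (fun A' B' h => hZ A' B' fun y hy => by rw [h y hy, hins]; simp only [Pi.add_apply]; ring)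
      (fun x hx => by
        rw [← haft x hx, ← hbef x hx]
        exact hc x (Finset.mem_insert_of_mem hx))
    rw [Finset.prod_congr rfl fun x hx => by rw [hbef x hx, haft x hx], ← h2,
      ← subZ_single ζ G hγ hmU _ _ h3, add_comm (finInd J'), ← add_assoc B]
    field_simp

end Recursion

/-! # Zero-freeness -/

/-- The part of complex contraction that gives zero-freeness. -/
structure RecInvariant (ζ : SpinParams) (Δ : ℕ) (Q : Set ℂ) : Prop where
  γ_ne : ζ.γ ≠ 0
  lam_mem : ζ.lam ∈ Q
  neg_γ_notMem : -ζ.γ ∉ Q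
  neg_one_notMem : -1 ∉ Q
  recF_mem : ∀ s₁ s₂ k : ℕ, Admissible ζ s₁ → s₁ + s₂ + k < Δ →
    ∀ x : Fin k → ℂ, (∀ i, x i ∈ Q) → recF ζ s₁ s₂ k x ∈ Q
  recF_ne : ∀ s₁ s₂ k : ℕ, Admissible ζ s₁ → s₁ + s₂ + k = Δ →
    ∀ x : Fin k → ℂ, (∀ i, x i ∈ Q) → recF ζ s₁ s₂ k x ≠ -1

/-- The possible values at the vertices below the root; a vertex with a neighbour of spin `+` has
the value `0` if `β = 0`. -/
def ChildValue (ζ : SpinParams) (Q : Set ℂ) (z : ℂ) : Prop := z ∈ Q ∨ ζ.β = 0 ∧ z = 0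

section ZeroFree

set_option linter.unusedSectionVars false

variable {V : Type u} [Fintype V] [DecidableEq V]

/-- The value at a vertex with `a` neighbours pinned to `+`, `b` neighbours pinned to `-`, and a set
`J` of free children with values `c`. -/
noncomputable def nodeVal (ζ : SpinParams) (a b : ℕ) (J : Finset V) (c : V → ℂ) : ℂ :=
  ζ.lam * ζ.β ^ a * (ζ.γ ^ b)⁻¹ * ∏ x ∈ J, fac ζ (c x)

theorem nodeVal_congr (ζ : SpinParams) (a b : ℕ) {J : Finset V} {c c' : V → ℂ}
    (h : ∀ x ∈ J, c x = c' x) : nodeVal ζ a b J c = nodeVal ζ a b J c' := by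
  rw [nodeVal, nodeVal, Finset.prod_congr rfl fun x hx => by rw [h x hx]]

/-- A child of value 0 contributes `fac` = 1/γ, which is the contribution of a neighbour pinned to
−, so it can be counted in `s₂`. -/
theorem nodeVal_eq_recF (ζ : SpinParams) (a b : ℕ) (J J₀ : Finset V) (c : V → ℂ) (hJ : J₀ ⊆ J)
    (h : ∀ x ∈ J₀, c x = 0) :
    nodeVal ζ a b J c =
      recF ζ a (b + J₀.card) (J \ J₀).card fun i => c ((J \ J₀).equivFin.symm i) := by
  have h1 : ∏ i, ((ζ.β * c ((J \ J₀).equivFin.symm i) + 1) / (c ((J \ J₀).equivFin.symm i) + ζ.γ)) =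
      ∏ x ∈ J \ J₀, fac ζ (c x) := by
    rw [← Finset.prod_coe_sort (J \ J₀)]
    exact (J \ J₀).equivFin.symm.prod_comp fun x => fac ζ (c x)
  have h2 : ∏ x ∈ J₀, fac ζ (c x) = (ζ.γ ^ J₀.card)⁻¹ := by
    rw [Finset.prod_congr rfl fun x hx => by rw [h x hx], Finset.prod_const]
    simp [fac]
  rw [nodeVal, recF, h1, ← Finset.prod_sdiff hJ, h2, pow_add, mul_inv]
  ring

variable {ζ : SpinParams} {Δ : ℕ} {Q : Set ℂ}

/-- Children outside `Q` have value 0 and are counted as − neighbours. The remaining arguments lie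
in `Q`, and the total degree is unchanged. -/
theorem nodeVal_exists_recF {a b : ℕ} {J : Finset V} {c : V → ℂ}
    (hc : ∀ x ∈ J, ChildValue ζ Q (c x)) (ha : Admissible ζ a) :
    ∃ s₁ s₂ k : ℕ, Admissible ζ s₁ ∧ s₁ + s₂ + k = a + b + J.card ∧
      ∃ x : Fin k → ℂ, (∀ i, x i ∈ Q) ∧ nodeVal ζ a b J c = recF ζ s₁ s₂ k x := by
  classical
  have hsub : J.filter (fun x => c x ∉ Q) ⊆ J := Finset.filter_subset _ _
  have h0 : ∀ x ∈ J.filter (fun x => c x ∉ Q), c x = 0 := fun x hx => by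
    rw [Finset.mem_filter] at hx
    exact ((hc x hx.1).resolve_left hx.2).2
  refine ⟨a, _, _, ha, ?_, _, fun i => ?_, nodeVal_eq_recF ζ a b J _ c hsub h0⟩
  · have := Finset.card_sdiff_add_card_eq_card hsub
    lia
  · have := ((J \ J.filter (fun x => c x ∉ Q)).equivFin.symm i).2
    simp only [Finset.mem_sdiff, Finset.mem_filter, not_and, not_not] at this
    exact this.2 this.1

theorem nodeVal_forced {a b : ℕ} {J : Finset V} {c : V → ℂ} (ha : ¬Admissible ζ a) :
    ζ.β = 0 ∧ nodeVal ζ a b J c = 0 := by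
  rw [Admissible, Classical.not_imp] at ha
  exact ⟨ha.1, by simp [nodeVal, ha.1, ha.2]⟩

theorem RecInvariant.nodeVal_mem (H : RecInvariant ζ Δ Q) {a b : ℕ} {J : Finset V} {c : V → ℂ}
    (hc : ∀ x ∈ J, ChildValue ζ Q (c x)) (hload : a + b + J.card < Δ) (ha : Admissible ζ a) :
    nodeVal ζ a b J c ∈ Q := by
  obtain ⟨s₁, s₂, k, h1, h2, x, hx, h⟩ := nodeVal_exists_recF (b := b) hc ha
  rw [h]
  exact H.recF_mem s₁ s₂ k h1 (by lia) x hx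

theorem RecInvariant.childValue_nodeVal (H : RecInvariant ζ Δ Q) {a b : ℕ} {J : Finset V}
    {c : V → ℂ} (hc : ∀ x ∈ J, ChildValue ζ Q (c x)) (hload : a + b + J.card < Δ) :
    ChildValue ζ Q (nodeVal ζ a b J c) := by
  by_cases ha : Admissible ζ a
  · exact Or.inl (H.nodeVal_mem hc hload ha)
  · exact Or.inr (nodeVal_forced ha)

/-- Below degree Δ the value lies in `Q`, which avoids −1; at degree Δ the second half of condition
1 applies; a + neighbour with β = 0 forces the value 0. -/
theorem RecInvariant.nodeVal_ne (H : RecInvariant ζ Δ Q) {a b : ℕ} {J : Finset V} {c : V → ℂ}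
    (hc : ∀ x ∈ J, ChildValue ζ Q (c x)) (hload : a + b + J.card ≤ Δ) :
    1 + nodeVal ζ a b J c ≠ 0 := by
  suffices nodeVal ζ a b J c ≠ -1 from fun h => this (by linear_combination h)
  by_cases ha : Admissible ζ a
  · obtain ⟨s₁, s₂, k, h1, h2, x, hx, h⟩ := nodeVal_exists_recF (b := b) hc ha
    rw [h]
    rcases hload.lt_or_eq with hlt | heq
    · exact fun h' => H.neg_one_notMem (h' ▸ H.recF_mem s₁ s₂ k h1 (by lia) x hx)
    · exact H.recF_ne s₁ s₂ k h1 (by lia) x hx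
  · rw [(nodeVal_forced ha).2]
    simp

/-- Every vertex of `U` has at most `Δ` neighbours, including the pinned ones. -/
def LoadLE (G : SimpleGraph V) [DecidableRel G.Adj] (Δ : ℕ) (U : Finset V) (A B : V → ℕ) : Prop :=
  ∀ y ∈ U, A y + B y + (U.filter (G.Adj y)).card ≤ Δ

/-- Every vertex of `U` has at most `Δ` neighbours, including the pinned ones and `v`. -/
def NodeLoadLE (G : SimpleGraph V) [DecidableRel G.Adj] (Δ : ℕ) (U : Finset V) (A B : V → ℕ)
    (v : V) : Prop :=
  ∀ y ∈ U, A y + B y + (U.filter (G.Adj y)).card + adjInd G v y ≤ Δ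

variable {G : SimpleGraph V} [DecidableRel G.Adj] {U : Finset V} {A B : V → ℕ} {v : V}

/-- The load at `y` does not grow: the edge to `x` leaves the induced graph and reappears as the
parent edge, and the edge to `v` is replaced by at most one half edge, since `y` cannot come both
before and after `x`. -/
theorem NodeLoadLE.child (h : NodeLoadLE G Δ U A B v) (e : V → ℕ) {x : V} (hx : x ∈ U) :
    NodeLoadLE G Δ (U.erase x) (addBefore e (U.filter (G.Adj v)) x A)
      (addAfter e (U.filter (G.Adj v)) x B) x := by
  intro y hy
  obtain ⟨hyx, hyU⟩ := Finset.mem_erase.1 hy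
  have h1 := h y hyU
  have h2 : ((U.erase x).filter (G.Adj y)).card + adjInd G x y ≤ (U.filter (G.Adj y)).card := by
    by_cases hxy : G.Adj x y
    · have h4 : U.filter (G.Adj y) = insert x ((U.erase x).filter (G.Adj y)) := by
        ext z
        have := hxy.symm
        simp only [Finset.mem_filter, Finset.mem_insert, Finset.mem_erase]
        grind
      rw [h4, Finset.card_insert_of_notMem (by simp)]
      simp [adjInd, hxy]
    · simpa [adjInd, hxy] using Finset.card_le_card
        (Finset.filter_subset_filter _ (Finset.erase_subset x U))
  have h3 : y ∈ U.filter (G.Adj v) ↔ G.Adj v y := by simp [hyU]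
  simp only [addBefore, addAfter, h3]
  have h4 : (if G.Adj v y ∧ e y < e x then 1 else 0) + (if G.Adj v y ∧ e x < e y then 1 else 0) ≤
      adjInd G v y := by
    simp only [adjInd]
    split_ifs <;> lia
  lia

/-- The inequality is strict because the edge to the parent `v` uses one of the Δ places and is no
longer counted. This is what makes the invariance of `Q` applicable below the root. -/
theorem NodeLoadLE.child_load (h : NodeLoadLE G Δ U A B v) (e : V → ℕ) {x : V}
    (hx : x ∈ U.filter (G.Adj v)) :
    addBefore e (U.filter (G.Adj v)) x A x + addAfter e (U.filter (G.Adj v)) x B x +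
      ((U.erase x).filter (G.Adj x)).card < Δ := by
  rw [Finset.mem_filter] at hx
  have h1 := h x hx.1
  have h2 := Finset.card_le_card (Finset.filter_subset_filter (G.Adj x) (Finset.erase_subset x U))
  simp only [addBefore, addAfter, lt_irrefl, and_false, if_false, adjInd, hx.2, if_true] at h1 ⊢
  lia

theorem NodeLoadLE.loadLE_after (h : NodeLoadLE G Δ U A B v) {A' B' : V → ℕ}
    (h' : ∀ y ∈ U, A' y + B' y ≤ A y + B y + adjInd G v y) : LoadLE G Δ U A' B' := by
  intro y hy
  have := h y hy
  have := h' y hy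
  lia

theorem LoadLE.nodeLoadLE {x : V} (h : LoadLE G Δ U A B) (hx : x ∈ U) :
    NodeLoadLE G Δ (U.erase x) A B x := by
  intro y hy
  have h1 := h y (Finset.mem_of_mem_erase hy)
  have h2 : ((U.erase x).filter (G.Adj y)).card + adjInd G x y ≤ (U.filter (G.Adj y)).card := by
    by_cases hxy : G.Adj x y
    · have h4 : U.filter (G.Adj y) = insert x ((U.erase x).filter (G.Adj y)) := by
        ext z
        have := hxy.symm
        simp only [Finset.mem_filter, Finset.mem_insert, Finset.mem_erase]
        grind
      rw [h4, Finset.card_insert_of_notMem (by simp)]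
      simp [adjInd, hxy]
    · simpa [adjInd, hxy] using Finset.card_le_card
        (Finset.filter_subset_filter _ (Finset.erase_subset x U))
  lia

theorem LoadLE.node_load {x : V} (h : LoadLE G Δ U A B) (hx : x ∈ U) :
    A x + B x + ((U.erase x).filter (G.Adj x)).card ≤ Δ := by
  have h1 := h x hx
  have h2 := Finset.card_le_card (Finset.filter_subset_filter (G.Adj x) (Finset.erase_subset x U))
  lia

/-- The tree recursion. Nonvanishing is assumed only on subsets of `U`, so that the identity is
available inside the induction that proves nonvanishing. -/
theorem nodeRatio_eq_nodeVal_of_ne (hγ : ζ.γ ≠ 0) {e : V → ℕ} (he : Function.Injective e)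
    (hZ : ∀ W ⊆ U, ∀ A' B' : V → ℕ, LoadLE G Δ W A' B' → subZ ζ G W A' B' ≠ 0)
    (h : NodeLoadLE G Δ U A B v) :
    nodeRatio ζ G U A B v = nodeVal ζ (A v) (B v) (U.filter (G.Adj v)) fun x =>
      nodeRatio ζ G (U.erase x) (addBefore e (U.filter (G.Adj v)) x A)
        (addAfter e (U.filter (G.Adj v)) x B) x := by
  have hind : ∀ C : V → ℕ, ∀ y ∈ U, (C + adjInd G v) y = (C + finInd (U.filter (G.Adj v))) y := by
    intro C y hy
    simp [adjInd, finInd, hy]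
  rw [nodeVal, ← subZ_telescope ζ G hγ he A _ B (Finset.filter_subset _ _), nodeRatio,
    subZ_congr ζ G (hind A) (fun _ _ => rfl), subZ_congr ζ G (fun _ _ => rfl) (hind B)]
  · field_simp
  · intro A' B' h'
    refine hZ U subset_rfl A' B' (h.loadLE_after fun y hy => ?_)
    rw [h' y hy]
    have := hind B y hy
    simp only [Pi.add_apply] at this
    lia
  · intro x hx
    exact hZ _ (Finset.erase_subset _ _) _ _
      ((h.child e (Finset.mem_of_mem_filter x hx)).loadLE_after fun y _ => by
        simp only [Pi.add_apply]; lia)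

/-- Both claims need each other: nonvanishing on `U` follows from the child values on smaller sets,
and the value of a vertex over `U` uses the recursion, hence nonvanishing on `U` itself. So `key`
comes first at each size. -/
theorem RecInvariant.zeroFree_aux (H : RecInvariant ζ Δ Q) {e : V → ℕ}
    (he : Function.Injective e) (n : ℕ) : ∀ U : Finset V, U.card = n →
    (∀ A B : V → ℕ, LoadLE G Δ U A B → subZ ζ G U A B ≠ 0) ∧
    ∀ (A B : V → ℕ) (v : V), NodeLoadLE G Δ U A B v →
      A v + B v + (U.filter (G.Adj v)).card < Δ → ChildValue ζ Q (nodeRatio ζ G U A B v) := by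
  induction n using Nat.strong_induction_on with
  | _ n ih =>
    intro U hU
    have hcard : ∀ x ∈ U, (U.erase x).card < n := fun x hx => hU ▸ Finset.card_erase_lt_of_mem hx
    have key : ∀ A B : V → ℕ, LoadLE G Δ U A B → subZ ζ G U A B ≠ 0 := by
      intro A B h
      rcases U.eq_empty_or_nonempty with rfl | ⟨u, hu⟩
      · simp [subZ_empty]
      have hsub : ∀ W ⊆ U.erase u, W.card < n := fun W hW =>
        (Finset.card_le_card hW).trans_lt (hcard u hu)
      have hN := h.nodeLoadLE hu
      have h0 : subZ ζ G (U.erase u) A (B + adjInd G u) ≠ 0 :=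
        (ih _ (hcard u hu) _ rfl).1 _ _ (hN.loadLE_after fun y _ => by
          simp only [Pi.add_apply]; lia)
      rw [← Finset.insert_erase hu, subZ_insert_eq ζ G H.γ_ne (Finset.notMem_erase u U) A B h0]
      refine mul_ne_zero (mul_ne_zero (pow_ne_zero _ H.γ_ne) h0) ?_
      rw [nodeRatio_eq_nodeVal_of_ne H.γ_ne he
        (fun W hW A' B' hL => (ih _ (hsub W hW) W rfl).1 A' B' hL) hN]
      refine H.nodeVal_ne (fun x hx => ?_) (h.node_load hu)
      exact (ih _ (hsub _ (Finset.erase_subset x _)) _ rfl).2 _ _ _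
        (hN.child e (Finset.mem_of_mem_filter x hx)) (hN.child_load e hx)
    refine ⟨key, fun A B v h hload => ?_⟩
    rw [nodeRatio_eq_nodeVal_of_ne H.γ_ne he (fun W hW A' B' hL => ?_) h]
    · refine H.childValue_nodeVal (fun x hx => ?_) hload
      exact (ih _ (hcard x (Finset.mem_of_mem_filter x hx)) _ rfl).2 _ _ _
        (h.child e (Finset.mem_of_mem_filter x hx)) (h.child_load e hx)
    · rcases hW.eq_or_ssubset with rfl | hlt
      · exact key A' B' hL
      · exact (ih _ (hU ▸ Finset.card_lt_card hlt) W rfl).1 A' B' hL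

theorem RecInvariant.subZ_ne_zero (H : RecInvariant ζ Δ Q) (h : LoadLE G Δ U A B) :
    subZ ζ G U A B ≠ 0 :=
  (H.zeroFree_aux (e := fun v => Fintype.equivFin V v)
    (Fin.val_injective.comp (Fintype.equivFin V).injective) _ U rfl).1 A B h

theorem RecInvariant.childValue_nodeRatio (H : RecInvariant ζ Δ Q) (h : NodeLoadLE G Δ U A B v)
    (hload : A v + B v + (U.filter (G.Adj v)).card < Δ) :
    ChildValue ζ Q (nodeRatio ζ G U A B v) :=
  (H.zeroFree_aux (e := fun v => Fintype.equivFin V v)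
    (Fin.val_injective.comp (Fintype.equivFin V).injective) _ U rfl).2 A B v h hload

theorem RecInvariant.nodeRatio_eq_nodeVal (H : RecInvariant ζ Δ Q) {e : V → ℕ}
    (he : Function.Injective e) (h : NodeLoadLE G Δ U A B v) :
    nodeRatio ζ G U A B v = nodeVal ζ (A v) (B v) (U.filter (G.Adj v)) fun x =>
      nodeRatio ζ G (U.erase x) (addBefore e (U.filter (G.Adj v)) x A)
        (addAfter e (U.filter (G.Adj v)) x B) x :=
  nodeRatio_eq_nodeVal_of_ne H.γ_ne he (fun _ _ _ _ hL => H.subZ_ne_zero hL) h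

end ZeroFree

/-! # Contraction in the transformed coordinates -/

section Contraction

/-- The 1-norm is dual to the sup norm on `Fin k → ℂ`, so condition 2 bounds the operator norm and
gives a Lipschitz constant for the sup norm. -/
theorem norm_fderiv_le_gradNorm₁ {k : ℕ} (f : (Fin k → ℂ) → ℂ) (x : Fin k → ℂ) :
    ‖fderiv ℂ f x‖ ≤ gradNorm₁ f x := by
  refine ContinuousLinearMap.opNorm_le_bound _ (Finset.sum_nonneg fun _ _ => norm_nonneg _) ?_
  intro v
  have hv : v = ∑ i, v i • (Pi.single i 1 : Fin k → ℂ) := by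
    ext j
    simp [Finset.sum_apply, Pi.single_apply]
  conv_lhs => rw [hv]
  rw [map_sum, gradNorm₁, Finset.sum_mul]
  refine (norm_sum_le _ _).trans (Finset.sum_le_sum fun i _ => ?_)
  rw [map_smul, norm_smul, mul_comm]
  exact mul_le_mul_of_nonneg_left (norm_le_pi_norm v i) (norm_nonneg _)

/-- What complex contraction provides: a compact invariant set with a coordinate `φ` in which the
recursion functions contract by the factor `ρ`. -/
structure RecContraction (ζ : SpinParams) (Δ : ℕ) (Q : Set ℂ) (φ : ℂ → ℂ) (ρ D L : ℝ) : Prop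
    extends RecInvariant ζ Δ Q where
  isCompact : IsCompact Q
  ρ_pos : 0 < ρ
  ρ_lt : ρ < 1
  D_nonneg : 0 ≤ D
  L_nonneg : 0 ≤ L
  norm_sub_le : ∀ x ∈ Q, ∀ y ∈ Q, ‖φ x - φ y‖ ≤ D
  norm_sub_le_mul : ∀ x ∈ Q, ∀ y ∈ Q, ‖x - y‖ ≤ L * ‖φ x - φ y‖
  contract : ∀ s₁ s₂ k : ℕ, Admissible ζ s₁ → s₁ + s₂ + k < Δ → ∀ x y : Fin k → ℂ,
    (∀ i, x i ∈ Q) → (∀ i, y i ∈ Q) → ∀ r : ℝ, 0 ≤ r → (∀ i, ‖φ (x i) - φ (y i)‖ ≤ r) →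
      ‖φ (recF ζ s₁ s₂ k x) - φ (recF ζ s₁ s₂ k y)‖ ≤ ρ * r

theorem differentiableAt_recF {ζ : SpinParams} (s₁ s₂ k : ℕ) {x : Fin k → ℂ}
    (hx : ∀ i, x i + ζ.γ ≠ 0) : DifferentiableAt ℂ (recF ζ s₁ s₂ k) x := by
  unfold recF
  have h : ∀ i ∈ Finset.univ, HasFDerivAt (fun x : Fin k → ℂ => (ζ.β * x i + 1) / (x i + ζ.γ)) _ x :=
    fun i _ => by
      have d1 : DifferentiableAt ℂ (fun x : Fin k → ℂ => ζ.β * x i + 1) x := by fun_prop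
      have d2 : DifferentiableAt ℂ (fun x : Fin k → ℂ => x i + ζ.γ) x := by fun_prop
      exact (d1.mul (d2.inv (hx i))).hasFDerivAt
  exact (HasFDerivAt.finsetProd h).differentiableAt.const_mul _

theorem ComplexContraction.exists_recContraction {ζ : SpinParams} {Δ : ℕ} (hγ : ζ.γ ≠ 0)
    (h : ComplexContraction ζ Δ) :
    ∃ (Q : Set ℂ) (φ : ℂ → ℂ) (ρ D L : ℝ), RecContraction ζ Δ Q φ ρ D L := by
  obtain ⟨Q, P, φ, ψ, hQc, hQb, hlam, hg, h1, hP, hφ, hψ, hinv, hφa, hψa, hmem, hne, η, hη, hgrad⟩ :=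
    h
  have hQ : IsCompact Q := Metric.isCompact_of_isClosed_isBounded hQc hQb
  have hPc : IsCompact P := by
    -- `P` inherits compactness from `Q`. This bounds the derivative of the inverse coordinate,
    -- giving `L`, and the diameter of `P`, giving `D`.
    have : P = φ '' Q := Set.Subset.antisymm
      (fun y hy => ⟨ψ y, hψ hy, hinv.2 hy⟩) hφ.image_subset
    rw [this]
    exact hQ.image_of_continuousOn hφa.continuousOn
  obtain ⟨L, hL⟩ := hPc.exists_bound_of_continuousOn hψa.deriv.continuousOn
  obtain ⟨D, hD⟩ := Metric.isBounded_iff.1 hPc.isBounded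
  have hD' : ∀ x ∈ Q, ∀ y ∈ Q, ‖φ x - φ y‖ ≤ D := fun x hx y hy => by
    rw [← dist_eq_norm]
    exact hD (hφ hx) (hφ hy)
  have hL0 : 0 ≤ L := (norm_nonneg _).trans (hL (φ ζ.lam) (hφ hlam))
  have hD0 : 0 ≤ D := (norm_nonneg _).trans (hD' _ hlam _ hlam)
  -- The given η may be 1 or larger; the cap at 1/2 keeps the contraction factor positive, so that
  -- its logarithm and negative powers can be used.
  refine ⟨Q, φ, 1 - min η (1 / 2), D, L, ⟨⟨hγ, hlam, hg, h1, hmem, hne⟩, hQ, ?_, ?_, hD0, hL0, hD',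
    ?_, ?_⟩⟩
  · linarith [min_le_right η (1 / 2)]
  · linarith [lt_min hη (by norm_num : (0 : ℝ) < 1 / 2)]
  · intro x hx y hy
    -- Convexity of `P`, and below of its powers, enters only through the mean value inequality.
    have := hP.norm_image_sub_le_of_norm_deriv_le (fun z hz => (hψa z hz).differentiableAt) hL
      (hφ hy) (hφ hx)
    rwa [hinv.1 hx, hinv.1 hy] at this
  · intro s₁ s₂ k ha hs x y hx hy r hr hxy
    have hconv : Convex ℝ (Set.pi Set.univ fun _ : Fin k => P) := convex_pi fun _ _ => hP
    have hdiff : ∀ z ∈ Set.pi Set.univ fun _ : Fin k => P,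
        DifferentiableAt ℂ (fun z => φ (recF ζ s₁ s₂ k fun i => ψ (z i))) z := by
      intro z hz
      have hz' : ∀ i, z i ∈ P := fun i => hz i (Set.mem_univ i)
      have d1 : DifferentiableAt ℂ (fun (z : Fin k → ℂ) i => ψ (z i)) z := by
        refine differentiableAt_pi.2 fun i => ?_
        exact (hψa _ (hz' i)).differentiableAt.comp z (differentiableAt_apply i z)
      have d2 : DifferentiableAt ℂ (recF ζ s₁ s₂ k) (fun i => ψ (z i)) :=
        differentiableAt_recF _ _ _ fun i h0 =>
          hg (eq_neg_of_add_eq_zero_left h0 ▸ hψ (hz' i))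
      have d3 := (hφa _ (hmem s₁ s₂ k ha hs _ fun i => hψ (hz' i))).differentiableAt
      have d4 : DifferentiableAt ℂ (recF ζ s₁ s₂ k ∘ fun z i => ψ (z i)) z :=
        DifferentiableAt.comp z d2 d1
      exact DifferentiableAt.comp (g := φ) z d3 d4
    have hbound : ∀ z ∈ Set.pi Set.univ fun _ : Fin k => P,
        ‖fderiv ℂ (fun z => φ (recF ζ s₁ s₂ k fun i => ψ (z i))) z‖ ≤ 1 - min η (1 / 2) :=
      fun z hz => ((norm_fderiv_le_gradNorm₁ _ _).trans
        (hgrad s₁ s₂ k ha hs z fun i => hz i (Set.mem_univ i))).trans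
          (by linarith [min_le_left η (1 / 2)])
    have := hconv.norm_image_sub_le_of_norm_fderiv_le hdiff hbound
      (x := fun i => φ (y i)) (y := fun i => φ (x i)) (fun i _ => hφ (hy i)) (fun i _ => hφ (hx i))
    simp only [hinv.1 (hx _), hinv.1 (hy _)] at this
    refine this.trans (mul_le_mul_of_nonneg_left ?_ (by linarith [min_le_right η (1 / 2)]))
    exact (pi_norm_le_iff_of_nonneg hr).2 hxy

end Contraction

/-! # Lipschitz bounds for the recursion -/

section Lipschitz

/-- Two products of `n` factors of norm at most `M` whose corresponding factors differ by at
most `r`. -/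
structure ClosePair (M r : ℝ) (n : ℕ) (z w : ℂ) : Prop where
  left : ‖z‖ ≤ M ^ n
  right : ‖w‖ ≤ M ^ n
  sub : ‖z - w‖ ≤ n * M ^ n * r

/-- The product rule zz' − ww' = z(z' − w') + (z − w)w' makes the coefficient of the error additive
in the number of factors, hence the shape n · M^n · r. -/
theorem ClosePair.mul {M r : ℝ} {m n : ℕ} {z w z' w' : ℂ} (hM : 0 ≤ M)
    (h : ClosePair M r m z w) (h' : ClosePair M r n z' w') :
    ClosePair M r (m + n) (z * z') (w * w') := by
  have hm := pow_nonneg hM m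
  have hn := pow_nonneg hM n
  refine ⟨?_, ?_, ?_⟩
  · rw [norm_mul, pow_add]
    exact mul_le_mul h.left h'.left (norm_nonneg _) hm
  · rw [norm_mul, pow_add]
    exact mul_le_mul h.right h'.right (norm_nonneg _) hm
  · have : z * z' - w * w' = z * (z' - w') + (z - w) * w' := by ring
    rw [this]
    refine (norm_add_le _ _).trans ?_
    rw [norm_mul, norm_mul]
    have h1 := mul_le_mul h.left h'.sub (norm_nonneg _) hm
    have h2 := mul_le_mul h.sub h'.right (norm_nonneg _) ((norm_nonneg _).trans h.sub)
    refine (add_le_add h1 h2).trans (le_of_eq ?_)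
    push_cast
    ring

theorem ClosePair.one (M r : ℝ) : ClosePair M r 0 1 1 := ⟨by simp, by simp, by simp⟩

theorem ClosePair.pow {M r : ℝ} {z w : ℂ} (hM : 0 ≤ M) (h : ClosePair M r 1 z w) (n : ℕ) :
    ClosePair M r n (z ^ n) (w ^ n) := by
  induction n with
  | zero => simpa using ClosePair.one M r
  | succ n ih => simpa only [pow_succ] using ih.mul hM h

theorem ClosePair.prod {ι : Type*} {M r : ℝ} (hM : 0 ≤ M) (s : Finset ι) {f g : ι → ℂ}
    (h : ∀ i ∈ s, ClosePair M r 1 (f i) (g i)) :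
    ClosePair M r s.card (∏ i ∈ s, f i) (∏ i ∈ s, g i) := by
  classical
  induction s using Finset.induction_on with
  | empty => simpa using ClosePair.one M r
  | insert a s ha ih =>
    rw [Finset.prod_insert ha, Finset.prod_insert ha, Finset.card_insert_of_notMem ha, add_comm]
    exact (h a (Finset.mem_insert_self a s)).mul hM
      (ih fun i hi => h i (Finset.mem_insert_of_mem hi))

theorem ClosePair.mono {M r : ℝ} {m n : ℕ} {z w : ℂ} (hM : 1 ≤ M) (hr : 0 ≤ r)
    (h : ClosePair M r m z w) (hmn : m ≤ n) : ClosePair M r n z w := by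
  have h1 := pow_le_pow_right₀ hM hmn
  refine ⟨h.left.trans h1, h.right.trans h1, h.sub.trans ?_⟩
  gcongr

/-- The distance of two parameter vectors. -/
noncomputable def paramDist (ζ ζ' : SpinParams) : ℝ :=
  max ‖ζ.β - ζ'.β‖ (max ‖ζ.γ - ζ'.γ‖ ‖ζ.lam - ζ'.lam‖)

theorem paramDist_self (ζ : SpinParams) : paramDist ζ ζ = 0 := by simp [paramDist]

theorem paramDist_nonneg (ζ ζ' : SpinParams) : 0 ≤ paramDist ζ ζ' :=
  (norm_nonneg _).trans (le_max_left _ _)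

/-- Parameters that are bounded by `K` and bounded away from the pole. -/
structure ParamBound (κ K : ℝ) (ζ : SpinParams) : Prop where
  γ_ge : κ ≤ ‖ζ.γ‖
  β_le : ‖ζ.β‖ ≤ K
  γ_le : ‖ζ.γ‖ ≤ K
  lam_le : ‖ζ.lam‖ ≤ K

/-- Arguments of the recursion that are bounded by `K` and bounded away from the pole. -/
structure ArgBound (κ K : ℝ) (ζ : SpinParams) (x : ℂ) : Prop where
  ge : κ ≤ ‖x + ζ.γ‖
  le : ‖x‖ ≤ K

/-- A bound for the factors of the recursion and for their Lipschitz constants. -/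
noncomputable def facBound (κ K : ℝ) : ℝ := K + 1 / κ + (1 / κ) ^ 2 + (K ^ 2 + 1) / κ +
  (4 * K ^ 2 + 2 * (K ^ 2 + 1)) / κ ^ 2 + 1

theorem closePair_fac {κ K r : ℝ} {ζ ζ' : SpinParams} {x x' : ℂ} (hκ : 0 < κ) (hK : 0 ≤ K)
    (h : ParamBound κ K ζ) (h' : ParamBound κ K ζ') (hx : ArgBound κ K ζ x)
    (hx' : ArgBound κ K ζ' x') (hr : paramDist ζ ζ' ≤ r) (hxr : ‖x - x'‖ ≤ r) :
    ClosePair (facBound κ K) r 1 (fac ζ x) (fac ζ' x') := by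
  have hr0 : 0 ≤ r := (norm_nonneg _).trans hxr
  have hb : ∀ {ζ x}, ParamBound κ K ζ → ArgBound κ K ζ x → ‖fac ζ x‖ ≤ (K ^ 2 + 1) / κ := by
    intro ζ x h hx
    rw [fac, norm_div]
    refine div_le_div₀ (by positivity) ?_ hκ hx.ge
    refine (norm_add_le _ _).trans ?_
    rw [norm_mul, norm_one, sq]
    gcongr
    exacts [h.β_le, hx.le]
  have hle : (K ^ 2 + 1) / κ ≤ facBound κ K := by
    have : 0 ≤ (4 * K ^ 2 + 2 * (K ^ 2 + 1)) / κ ^ 2 := by positivity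
    have : 0 ≤ 1 / κ := by positivity
    unfold facBound
    nlinarith
  have hle' : (4 * K ^ 2 + 2 * (K ^ 2 + 1)) / κ ^ 2 ≤ facBound κ K := by
    have : 0 ≤ (K ^ 2 + 1) / κ := by positivity
    have : 0 ≤ 1 / κ := by positivity
    unfold facBound
    nlinarith
  refine ⟨by simpa using (hb h hx).trans hle, by simpa using (hb h' hx').trans hle, ?_⟩
  have hn : x + ζ.γ ≠ 0 := norm_pos_iff.1 (hκ.trans_le hx.ge)
  have hn' : x' + ζ'.γ ≠ 0 := norm_pos_iff.1 (hκ.trans_le hx'.ge)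
  have hβ : ‖ζ.β - ζ'.β‖ ≤ r := (le_max_left _ _).trans hr
  have hγ : ‖ζ.γ - ζ'.γ‖ ≤ r := (le_max_left _ _).trans ((le_max_right _ _).trans hr)
  -- Over the common denominator, each summand of the numerator carries a difference of arguments or
  -- of parameters, so it is at most a constant times `r`.
  have key : fac ζ x - fac ζ' x' = ((ζ.β * (x - x') + (ζ.β - ζ'.β) * x') * (x' + ζ'.γ) -
      (ζ'.β * x' + 1) * ((x - x') + (ζ.γ - ζ'.γ))) / ((x + ζ.γ) * (x' + ζ'.γ)) := by
    rw [fac, fac, div_sub_div _ _ hn hn']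
    congr 1
    ring
  have e1 : ‖(ζ.β * (x - x') + (ζ.β - ζ'.β) * x') * (x' + ζ'.γ)‖ ≤ (K * r + r * K) * (K + K) := by
    rw [norm_mul]
    refine mul_le_mul ((norm_add_le _ _).trans ?_) ((norm_add_le _ _).trans ?_) (norm_nonneg _)
      (by positivity)
    · rw [norm_mul, norm_mul]
      gcongr
      exacts [h.β_le, hx'.le]
    · exact add_le_add hx'.le h'.γ_le
  have e2 : ‖(ζ'.β * x' + 1) * ((x - x') + (ζ.γ - ζ'.γ))‖ ≤ (K * K + 1) * (r + r) := by
    rw [norm_mul]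
    refine mul_le_mul ((norm_add_le _ _).trans ?_) ((norm_add_le _ _).trans ?_) (norm_nonneg _)
      (by positivity)
    · rw [norm_mul, norm_one]
      gcongr
      exacts [h'.β_le, hx'.le]
    · exact add_le_add hxr hγ
  rw [key, norm_div, norm_mul]
  calc _ ≤ ((K * r + r * K) * (K + K) + (K * K + 1) * (r + r)) / (κ * κ) := by
        refine div_le_div₀ (by positivity) ((norm_sub_le _ _).trans (add_le_add e1 e2))
          (by positivity) (mul_le_mul hx.ge hx'.ge hκ.le (norm_nonneg _))
    _ = (4 * K ^ 2 + 2 * (K ^ 2 + 1)) / κ ^ 2 * r := by ring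
    _ ≤ _ := by
        simp only [Nat.cast_one, one_mul, pow_one]
        exact mul_le_mul_of_nonneg_right hle' hr0

theorem one_le_facBound {κ K : ℝ} (hκ : 0 < κ) (hK : 0 ≤ K) : 1 ≤ facBound κ K := by
  unfold facBound
  have : 0 ≤ 1 / κ := by positivity
  have : 0 ≤ (K ^ 2 + 1) / κ := by positivity
  have : 0 ≤ (4 * K ^ 2 + 2 * (K ^ 2 + 1)) / κ ^ 2 := by positivity
  nlinarith

theorem closePair_param {κ K r : ℝ} {ζ ζ' : SpinParams} (hκ : 0 < κ) (hK : 0 ≤ K)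
    (h : ParamBound κ K ζ) (h' : ParamBound κ K ζ') (hr : paramDist ζ ζ' ≤ r) :
    ClosePair (facBound κ K) r 1 ζ.lam ζ'.lam ∧ ClosePair (facBound κ K) r 1 ζ.β ζ'.β ∧
      ClosePair (facBound κ K) r 1 ζ.γ ζ'.γ ∧ ClosePair (facBound κ K) r 1 ζ.γ⁻¹ ζ'.γ⁻¹ := by
  have hr0 : 0 ≤ r := (paramDist_nonneg _ _).trans hr
  have hM := one_le_facBound hκ hK
  have p1 : 0 ≤ 1 / κ := by positivity
  have p2 : 0 ≤ (K ^ 2 + 1) / κ := by positivity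
  have p3 : 0 ≤ (4 * K ^ 2 + 2 * (K ^ 2 + 1)) / κ ^ 2 := by positivity
  have hKM : K ≤ facBound κ K := by unfold facBound; nlinarith
  have hκM : 1 / κ ≤ facBound κ K := by unfold facBound; nlinarith
  have hκM' : (1 / κ) ^ 2 ≤ facBound κ K := by unfold facBound; nlinarith
  have hrM : r ≤ facBound κ K * r := le_mul_of_one_le_left hr0 hM
  have hβ : ‖ζ.β - ζ'.β‖ ≤ r := (le_max_left _ _).trans hr
  have hγ : ‖ζ.γ - ζ'.γ‖ ≤ r := (le_max_left _ _).trans ((le_max_right _ _).trans hr)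
  have hl : ‖ζ.lam - ζ'.lam‖ ≤ r := (le_max_right _ _).trans ((le_max_right _ _).trans hr)
  have hi : ∀ {ζ}, ParamBound κ K ζ → ‖ζ.γ⁻¹‖ ≤ 1 / κ := fun {ζ} h => by
    rw [norm_inv, one_div]
    exact inv_anti₀ hκ h.γ_ge
  have hn : ζ.γ ≠ 0 := norm_pos_iff.1 (hκ.trans_le h.γ_ge)
  have hn' : ζ'.γ ≠ 0 := norm_pos_iff.1 (hκ.trans_le h'.γ_ge)
  refine ⟨⟨?_, ?_, ?_⟩, ⟨?_, ?_, ?_⟩, ⟨?_, ?_, ?_⟩, ?_, ?_, ?_⟩ <;>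
    simp only [pow_one, Nat.cast_one, one_mul]
  · exact h.lam_le.trans hKM
  · exact h'.lam_le.trans hKM
  · exact hl.trans hrM
  · exact h.β_le.trans hKM
  · exact h'.β_le.trans hKM
  · exact hβ.trans hrM
  · exact h.γ_le.trans hKM
  · exact h'.γ_le.trans hKM
  · exact hγ.trans hrM
  · exact (hi h).trans hκM
  · exact (hi h').trans hκM
  · have : ζ.γ⁻¹ - ζ'.γ⁻¹ = -(ζ.γ⁻¹ * ζ'.γ⁻¹ * (ζ.γ - ζ'.γ)) := by
      field_simp
      ring
    rw [this, norm_neg, norm_mul, norm_mul]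
    refine mul_le_mul (le_trans ?_ hκM') hγ (norm_nonneg _) (by linarith)
    rw [sq]
    exact mul_le_mul (hi h) (hi h') (norm_nonneg _) p1

theorem closePair_nodeVal {V : Type u} [Fintype V] [DecidableEq V] {κ K r : ℝ}
    {ζ ζ' : SpinParams} (hκ : 0 < κ) (hK : 0 ≤ K)
    (h : ParamBound κ K ζ) (h' : ParamBound κ K ζ') (hr : paramDist ζ ζ' ≤ r)
    {a b : ℕ} {J : Finset V} {c c' : V → ℂ} (hc : ∀ x ∈ J, ArgBound κ K ζ (c x))
    (hc' : ∀ x ∈ J, ArgBound κ K ζ' (c' x)) (hcr : ∀ x ∈ J, ‖c x - c' x‖ ≤ r) :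
    ClosePair (facBound κ K) r (1 + a + b + J.card) (nodeVal ζ a b J c) (nodeVal ζ' a b J c') := by
  have hM : 0 ≤ facBound κ K := zero_le_one.trans (one_le_facBound hκ hK)
  obtain ⟨h1, h2, -, h3⟩ := closePair_param hκ hK h h' hr
  rw [nodeVal, nodeVal, ← inv_pow, ← inv_pow]
  exact ((h1.mul hM (h2.pow hM a)).mul hM (h3.pow hM b)).mul hM
    (ClosePair.prod hM J fun x hx => closePair_fac hκ hK h h' (hc x hx) (hc' x hx) hr (hcr x hx))

end Lipschitz

/-! # Truncation of the recursion -/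

section Truncation

set_option linter.unusedSectionVars false

variable {V : Type u} [Fintype V] [DecidableEq V]

/-- The value at `v` of the recursion truncated at depth `d`. -/
noncomputable def truncVal (ζ : SpinParams) (G : SimpleGraph V) [DecidableRel G.Adj] (e : V → ℕ) :
    ℕ → Finset V → (V → ℕ) → (V → ℕ) → V → ℂ
  | 0, _, _, _, _ => ζ.lam
  | d + 1, U, A, B, v => nodeVal ζ (A v) (B v) (U.filter (G.Adj v)) fun x =>
      truncVal ζ G e d (U.erase x) (addBefore e (U.filter (G.Adj v)) x A)
        (addAfter e (U.filter (G.Adj v)) x B) x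

variable {ζ : SpinParams} {Δ : ℕ} {Q : Set ℂ} {G : SimpleGraph V} [DecidableRel G.Adj]

theorem RecInvariant.childValue_truncVal (H : RecInvariant ζ Δ Q) (e : V → ℕ) (d : ℕ) :
    ∀ {U : Finset V} {A B : V → ℕ} {v : V}, NodeLoadLE G Δ U A B v →
      A v + B v + (U.filter (G.Adj v)).card < Δ → ChildValue ζ Q (truncVal ζ G e d U A B v) := by
  induction d with
  | zero => exact fun _ _ => Or.inl H.lam_mem
  | succ d ih =>
    intro U A B v h hload
    exact H.childValue_nodeVal (fun x hx =>
      ih (h.child e (Finset.mem_of_mem_filter x hx)) (h.child_load e hx)) hload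

/-- Each level of the recursion moves along one edge, so truncation at depth d reads only the ball
of radius d around `v`. -/
theorem truncVal_congr (e : V → ℕ) (d : ℕ) :
    ∀ {U U' : Finset V} {A B A' B' : V → ℕ} {v : V},
      (∀ y, G.edist v y ≤ d → (y ∈ U ↔ y ∈ U') ∧ A y = A' y ∧ B y = B' y) →
      truncVal ζ G e d U A B v = truncVal ζ G e d U' A' B' v := by
  induction d with
  | zero => exact fun _ => rfl
  | succ d ih =>
    intro U U' A B A' B' v h
    have hv := h v (by simp)
    have hJ : U.filter (G.Adj v) = U'.filter (G.Adj v) := by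
      ext y
      simp only [Finset.mem_filter, and_congr_left_iff]
      intro hy
      refine (h y ?_).1
      rw [SimpleGraph.edist_eq_one_iff_adj.2 hy]
      push_cast
      exact le_add_self
    rw [truncVal, truncVal, hv.2.1, hv.2.2, hJ]
    refine nodeVal_congr _ _ _ fun x hx => ih fun y hy => ?_
    have hvx : G.Adj v x := (Finset.mem_filter.1 hx).2
    have hvy := h y (by
      refine (G.edist_triangle (v := x)).trans ?_
      rw [SimpleGraph.edist_eq_one_iff_adj.2 hvx, add_comm]
      push_cast
      gcongr)
    simp only [Finset.mem_erase, addBefore, addAfter, hvy.1, hvy.2.1, hvy.2.2, and_self]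

/-- Children that vanish on both sides become − neighbours on both sides, so that the two values
come from the same recursion function. They must be treated apart because 0 need not lie in `Q`,
where φ is controlled. -/
theorem RecContraction.contract_nodeVal {φ : ℂ → ℂ} {ρ D L : ℝ} (H : RecContraction ζ Δ Q φ ρ D L)
    {a b : ℕ} {J : Finset V} {c c' : V → ℂ} {r : ℝ} (hr : 0 ≤ r) (ha : Admissible ζ a)
    (hload : a + b + J.card < Δ)
    (h : ∀ x ∈ J, (c x ∈ Q ∧ c' x ∈ Q ∧ ‖φ (c x) - φ (c' x)‖ ≤ r) ∨ (c x = 0 ∧ c' x = 0)) :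
    ‖φ (nodeVal ζ a b J c) - φ (nodeVal ζ a b J c')‖ ≤ ρ * r := by
  classical
  have hsub : J.filter (fun x => c x = 0 ∧ c' x = 0) ⊆ J := Finset.filter_subset _ _
  have hcard := Finset.card_sdiff_add_card_eq_card hsub
  have hmem : ∀ i, ((J \ J.filter (fun x => c x = 0 ∧ c' x = 0)).equivFin.symm i : V) ∈
      J \ J.filter (fun x => c x = 0 ∧ c' x = 0) := fun i => Subtype.mem _
  have key : ∀ i, _ := fun i => (h _ (Finset.mem_sdiff.1 (hmem i)).1).resolve_right fun h0 =>
    (Finset.mem_sdiff.1 (hmem i)).2 (Finset.mem_filter.2 ⟨(Finset.mem_sdiff.1 (hmem i)).1, h0⟩)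
  rw [nodeVal_eq_recF ζ a b J _ c hsub fun x hx => (Finset.mem_filter.1 hx).2.1,
    nodeVal_eq_recF ζ a b J _ c' hsub fun x hx => (Finset.mem_filter.1 hx).2.2]
  exact H.contract _ _ _ ha (by lia) _ _ (fun i => (key i).1) (fun i => (key i).2.1) r hr
    (fun i => (key i).2.2)

/-- The depth is d + 1 because at depth 0 the truncated value is λ ∈ `Q` while the true ratio may be
a forced 0. After one level both are forced or both lie in `Q`; the diameter `D` then starts the
induction and each further level gains ρ. -/
theorem RecContraction.truncVal_bound {φ : ℂ → ℂ} {ρ D L : ℝ} (H : RecContraction ζ Δ Q φ ρ D L)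
    {e : V → ℕ} (he : Function.Injective e) (d : ℕ) : ∀ {U : Finset V} {A B : V → ℕ} {v : V},
    NodeLoadLE G Δ U A B v → A v + B v + (U.filter (G.Adj v)).card < Δ →
    (nodeRatio ζ G U A B v ∈ Q ∧ truncVal ζ G e (d + 1) U A B v ∈ Q ∧
      ‖φ (nodeRatio ζ G U A B v) - φ (truncVal ζ G e (d + 1) U A B v)‖ ≤ D * ρ ^ d) ∨
    (nodeRatio ζ G U A B v = 0 ∧ truncVal ζ G e (d + 1) U A B v = 0) := by
  have HI := H.toRecInvariant
  have mem : ∀ (d : ℕ) {U : Finset V} {A B : V → ℕ} {v : V},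
      NodeLoadLE G Δ U A B v → A v + B v + (U.filter (G.Adj v)).card < Δ → Admissible ζ (A v) →
      nodeRatio ζ G U A B v ∈ Q ∧ truncVal ζ G e (d + 1) U A B v ∈ Q := by
    intro d U A B v h hload ha
    constructor
    · rw [HI.nodeRatio_eq_nodeVal he h]
      exact HI.nodeVal_mem (fun x hx => HI.childValue_nodeRatio
        (h.child e (Finset.mem_of_mem_filter x hx)) (h.child_load e hx)) hload ha
    · exact HI.nodeVal_mem (fun x hx => HI.childValue_truncVal e d
        (h.child e (Finset.mem_of_mem_filter x hx)) (h.child_load e hx)) hload ha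
  induction d with
  | zero =>
    intro U A B v h hload
    by_cases ha : Admissible ζ (A v)
    · obtain ⟨h1, h2⟩ := mem 0 h hload ha
      exact Or.inl ⟨h1, h2, by simpa using H.norm_sub_le _ h1 _ h2⟩
    · rw [HI.nodeRatio_eq_nodeVal he h]
      exact Or.inr ⟨(nodeVal_forced ha).2, (nodeVal_forced ha).2⟩
  | succ d ih =>
    intro U A B v h hload
    by_cases ha : Admissible ζ (A v)
    · obtain ⟨h1, h2⟩ := mem (d + 1) h hload ha
      refine Or.inl ⟨h1, h2, ?_⟩
      rw [HI.nodeRatio_eq_nodeVal he h, truncVal, pow_succ, ← mul_assoc, mul_comm _ ρ]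
      exact H.contract_nodeVal (mul_nonneg H.D_nonneg (pow_nonneg H.ρ_pos.le _)) ha hload
        fun x hx => ih (h.child e (Finset.mem_of_mem_filter x hx)) (h.child_load e hx)
    · rw [HI.nodeRatio_eq_nodeVal he h]
      exact Or.inr ⟨(nodeVal_forced ha).2, (nodeVal_forced ha).2⟩

/-- By compactness, and since γ ≠ 0, the set of child values stays away from the pole −γ. The bounds
also cover nearby parameters and arguments, which the algorithm needs for its rounded input. -/
theorem RecContraction.exists_bounds {φ : ℂ → ℂ} {ρ D L : ℝ} (H : RecContraction ζ Δ Q φ ρ D L) :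
    ∃ κ K : ℝ, 0 < κ ∧ 0 ≤ K ∧ ∀ ζ' : SpinParams, paramDist ζ ζ' ≤ κ → ParamBound κ K ζ' ∧
      ∀ x x' : ℂ, ChildValue ζ Q x → ‖x - x'‖ ≤ κ → ArgBound κ K ζ' x' := by
  have hcont : ContinuousOn (fun x : ℂ => ‖x + ζ.γ‖) Q := by fun_prop
  obtain ⟨x₀, hx₀, hmin⟩ := H.isCompact.exists_isMinOn ⟨_, H.lam_mem⟩ hcont
  have hpos : 0 < ‖x₀ + ζ.γ‖ := norm_pos_iff.2 fun h0 =>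
    H.neg_γ_notMem (eq_neg_of_add_eq_zero_left h0 ▸ hx₀)
  have hγ : 0 < ‖ζ.γ‖ := norm_pos_iff.2 H.γ_ne
  obtain ⟨M, hM⟩ := H.isCompact.isBounded.exists_norm_le
  -- A third of the distance to the pole: an argument may move by κ and γ may move by κ, and κ still
  -- remains.
  set κ := min ‖x₀ + ζ.γ‖ ‖ζ.γ‖ / 3 with hκ
  have hκ1 : 3 * κ ≤ ‖x₀ + ζ.γ‖ := by linarith [min_le_left ‖x₀ + ζ.γ‖ ‖ζ.γ‖]
  have hκ2 : 3 * κ ≤ ‖ζ.γ‖ := by linarith [min_le_right ‖x₀ + ζ.γ‖ ‖ζ.γ‖]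
  have hκ0 : 0 < κ := by
    have := lt_min hpos hγ
    linarith
  have hM0 : 0 ≤ M := (norm_nonneg _).trans (hM _ H.lam_mem)
  refine ⟨κ, κ + ‖ζ.β‖ + ‖ζ.γ‖ + ‖ζ.lam‖ + M, hκ0, by positivity, fun ζ' hζ => ?_⟩
  have hβ : ‖ζ.β - ζ'.β‖ ≤ κ := (le_max_left _ _).trans hζ
  have hγ' : ‖ζ.γ - ζ'.γ‖ ≤ κ := (le_max_left _ _).trans ((le_max_right _ _).trans hζ)
  have hl : ‖ζ.lam - ζ'.lam‖ ≤ κ := (le_max_right _ _).trans ((le_max_right _ _).trans hζ)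
  have up : ∀ a b : ℂ, ‖a - b‖ ≤ κ → ‖b‖ ≤ κ + ‖a‖ := fun a b h => by
    have := norm_sub_norm_le b a
    rw [norm_sub_rev] at this
    linarith
  have := norm_nonneg ζ.β
  have := norm_nonneg ζ.lam
  refine ⟨⟨?_, ?_, ?_, ?_⟩, fun x x' hx hxx => ⟨?_, ?_⟩⟩
  · linarith [norm_sub_norm_le ζ.γ ζ'.γ]
  · linarith [up _ _ hβ]
  · linarith [up _ _ hγ']
  · linarith [up _ _ hl]
  · have h1 : 3 * κ ≤ ‖x + ζ.γ‖ := by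
      rcases hx with hx | ⟨-, rfl⟩
      · exact hκ1.trans (isMinOn_iff.1 hmin x hx)
      · simpa using hκ2
    have h2 : ‖x + ζ.γ‖ ≤ ‖x' + ζ'.γ‖ + (‖x - x'‖ + ‖ζ.γ - ζ'.γ‖) := by
      have : x + ζ.γ = (x' + ζ'.γ) + ((x - x') + (ζ.γ - ζ'.γ)) := by ring
      rw [this]
      exact (norm_add_le _ _).trans (add_le_add le_rfl (norm_add_le _ _))
    linarith
  · have h1 : ‖x‖ ≤ M := by
      rcases hx with hx | ⟨-, rfl⟩
      · exact hM x hx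
      · simpa using hM0
    linarith [up _ _ hxx]

/-- The values of the recursion at the root stay away from `-1`. -/
theorem RecContraction.exists_root_lower {φ : ℂ → ℂ} {ρ D L : ℝ}
    (H : RecContraction ζ Δ Q φ ρ D L) :
    ∃ μ : ℝ, 0 < μ ∧ ∀ (V : Type u) [Fintype V] [DecidableEq V] (a b : ℕ) (J : Finset V) (c : V → ℂ),
      (∀ x ∈ J, ChildValue ζ Q (c x)) → a + b + J.card ≤ Δ → μ ≤ ‖1 + nodeVal ζ a b J c‖ := by
  set I : Set (ℕ × ℕ × ℕ) := {s | Admissible ζ s.1 ∧ s.1 + s.2.1 + s.2.2 ≤ Δ}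
  have hI : I.Finite := by
    refine Set.Finite.subset (Set.finite_Iic (Δ, Δ, Δ)) ?_
    rintro ⟨s₁, s₂, k⟩ ⟨-, h⟩
    simp only [Set.mem_Iic, Prod.mk_le_mk] at h ⊢
    lia
  set K : Set ℂ := ⋃ s ∈ I, (fun x => 1 + recF ζ s.1 s.2.1 s.2.2 x) '' Set.pi Set.univ fun _ => Q
  -- Only finitely many shapes have degree at most Δ, and each contributes the continuous image of a
  -- power of `Q`; hence `K` is compact and attains its positive minimal norm.
  have hK : IsCompact K := by
    refine hI.isCompact_biUnion fun s hs => ?_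
    refine (isCompact_univ_pi fun _ => H.isCompact).image_of_continuousOn ?_
    refine ContinuousOn.add continuousOn_const fun x hx => ?_
    refine (differentiableAt_recF _ _ _ fun i h0 => H.neg_γ_notMem ?_).continuousAt.continuousWithinAt
    exact eq_neg_of_add_eq_zero_left h0 ▸ hx i (Set.mem_univ i)
  have hne : ∀ z ∈ K, z ≠ 0 := by
    intro z hz h0
    simp only [K, Set.mem_iUnion, Set.mem_image] at hz
    obtain ⟨⟨s₁, s₂, k⟩, ⟨ha, hs⟩, x, hx, rfl⟩ := hz
    have hx' : ∀ i, x i ∈ Q := fun i => hx i (Set.mem_univ i)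
    have h1 : recF ζ s₁ s₂ k x = -1 := by linear_combination h0
    rcases hs.lt_or_eq with hlt | heq
    · exact H.neg_one_notMem (h1 ▸ H.recF_mem _ _ _ ha hlt x hx')
    · exact H.recF_ne _ _ _ ha heq x hx' h1
  have hlam : 1 + recF ζ 0 0 0 ![] ∈ K := by
    simp only [K, Set.mem_iUnion, Set.mem_image]
    exact ⟨(0, 0, 0), ⟨fun _ => rfl, by simp⟩, ![], fun i => i.elim0, rfl⟩
  obtain ⟨z, hz, hmin⟩ := hK.exists_isMinOn ⟨_, hlam⟩ (continuous_norm.continuousOn)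
  -- The 1 covers the root whose value is forced to 0.
  refine ⟨min ‖z‖ 1, lt_min (norm_pos_iff.2 (hne z hz)) one_pos, ?_⟩
  intro V _ _ a b J c hc hload
  by_cases ha : Admissible ζ a
  · obtain ⟨s₁, s₂, k, h1, h2, x, hx, h⟩ := nodeVal_exists_recF (b := b) hc ha
    rw [h]
    refine (min_le_left _ _).trans (isMinOn_iff.1 hmin _ ?_)
    simp only [K, Set.mem_iUnion, Set.mem_image]
    exact ⟨(s₁, s₂, k), ⟨h1, h2.trans_le hload⟩, x, fun i _ => hx i, rfl⟩
  · rw [(nodeVal_forced ha).2]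
    simp

/-- Bounds for the ratio at the root and for its approximation by the truncated recursion. -/
structure RootBound (ζ : SpinParams) (Δ : ℕ) (ρ C μ : ℝ) : Prop where
  ρ_pos : 0 < ρ
  ρ_lt : ρ < 1
  C_nonneg : 0 ≤ C
  μ_pos : 0 < μ
  bounds : ∀ (V : Type u) [Fintype V] [DecidableEq V] (G : SimpleGraph V) [DecidableRel G.Adj]
    (e : V → ℕ), Function.Injective e → ∀ (U : Finset V) (A B : V → ℕ) (v : V),
    NodeLoadLE G Δ U A B v → A v + B v + (U.filter (G.Adj v)).card ≤ Δ →
    μ ≤ ‖1 + nodeRatio ζ G U A B v‖ ∧ ‖nodeRatio ζ G U A B v‖ ≤ C ∧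
    ∀ d, μ ≤ ‖1 + truncVal ζ G e (d + 1) U A B v‖ ∧
      ‖nodeRatio ζ G U A B v - truncVal ζ G e (d + 2) U A B v‖ ≤ C * ρ ^ d

/-- With Δ neighbours the root value may leave `Q`, where no contraction is available. So the
contraction is used at the children, and the root step costs only a Lipschitz constant; this is the
second extra level in the depth d + 2. -/
theorem RecContraction.exists_rootBound {φ : ℂ → ℂ} {ρ D L : ℝ}
    (H : RecContraction ζ Δ Q φ ρ D L) : ∃ C μ : ℝ, RootBound.{u} ζ Δ ρ C μ := by
  have HI := H.toRecInvariant
  obtain ⟨κ, K, hκ, hK, hb⟩ := H.exists_bounds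
  obtain ⟨hp, ha⟩ := hb ζ (by rw [paramDist_self]; exact hκ.le)
  obtain ⟨μ, hμ, hlow⟩ := RecContraction.exists_root_lower.{u} H
  have hM := one_le_facBound hκ hK
  have hL := H.L_nonneg
  have hD := H.D_nonneg
  set N := facBound κ K ^ (Δ + 1)
  have hN : 0 ≤ N := pow_nonneg (by linarith) _
  -- The first summand bounds the ratio itself; the second is the Lipschitz constant of at most Δ +
  -- 1 factors times the error `L * D` of the children.
  refine ⟨N + (Δ + 1) * N * (L * D), μ, H.ρ_pos, H.ρ_lt, by positivity, hμ, ?_⟩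
  intro V _ _ G _ e he U A B v h hload
  have hR : ∀ x ∈ U.filter (G.Adj v), ChildValue ζ Q (nodeRatio ζ G (U.erase x)
      (addBefore e (U.filter (G.Adj v)) x A) (addAfter e (U.filter (G.Adj v)) x B) x) := fun x hx =>
    HI.childValue_nodeRatio (h.child e (Finset.mem_of_mem_filter x hx)) (h.child_load e hx)
  have hT : ∀ d, ∀ x ∈ U.filter (G.Adj v), ChildValue ζ Q (truncVal ζ G e d (U.erase x)
      (addBefore e (U.filter (G.Adj v)) x A) (addAfter e (U.filter (G.Adj v)) x B) x) := fun d x hx =>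
    HI.childValue_truncVal e d (h.child e (Finset.mem_of_mem_filter x hx)) (h.child_load e hx)
  have close : ∀ d, ClosePair (facBound κ K) (L * (D * ρ ^ d)) (Δ + 1) (nodeRatio ζ G U A B v)
      (truncVal ζ G e (d + 2) U A B v) := by
    intro d
    have hr : 0 ≤ L * (D * ρ ^ d) := mul_nonneg hL (mul_nonneg hD (pow_nonneg H.ρ_pos.le _))
    rw [HI.nodeRatio_eq_nodeVal he h, truncVal]
    refine (closePair_nodeVal hκ hK hp hp (by rwa [paramDist_self])
      (fun x hx => ha _ _ (hR x hx) (by simpa using hκ.le))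
      (fun x hx => ha _ _ (hT (d + 1) x hx) (by simpa using hκ.le)) fun x hx => ?_).mono hM hr
        (by lia)
    rcases H.truncVal_bound he d (h.child e (Finset.mem_of_mem_filter x hx))
      (h.child_load e hx) with ⟨h1, h2, h3⟩ | ⟨h1, h2⟩
    · exact (H.norm_sub_le_mul _ h1 _ h2).trans (mul_le_mul_of_nonneg_left h3 hL)
    · rw [h1, h2]
      simpa using hr
  refine ⟨?_, ?_, fun d => ⟨hlow V _ _ _ _ (hT d) hload, ?_⟩⟩
  · rw [HI.nodeRatio_eq_nodeVal he h]
    exact hlow V _ _ _ _ hR hload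
  · refine (close 0).left.trans ?_
    have : 0 ≤ (Δ + 1) * N * (L * D) := by positivity
    linarith
  · refine (close d).sub.trans ?_
    have h1 : 0 ≤ N * ρ ^ d := mul_nonneg hN (pow_nonneg H.ρ_pos.le _)
    push_cast
    nlinarith

end Truncation

/-! # Strong spatial mixing -/

section Mixing

set_option linter.unusedSectionVars false

variable {V : Type u} [Fintype V] [DecidableEq V]

theorem configWeight_eq (ζ : SpinParams) (G : SimpleGraph V) (τ : V → Bool) :
    configWeight ζ G τ = ζ.β ^ inducedEdges G (Finset.univ.filter fun v => τ v = true) *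
      ζ.γ ^ inducedEdges G (Finset.univ.filter fun v => τ v = false) *
        ζ.lam ^ (Finset.univ.filter fun v => τ v = true).card := by
  simp only [configWeight, inducedEdges, Finset.mem_filter, Finset.mem_univ, true_and,
    Set.ncard_eq_toFinset_card', Set.toFinset_ofPred]

theorem inducedEdges_empty (G : SimpleGraph V) : inducedEdges G ∅ = 0 := by
  rw [inducedEdges, Set.ncard_eq_zero, Set.eq_empty_iff_forall_notMem]
  intro e
  induction e with
  | _ x y => exact fun h => Finset.notMem_empty x (h.2 x (Sym2.mem_mk_left x y))

theorem inducedEdges_union (G : SimpleGraph V) [DecidableRel G.Adj] (P : Finset V) {S : Finset V}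
    (h : Disjoint S P) :
    inducedEdges G (S ∪ P) =
      inducedEdges G P + (∑ v ∈ S, (P.filter (G.Adj v)).card + inducedEdges G S) := by
  induction S using Finset.induction_on with
  | empty =>
    simp [inducedEdges_empty]
  | insert a S ha ih =>
    rw [Finset.disjoint_insert_left] at h
    rw [Finset.insert_union, inducedEdges_insert G (by simp [ha, h.1]), ih h.2,
      inducedEdges_insert G ha, Finset.sum_insert ha, Finset.filter_union,
      Finset.card_union_of_disjoint (Finset.disjoint_filter_filter h.2)]
    ring

/-- The free vertices of a pinning, or those with a given spin. -/
def pinSet (σ : Pinning V) (s : Option Bool) : Finset V := Finset.univ.filter fun v => σ v = s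

/-- The number of neighbours that are pinned to the spin `s`. -/
def pinCount (G : SimpleGraph V) [DecidableRel G.Adj] (σ : Pinning V) (s : Bool) (v : V) : ℕ :=
  ((pinSet σ (some s)).filter (G.Adj v)).card

/-- The contribution of the pinned vertices to the weights. -/
noncomputable def pinWeight (ζ : SpinParams) (G : SimpleGraph V) (σ : Pinning V) : ℂ :=
  ζ.lam ^ (pinSet σ (some true)).card * ζ.β ^ inducedEdges G (pinSet σ (some true)) *
    ζ.γ ^ inducedEdges G (pinSet σ (some false))

theorem mem_pinSet {σ : Pinning V} {s : Option Bool} {v : V} : v ∈ pinSet σ s ↔ σ v = s := by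
  simp [pinSet]

/-- A configuration that extends the pinning is determined by its + vertices among the free ones.
Edges between free and pinned vertices become half edges, and the weight inside the pinned set
factors out. -/
theorem pinnedZ_eq (ζ : SpinParams) (G : SimpleGraph V) [DecidableRel G.Adj] (σ : Pinning V) :
    pinnedZ ζ G σ = pinWeight ζ G σ *
      subZ ζ G (pinSet σ none) (pinCount G σ true) (pinCount G σ false) := by
  rw [pinnedZ, subZ, Finset.mul_sum]
  refine Finset.sum_bij' (fun τ _ => (pinSet σ none).filter fun v => τ v = true)
    (fun S _ v => decide (v ∈ S ∪ pinSet σ (some true))) (fun τ _ => by simp) ?_ ?_ ?_ ?_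
  · intro S hS
    simp only [Finset.mem_filter, Finset.mem_univ, true_and]
    intro v
    have hS' := Finset.mem_powerset.1 hS
    rcases h : σ v with _ | _ | _
    · simp
    · have : v ∉ S := fun hv => by
        have := mem_pinSet.1 (hS' hv)
        simp [h] at this
      simp [mem_pinSet, h, this]
    · simp [mem_pinSet, h]
  · intro τ hτ
    ext v
    have := (Finset.mem_filter.1 hτ).2 v
    rcases h : σ v with _ | _ | _ <;> simp [h, mem_pinSet] at this ⊢ <;> simp [this]
  · intro S hS
    have hS' := Finset.mem_powerset.1 hS
    ext v
    simp only [Finset.mem_filter, decide_eq_true_eq, Finset.mem_union, mem_pinSet]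
    constructor
    · rintro ⟨h1, h2 | h2⟩
      · exact h2
      · simp [h1] at h2
    · exact fun h => ⟨mem_pinSet.1 (hS' h), Or.inl h⟩
  · intro τ hτ
    have hτ' := (Finset.mem_filter.1 hτ).2
    set S := (pinSet σ none).filter fun v => τ v = true with hS
    have h1 : (Finset.univ.filter fun v => τ v = true) = S ∪ pinSet σ (some true) := by
      ext v
      have := hτ' v
      rcases h : σ v with _ | _ | _ <;> simp [h, mem_pinSet, hS] at this ⊢ <;> simp [this]
    have h2 : (Finset.univ.filter fun v => τ v = false) =
        (pinSet σ none \ S) ∪ pinSet σ (some false) := by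
      ext v
      have := hτ' v
      rcases h : σ v with _ | _ | _ <;> simp [h, mem_pinSet, hS] at this ⊢ <;> simp [this]
    have d1 : Disjoint S (pinSet σ (some true)) := by
      rw [Finset.disjoint_left]
      intro v hv hv'
      simp [hS, mem_pinSet] at hv hv'
      simp [hv.1] at hv'
    have d2 : Disjoint (pinSet σ none \ S) (pinSet σ (some false)) := by
      rw [Finset.disjoint_left]
      intro v hv hv'
      simp [hS, mem_pinSet] at hv hv'
      simp [hv.1] at hv'
    rw [configWeight_eq, h1, h2, inducedEdges_union G _ d1, inducedEdges_union G _ d2,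
      Finset.card_union_of_disjoint d1, pinWeight]
    simp only [pinCount]
    ring

/-- Fixing the spin + at `v` is the same as extending the pinning by `v`, to which `pinnedZ_eq`
applies. -/
theorem pinnedZPlus_eq (ζ : SpinParams) (G : SimpleGraph V) [DecidableRel G.Adj] (σ : Pinning V)
    {v : V} (hv : σ v = none) :
    pinnedZPlus ζ G σ v = pinWeight ζ G σ * (ζ.lam * ζ.β ^ pinCount G σ true v *
      subZ ζ G ((pinSet σ none).erase v) (pinCount G σ true + adjInd G v) (pinCount G σ false)) := by
  have h0 : pinnedZPlus ζ G σ v = pinnedZ ζ G (Function.update σ v (some true)) := by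
    rw [pinnedZPlus, pinnedZ]
    refine Finset.sum_congr (Finset.filter_congr fun τ _ => ?_) fun _ _ => rfl
    constructor
    · rintro ⟨h1, h2⟩ w
      by_cases hw : w = v
      · subst hw; simp [h2]
      · simpa [hw] using h1 w
    · intro h
      refine ⟨fun w => ?_, ?_⟩
      · by_cases hw : w = v
        · subst hw; exact Or.inl hv
        · simpa [hw] using h w
      · simpa using (h v).symm
  have s1 : pinSet (Function.update σ v (some true)) none = (pinSet σ none).erase v := by
    ext w
    by_cases hw : w = v
    · subst hw; simp [mem_pinSet]
    · simp [mem_pinSet, hw]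
  have s2 : pinSet (Function.update σ v (some true)) (some true) =
      insert v (pinSet σ (some true)) := by
    ext w
    by_cases hw : w = v
    · subst hw; simp [mem_pinSet]
    · simp [mem_pinSet, hw]
  have s3 : pinSet (Function.update σ v (some true)) (some false) = pinSet σ (some false) := by
    ext w
    by_cases hw : w = v
    · subst hw; simp [mem_pinSet, hv]
    · simp [mem_pinSet, hw]
  have hvP : v ∉ pinSet σ (some true) := by simp [mem_pinSet, hv]
  have c1 : pinCount G (Function.update σ v (some true)) true = pinCount G σ true + adjInd G v := by
    ext w
    rw [pinCount, s2, Finset.filter_insert]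
    by_cases hw : G.Adj w v
    · rw [if_pos hw, Finset.card_insert_of_notMem (by simp [hvP])]
      simp [pinCount, adjInd, hw.symm]
    · have : ¬G.Adj v w := fun h => hw h.symm
      simp [hw, pinCount, adjInd, this]
  have c2 : pinCount G (Function.update σ v (some true)) false = pinCount G σ false := by
    ext w
    rw [pinCount, s3, pinCount]
  rw [h0, pinnedZ_eq, s1, c1, c2, pinWeight, s2, s3, inducedEdges_insert G hvP,
    Finset.card_insert_of_notMem hvP, pinWeight, pow_succ, pow_add]
  change _ = _ * (_ * ζ.β ^ ((pinSet σ (some true)).filter (G.Adj v)).card * _)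
  ring

variable {ζ : SpinParams} {Δ : ℕ} {G : SimpleGraph V} [DecidableRel G.Adj]

/-- Feasibility excludes exactly the zero factors that λ = 0 or β = 0 could cause inside the pinned
set. -/
theorem Feasible.pinWeight_ne_zero (hγ : ζ.γ ≠ 0) {σ : Pinning V} (h : Feasible ζ G σ) :
    pinWeight ζ G σ ≠ 0 := by
  refine mul_ne_zero (mul_ne_zero ?_ ?_) (pow_ne_zero _ hγ)
  · by_cases hl : ζ.lam = 0
    · have : pinSet σ (some true) = ∅ := by
        ext v
        simpa [mem_pinSet] using h.1 hl v
      simp [this]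
    · exact pow_ne_zero _ hl
  · by_cases hβ : ζ.β = 0
    · have : inducedEdges G (pinSet σ (some true)) = 0 := by
        rw [inducedEdges, Set.ncard_eq_zero, Set.eq_empty_iff_forall_notMem]
        intro e
        induction e with
        | _ x y =>
          rintro ⟨h1, h2⟩
          exact h.2 hβ x y h1 ⟨mem_pinSet.1 (h2 x (by simp)), mem_pinSet.1 (h2 y (by simp))⟩
      simp [this]
    · exact pow_ne_zero _ hβ

theorem loadLE_pinCount (hG : G ∈ boundedDegreeGraphs Δ V) (σ : Pinning V) :
    LoadLE G Δ (pinSet σ none) (pinCount G σ true) (pinCount G σ false) := by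
  intro y _
  refine le_trans (le_of_eq ?_) (hG y)
  have : (G.neighborSet y).ncard = (Finset.univ.filter (G.Adj y)).card := by
    rw [← Set.ncard_coe_finset]
    congr 1
    ext
    simp
  rw [this, pinCount, pinCount, ← Finset.card_union_of_disjoint, ← Finset.card_union_of_disjoint]
  · congr 1
    ext w
    rcases h : σ w with _ | _ | _ <;> simp [mem_pinSet, h]
  · rw [Finset.disjoint_left]
    intro w hw hw'
    rcases h : σ w with _ | _ | _ <;> simp [mem_pinSet, h] at hw hw'
  · rw [Finset.disjoint_left]
    intro w hw hw'
    rcases h : σ w with _ | _ | _ <;> simp [mem_pinSet, h] at hw hw'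

theorem marginal_eq (hγ : ζ.γ ≠ 0) {σ : Pinning V} (hσ : Feasible ζ G σ) {v : V}
    (hv : σ v = none)
    (h0 : subZ ζ G ((pinSet σ none).erase v) (pinCount G σ true) (pinCount G σ false + adjInd G v)
      ≠ 0) :
    marginal ζ G σ v =
      nodeRatio ζ G ((pinSet σ none).erase v) (pinCount G σ true) (pinCount G σ false) v /
        (1 + nodeRatio ζ G ((pinSet σ none).erase v) (pinCount G σ true) (pinCount G σ false) v) := by
  have hv' : v ∈ pinSet σ none := mem_pinSet.2 hv
  have h1 := subZ_insert_eq ζ G hγ (Finset.notMem_erase v (pinSet σ none)) (pinCount G σ true)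
    (pinCount G σ false) h0
  rw [Finset.insert_erase hv'] at h1
  rw [marginal, pinnedZPlus_eq ζ G σ hv, pinnedZ_eq, mul_div_mul_left _ _ (hσ.pinWeight_ne_zero hγ),
    h1, ← div_div, nodeRatio]

theorem norm_div_one_add_sub_le {x y : ℂ} {μ : ℝ} (hμ : 0 < μ) (hx : μ ≤ ‖1 + x‖)
    (hy : μ ≤ ‖1 + y‖) : ‖x / (1 + x) - y / (1 + y)‖ ≤ ‖x - y‖ / μ ^ 2 := by
  have hx' : 1 + x ≠ 0 := norm_pos_iff.1 (hμ.trans_le hx)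
  have hy' : 1 + y ≠ 0 := norm_pos_iff.1 (hμ.trans_le hy)
  have : x / (1 + x) - y / (1 + y) = (x - y) / ((1 + x) * (1 + y)) := by
    rw [div_sub_div _ _ hx' hy']
    congr 1
    ring
  rw [this, norm_div, norm_mul, sq]
  gcongr

/-- The margin of 2 is needed because the recursion reads `pinCount` at distance d, and this count
depends on pins at distance d + 1. -/
theorem truncVal_eq_of_distToSet (e : V → ℕ) {σ τ : Pinning V} {v : V} {d : ℕ}
    (h : ((d + 2 : ℕ) : ℕ∞) ≤ distToSet G v (differSet σ τ)) :
    truncVal ζ G e d ((pinSet σ none).erase v) (pinCount G σ true) (pinCount G σ false) v =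
      truncVal ζ G e d ((pinSet τ none).erase v) (pinCount G τ true) (pinCount G τ false) v := by
  have heq : ∀ z, G.edist v z ≤ (d + 1 : ℕ) → σ z = τ z := by
    intro z hz
    by_contra hne
    have h1 : distToSet G v (differSet σ τ) ≤ G.edist v z := iInf₂_le z hne
    have := (h.trans h1).trans hz
    norm_cast at this
    lia
  refine truncVal_congr e d fun y hy => ?_
  have hy1 : σ y = τ y := heq y (hy.trans (by norm_cast; lia))
  have hcount : ∀ s, pinCount G σ s y = pinCount G τ s y := by
    intro s
    rw [pinCount, pinCount]
    congr 1
    ext z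
    simp only [Finset.mem_filter, mem_pinSet, and_congr_left_iff]
    intro hyz
    rw [heq z]
    refine (G.edist_triangle (v := y)).trans ?_
    rw [SimpleGraph.edist_eq_one_iff_adj.2 hyz]
    push_cast
    gcongr
  refine ⟨?_, hcount true, hcount false⟩
  rw [Finset.mem_erase, Finset.mem_erase, mem_pinSet, mem_pinSet, hy1]

end Mixing

theorem RootBound.strongSpatialMixing {ζ : SpinParams} {Δ : ℕ} {Q : Set ℂ} {ρ C μ : ℝ}
    (HI : RecInvariant ζ Δ Q) (H : RootBound.{u} ζ Δ ρ C μ) :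
    StrongSpatialMixing.{u} ζ (boundedDegreeGraphs Δ) := by
  have hρ := H.ρ_pos
  have hμ := H.μ_pos
  have hC := H.C_nonneg
  -- An error ρ^d needs depth d + 2 and hence distance d + 4, which gives the ρ^4. The first summand
  -- serves distances t ≥ 4, the second is the trivial bound for t < 4, and the 1 ensures positivity
  -- when C = 0.
  refine ⟨(2 * (C / μ ^ 2) + 2 * (C / μ) + 1) / ρ ^ 4, -Real.log ρ, by positivity,
    neg_pos.2 (Real.log_neg hρ H.ρ_lt), ?_⟩
  intro V _ _ G hG v σ τ hσ hτ hσv hτv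
  classical
  set e : V → ℕ := fun v => Fintype.equivFin V v
  have he : Function.Injective e := Fin.val_injective.comp (Fintype.equivFin V).injective
  have hne : ∀ σ : Pinning V, Feasible ζ G σ → pinnedZ ζ G σ ≠ 0 := fun σ hσ => by
    rw [pinnedZ_eq]
    exact mul_ne_zero (hσ.pinWeight_ne_zero HI.γ_ne) (HI.subZ_ne_zero (loadLE_pinCount hG σ))
  refine ⟨hne σ hσ, hne τ hτ, fun t ht => ?_⟩
  have main : ∀ σ : Pinning V, Feasible ζ G σ → σ v = none →
      ‖marginal ζ G σ v‖ ≤ C / μ ∧ ∀ d : ℕ, ‖marginal ζ G σ v -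
        truncVal ζ G e (d + 2) ((pinSet σ none).erase v) (pinCount G σ true) (pinCount G σ false) v /
        (1 + truncVal ζ G e (d + 2) ((pinSet σ none).erase v) (pinCount G σ true)
          (pinCount G σ false) v)‖ ≤ C * ρ ^ d / μ ^ 2 := by
    intro σ hσ hv
    have hv' : v ∈ pinSet σ none := mem_pinSet.2 hv
    have hN := (loadLE_pinCount hG σ).nodeLoadLE hv'
    obtain ⟨h1, h2, h3⟩ := H.bounds V G e he _ _ _ v hN ((loadLE_pinCount hG σ).node_load hv')
    rw [marginal_eq HI.γ_ne hσ hv (HI.subZ_ne_zero (hN.loadLE_after fun y _ => by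
      simp only [Pi.add_apply]; lia))]
    refine ⟨?_, fun d => ?_⟩
    · rw [norm_div]
      gcongr
    · refine (norm_div_one_add_sub_le hμ h1 (h3 (d + 1)).1).trans ?_
      gcongr
      exact (h3 d).2
  have hexp : Real.exp (-(-Real.log ρ * t)) = ρ ^ t := by
    rw [neg_mul, neg_neg, mul_comm, Real.exp_nat_mul, Real.exp_log hρ]
  rw [hexp, div_mul_eq_mul_div, le_div_iff₀ (by positivity)]
  obtain ⟨hσb, hσd⟩ := main σ hσ hσv
  obtain ⟨hτb, hτd⟩ := main τ hτ hτv
  rcases le_or_gt 4 t with h4 | h4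
  · obtain ⟨d, rfl⟩ := Nat.exists_eq_add_of_le' h4
    have h1 := hσd d
    -- Now both marginals are compared with one and the same truncated value.
    rw [truncVal_eq_of_distToSet e (by simpa [add_assoc] using ht)] at h1
    have h2 := hτd d
    have h3 : ‖marginal ζ G σ v - marginal ζ G τ v‖ ≤ 2 * (C / μ ^ 2) * ρ ^ d := by
      refine (norm_sub_le_norm_sub_add_norm_sub _ _ _).trans ((add_le_add h1 ?_).trans
        (le_of_eq (by ring : C * ρ ^ d / μ ^ 2 + C * ρ ^ d / μ ^ 2 = _)))
      rwa [norm_sub_rev]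
    rw [pow_add, ← mul_assoc]
    refine mul_le_mul_of_nonneg_right (h3.trans ?_) (by positivity)
    refine mul_le_mul_of_nonneg_right ?_ (by positivity)
    have : 0 ≤ C / μ := by positivity
    linarith
  · have h3 : ‖marginal ζ G σ v - marginal ζ G τ v‖ ≤ 2 * (C / μ) :=
      (norm_sub_le _ _).trans (by linarith)
    have : 0 ≤ C / μ ^ 2 := by positivity
    exact mul_le_mul (by linarith) (pow_le_pow_of_le_one hρ.le H.ρ_lt.le h4.le) (by positivity)
      (by positivity)

/-! # Evaluation with cost bounds -/

/-- Evaluation with cost at most `B`. -/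
def Ev (p : Program) (env : List Val) (e : Expr) (v : Val) (B : ℕ) : Prop :=
  ∃ c ≤ B, Eval p env e v c

/-- The function `f` of the program maps `v` to `w`, with cost at most `B`. -/
def Call (p : Program) (f : ℕ) (v w : Val) (B : ℕ) : Prop :=
  ∃ body, p[f]? = some body ∧ Ev p [v] body w B

section Ev

variable {p : Program} {env : List Val} {a b t : Expr} {v w : Val} {x y : ℤ} {B C D : ℕ}

/-- Applied before the evaluation rules, it leaves the cost as a metavariable that the rules fill
in, so each specification ends in a single arithmetic inequality. -/
theorem Ev.le (h : Ev p env a v B) (hB : B ≤ C) : Ev p env a v C := by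
  obtain ⟨c, hc, h⟩ := h
  exact ⟨c, hc.trans hB, h⟩

theorem Ev.var {i : ℕ} (h : env[i]? = some v) : Ev p env (.var i) v (i + 1) :=
  ⟨_, le_rfl, .var h⟩

theorem Ev.const (z : ℤ) : Ev p env (.const z) (.int z) (intSize z + 1) :=
  ⟨_, le_rfl, .const z⟩

theorem Ev.arith (o : ArithOp) (ha : Ev p env a (.int x) B) (hb : Ev p env b (.int y) C) :
    Ev p env (.arith o a b) (.int (o.apply x y)) (B + C + intSize x + intSize y + 1) := by
  obtain ⟨c, hc, ha⟩ := ha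
  obtain ⟨d, hd, hb⟩ := hb
  exact ⟨_, by lia, .arith o ha hb⟩

theorem Ev.add (ha : Ev p env a (.int x) B) (hb : Ev p env b (.int y) C) :
    Ev p env (.arith .add a b) (.int (x + y)) (B + C + intSize x + intSize y + 1) :=
  Ev.arith .add ha hb

theorem Ev.sub (ha : Ev p env a (.int x) B) (hb : Ev p env b (.int y) C) :
    Ev p env (.arith .sub a b) (.int (x - y)) (B + C + intSize x + intSize y + 1) :=
  Ev.arith .sub ha hb

theorem Ev.mul (ha : Ev p env a (.int x) B) (hb : Ev p env b (.int y) C) :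
    Ev p env (.arith .mul a b) (.int (x * y)) (B + C + intSize x + intSize y + 1) :=
  Ev.arith .mul ha hb

theorem Ev.div (ha : Ev p env a (.int x) B) (hb : Ev p env b (.int y) C) :
    Ev p env (.arith .div a b) (.int (x / y)) (B + C + intSize x + intSize y + 1) :=
  Ev.arith .div ha hb

theorem Ev.pair (ha : Ev p env a v B) (hb : Ev p env b w C) :
    Ev p env (.pair a b) (.pair v w) (B + C + 1) := by
  obtain ⟨c, hc, ha⟩ := ha
  obtain ⟨d, hd, hb⟩ := hb
  exact ⟨_, by lia, .pair ha hb⟩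

theorem Ev.fst (ha : Ev p env a (.pair v w) B) : Ev p env (.fst a) v (B + 1) := by
  obtain ⟨c, hc, ha⟩ := ha
  exact ⟨_, by lia, .fst ha⟩

theorem Ev.snd (ha : Ev p env a (.pair v w) B) : Ev p env (.snd a) w (B + 1) := by
  obtain ⟨c, hc, ha⟩ := ha
  exact ⟨_, by lia, .snd ha⟩

theorem Ev.ifPosTrue (ht : Ev p env t (.int x) B) (hx : 0 < x) (ha : Ev p env a v C) :
    Ev p env (.ifPos t a b) v (B + C + 1) := by
  obtain ⟨c, hc, ht⟩ := ht
  obtain ⟨d, hd, ha⟩ := ha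
  exact ⟨_, by lia, .ifPosTrue ht hx ha⟩

theorem Ev.ifPosFalse (ht : Ev p env t (.int x) B) (hx : x ≤ 0) (hb : Ev p env b v C) :
    Ev p env (.ifPos t a b) v (B + C + 1) := by
  obtain ⟨c, hc, ht⟩ := ht
  obtain ⟨d, hd, hb⟩ := hb
  exact ⟨_, by lia, .ifPosFalse ht hx hb⟩

theorem Ev.ifPairTrue {v' w' : Val} (ht : Ev p env t (.pair v' w') B) (ha : Ev p env a v C) :
    Ev p env (.ifPair t a b) v (B + C + 1) := by
  obtain ⟨c, hc, ht⟩ := ht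
  obtain ⟨d, hd, ha⟩ := ha
  exact ⟨_, by lia, .ifPairTrue ht ha⟩

theorem Ev.ifPairFalse (ht : Ev p env t (.int x) B) (hb : Ev p env b v C) :
    Ev p env (.ifPair t a b) v (B + C + 1) := by
  obtain ⟨c, hc, ht⟩ := ht
  obtain ⟨d, hd, hb⟩ := hb
  exact ⟨_, by lia, .ifPairFalse ht hb⟩

theorem Ev.letIn (ha : Ev p env a v B) (hb : Ev p (v :: env) b w C) :
    Ev p env (.letIn a b) w (B + C + 1) := by
  obtain ⟨c, hc, ha⟩ := ha
  obtain ⟨d, hd, hb⟩ := hb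
  exact ⟨_, by lia, .letIn ha hb⟩

theorem Ev.call {f : ℕ} (ha : Ev p env a v B) (hf : Call p f v w C) :
    Ev p env (.call f a) w (B + C + 1) := by
  obtain ⟨c, hc, ha⟩ := ha
  obtain ⟨body, hf, d, hd, hb⟩ := hf
  exact ⟨_, by lia, .call ha hf hb⟩

end Ev

/-! # The program -/

namespace FPTASProgram

open Expr

/-- `(x, y) ↦ x * y` for Gaussian integers. -/
def cmulE : Expr :=
  .pair (arith .sub (arith .mul (fst (fst (var 0))) (fst (snd (var 0))))
      (arith .mul (snd (fst (var 0))) (snd (snd (var 0)))))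
    (arith .add (arith .mul (fst (fst (var 0))) (snd (snd (var 0))))
      (arith .mul (snd (fst (var 0))) (fst (snd (var 0)))))

/-- `(x, y) ↦ x + y` for Gaussian integers. -/
def caddE : Expr :=
  .pair (arith .add (fst (fst (var 0))) (fst (snd (var 0))))
    (arith .add (snd (fst (var 0))) (snd (snd (var 0))))

/-- `(f, g) ↦ f * g` for fractions of Gaussian integers. -/
def fmulE : Expr :=
  .pair (call 1 (.pair (fst (fst (var 0))) (fst (snd (var 0)))))
    (call 1 (.pair (snd (fst (var 0))) (snd (snd (var 0)))))

/-- `(g, k, f) ↦ f * g ^ k` for fractions of Gaussian integers. -/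
def fpowE : Expr :=
  ifPos (fst (snd (var 0)))
    (call 4 (.pair (fst (var 0)) (.pair (arith .sub (fst (snd (var 0))) (const 1))
      (call 3 (.pair (snd (snd (var 0))) (fst (var 0)))))))
    (snd (snd (var 0)))

/-- `((W, β, γ, λ), (N, D)) ↦ (β * N + W * D, W * N + γ * D)`. -/
def stepE : Expr :=
  .pair (call 2 (.pair (call 1 (.pair (fst (snd (fst (var 0)))) (fst (snd (var 0)))))
      (call 1 (.pair (fst (fst (var 0))) (snd (snd (var 0)))))))
    (call 2 (.pair (call 1 (.pair (fst (fst (var 0))) (fst (snd (var 0)))))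
      (call 1 (.pair (fst (snd (snd (fst (var 0))))) (snd (snd (var 0)))))))

/-- The updated entry of a vertex, from the entry `e` (variable `2`), its difference `j` to the
vertex that is removed (variable `1`), and the adjacency indicator (variable `0`). -/
def entryE : Expr :=
  ifPair (var 2)
    (ifPos (var 1)
      (ifPos (var 0) (.pair (fst (var 2)) (.pair (arith .add (fst (snd (var 2))) (const 1))
        (snd (snd (var 2))))) (var 2))
      (ifPos (arith .sub (const 0) (var 1))
        (ifPos (var 0) (.pair (fst (var 2)) (.pair (fst (snd (var 2)))
          (arith .add (snd (snd (var 2))) (const 1)))) (var 2))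
        (const 0)))
    (const 0)

/-- `(row, state, j, s) ↦` the state where vertex `j` is removed and, if `s = 1`, the half edges of
the vertices in the row are added. -/
def updateE : Expr :=
  ifPair (fst (snd (var 0)))
    (.pair
      (letIn (fst (fst (snd (var 0)))) (letIn (fst (snd (snd (var 1))))
        (letIn (arith .mul (fst (fst (var 2))) (snd (snd (snd (var 2))))) entryE)))
      (call 6 (.pair (snd (fst (var 0))) (.pair (snd (fst (snd (var 0))))
        (.pair (arith .sub (fst (snd (snd (var 0)))) (const 1)) (snd (snd (snd (var 0)))))))))
    (const 0)

/-- `(parameters, k, entry, state) ↦` the value at a vertex. -/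
def nodeE : Expr :=
  ifPos (fst (snd (var 0)))
    (call 8 (.pair
      (.pair (fst (var 0)) (.pair (arith .div (fst (snd (var 0))) (const 2))
        (.pair (fst (fst (snd (snd (var 0))))) (snd (snd (snd (var 0)))))))
      (.pair (fst (fst (snd (snd (var 0))))) (.pair (snd (snd (snd (var 0)))) (.pair (const 0)
        (call 4 (.pair (.pair (fst (fst (var 0))) (fst (snd (snd (fst (var 0))))))
          (.pair (snd (snd (fst (snd (snd (var 0))))))
          (call 4 (.pair (.pair (fst (snd (fst (var 0)))) (fst (fst (var 0))))
            (.pair (fst (snd (fst (snd (snd (var 0))))))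
              (.pair (snd (snd (snd (fst (var 0))))) (fst (fst (var 0)))))))))))))))
    (.pair (snd (snd (snd (fst (var 0))))) (fst (fst (var 0))))

/-- `((parameters, k, row₀, state₀), row, state, j, acc) ↦` the product of `acc` and the
contributions of the children in `row`. -/
def loopE : Expr :=
  ifPair (fst (snd (snd (var 0))))
    (call 8 (.pair (fst (var 0)) (.pair (snd (fst (snd (var 0))))
      (.pair (snd (fst (snd (snd (var 0)))))
      (.pair (arith .add (fst (snd (snd (snd (var 0))))) (const 1))
        (ifPos (fst (fst (snd (var 0))))
          (ifPair (fst (fst (snd (snd (var 0)))))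
            (call 3 (.pair (snd (snd (snd (snd (var 0)))))
              (call 5 (.pair (fst (fst (var 0)))
                (call 7 (.pair (fst (fst (var 0))) (.pair (fst (snd (fst (var 0))))
                  (.pair (fst (fst (snd (snd (var 0)))))
                    (call 6 (.pair (fst (snd (snd (fst (var 0)))))
                      (.pair (snd (snd (snd (fst (var 0)))))
                      (.pair (fst (snd (snd (snd (var 0))))) (const 1)))))))))))))
            (snd (snd (snd (snd (var 0))))))
          (snd (snd (snd (snd (var 0)))))))))))
    (snd (snd (snd (snd (var 0)))))

/-- `(list, i) ↦` the `i`-th entry of the list. -/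
def nthE : Expr :=
  ifPos (snd (var 0))
    (call 9 (.pair (snd (fst (var 0))) (arith .sub (snd (var 0)) (const 1))))
    (fst (fst (var 0)))

/-- `rows ↦` the state where all vertices are present. -/
def initE : Expr :=
  ifPair (var 0)
    (.pair (.pair (fst (var 0)) (.pair (const 0) (const 0))) (call 10 (snd (var 0))))
    (const 0)

/-- `b ↦ 2 ^ b`. -/
def twoPowE : Expr :=
  ifPos (var 0) (arith .mul (const 2) (call 11 (arith .sub (var 0) (const 1)))) (const 1)

/-- `((parameters, k), rows, i, state, acc) ↦` the product of `acc` and the contributions of the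
vertices from `i` on. -/
def sweepE : Expr :=
  ifPair (fst (snd (var 0)))
    (letIn (call 9 (.pair (fst (snd (snd (snd (var 0))))) (fst (snd (snd (var 0))))))
    (letIn (call 6 (.pair (fst (fst (snd (var 1)))) (.pair (fst (snd (snd (snd (var 1)))))
      (.pair (fst (snd (snd (var 1)))) (const 0)))))
    (letIn (call 7 (.pair (fst (fst (var 2))) (.pair (snd (fst (var 2))) (.pair (var 1) (var 0)))))
    (call 12 (.pair (fst (var 3)) (.pair (snd (fst (snd (var 3))))
      (.pair (arith .add (fst (snd (snd (var 3)))) (const 1))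
      (.pair (call 6 (.pair (fst (fst (snd (var 3)))) (.pair (var 1)
          (.pair (fst (snd (snd (var 3)))) (const 1)))))
        (call 3 (.pair
          (call 4 (.pair (.pair (fst (snd (snd (fst (fst (var 3)))))) (fst (fst (fst (var 3)))))
            (.pair (snd (snd (var 2))) (snd (snd (snd (snd (var 3))))))))
          (.pair (call 2 (var 0)) (snd (var 0)))))))))))))
    (snd (snd (snd (snd (var 0)))))

/-- `(N, D) ↦ (re, im, d)` with `N / D = (re + im * I) / d`. -/
def quotE : Expr :=
  letIn (call 1 (.pair (fst (var 0)) (.pair (fst (snd (var 0)))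
      (arith .sub (const 0) (snd (snd (var 0)))))))
    (.pair (fst (var 0)) (.pair (snd (var 0))
      (arith .add (arith .mul (fst (snd (var 1))) (fst (snd (var 1))))
        (arith .mul (snd (snd (var 1))) (snd (snd (var 1)))))))

/-- `C * (n + m) ^ q`, where the input is variable `0`. -/
def fuelE (C : ℕ) : ℕ → Expr
  | 0 => const C
  | q + 1 => arith .mul (fuelE C q) (arith .add (fst (var 0)) (fst (snd (snd (var 0)))))

/-- The main function. -/
def mainE (C q : ℕ) : Expr :=
  call 13 (call 12 (.pair
    (.pair
      (.pair (.pair (call 11 (fst (snd (snd (snd (var 0)))))) (const 0))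
        (snd (snd (snd (snd (var 0))))))
      (fuelE C q))
    (.pair (fst (snd (var 0))) (.pair (const 0) (.pair (call 10 (fst (snd (var 0))))
      (.pair (.pair (const 1) (const 0)) (.pair (const 1) (const 0))))))))

/-- The whole program. -/
def prog (C q : ℕ) : Program :=
  [mainE C q, cmulE, caddE, fmulE, fpowE, stepE, updateE, nodeE, loopE, nthE, initE, twoPowE,
    sweepE, quotE]

/-! ## Arithmetic -/

/-- Gaussian integers as values. -/
abbrev encG (z : GaussianInt) : Val := .pair (.int z.re) (.int z.im)

/-- Fractions of Gaussian integers. -/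
abbrev Frac : Type := GaussianInt × GaussianInt

/-- Fractions as values. -/
abbrev encF (f : Frac) : Val := .pair (encG f.1) (encG f.2)

/-- The absolute values of the parts of `z` have a sum of at most `2 ^ X`. -/
def GBd (X : ℕ) (z : GaussianInt) : Prop := z.re.natAbs + z.im.natAbs ≤ 2 ^ X

theorem GBd.mono {X Y : ℕ} {z : GaussianInt} (h : GBd X z) (hXY : X ≤ Y) : GBd Y z :=
  le_trans h (Nat.pow_le_pow_right (by norm_num) hXY)

/-- The sum of the absolute values of the parts is submultiplicative, so exponents add under
products without a correction term. -/
theorem GBd.mul {X Y : ℕ} {z w : GaussianInt} (hz : GBd X z) (hw : GBd Y w) :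
    GBd (X + Y) (z * w) := by
  unfold GBd at *
  rw [pow_add]
  refine le_trans ?_ (Nat.mul_le_mul hz hw)
  have h1 : (z * w).re = z.re * w.re + -(z.im * w.im) := by simp [Zsqrtd.re_mul]
  have h2 : (z * w).im = z.re * w.im + z.im * w.re := by simp [Zsqrtd.im_mul]
  rw [h1, h2]
  have h3 := Int.natAbs_add_le (z.re * w.re) (-(z.im * w.im))
  have h4 := Int.natAbs_add_le (z.re * w.im) (z.im * w.re)
  simp only [Int.natAbs_neg, Int.natAbs_mul] at h3 h4
  nlinarith

theorem GBd.add {X : ℕ} {z w : GaussianInt} (hz : GBd X z) (hw : GBd X w) :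
    GBd (X + 1) (z + w) := by
  unfold GBd at *
  rw [Zsqrtd.re_add, Zsqrtd.im_add, pow_succ]
  have h3 := Int.natAbs_add_le z.re w.re
  have h4 := Int.natAbs_add_le z.im w.im
  lia

theorem GBd.intSize_le {X : ℕ} {z : GaussianInt} (h : GBd X z) :
    intSize z.re ≤ X + 1 ∧ intSize z.im ≤ X + 1 := by
  unfold GBd at h
  rw [intSize, intSize, Nat.size_le, Nat.size_le, pow_succ]
  have := Nat.one_le_two_pow (n := X)
  constructor <;> lia

/-- Both parts of a fraction are bounded by `2 ^ X`. -/
def FBd (X : ℕ) (f : Frac) : Prop := GBd X f.1 ∧ GBd X f.2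

theorem FBd.mono {X Y : ℕ} {f : Frac} (h : FBd X f) (hXY : X ≤ Y) : FBd Y f :=
  ⟨h.1.mono hXY, h.2.mono hXY⟩

theorem FBd.mul {X Y : ℕ} {f g : Frac} (hf : FBd X f) (hg : FBd Y g) : FBd (X + Y) (f * g) :=
  ⟨hf.1.mul hg.1, hf.2.mul hg.2⟩

theorem FBd.one : FBd 0 1 := ⟨by simp [GBd], by simp [GBd]⟩

theorem FBd.pow {X : ℕ} {f : Frac} (hf : FBd X f) (k : ℕ) : FBd (k * X) (f ^ k) := by
  induction k with
  | zero => simpa using FBd.one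
  | succ k ih =>
    rw [pow_succ, Nat.succ_mul]
    exact ih.mul hf

theorem intSize_mul_le (x y : ℤ) : intSize (x * y) ≤ intSize x + intSize y := by
  rw [intSize, Nat.size_le, Int.natAbs_mul, pow_add]
  exact Nat.mul_lt_mul'' (Nat.lt_size_self _) (Nat.lt_size_self _)

theorem intSize_le_natAbs (x : ℤ) : intSize x ≤ x.natAbs := by
  rw [intSize, Nat.size_le]
  exact Nat.lt_two_pow_self

/-! ### Cost of the arithmetic on Gaussian integers and their fractions. -/

section Specs

variable {C q : ℕ}

theorem call_cmul {X : ℕ} {z w : GaussianInt} (hz : GBd X z) (hw : GBd X w) :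
    Call (prog C q) 1 (.pair (encG z) (encG w)) (encG (z * w)) (20 * (X + 3)) := by
  have h : encG (z * w) = .pair (.int (z.re * w.re - z.im * w.im))
      (.int (z.re * w.im + z.im * w.re)) := by
    simp [encG, Zsqrtd.re_mul, Zsqrtd.im_mul, sub_eq_add_neg]
  refine ⟨cmulE, rfl, ?_⟩
  rw [h]
  apply Ev.le
  · repeat' first
      | exact Ev.var rfl | apply Ev.pair | apply Ev.sub | apply Ev.add | apply Ev.mul
      | apply Ev.fst | apply Ev.snd
  · have h1 := hz.intSize_le
    have h2 := hw.intSize_le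
    have h3 := intSize_mul_le z.re w.re
    have h4 := intSize_mul_le z.im w.im
    have h5 := intSize_mul_le z.re w.im
    have h6 := intSize_mul_le z.im w.re
    lia

theorem call_cadd {X : ℕ} {z w : GaussianInt} (hz : GBd X z) (hw : GBd X w) :
    Call (prog C q) 2 (.pair (encG z) (encG w)) (encG (z + w)) (20 * (X + 3)) := by
  refine ⟨caddE, rfl, ?_⟩
  apply Ev.le
  · repeat' first
      | exact Ev.var rfl | apply Ev.pair | apply Ev.add | apply Ev.fst | apply Ev.snd
  · have h1 := hz.intSize_le
    have h2 := hw.intSize_le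
    lia

theorem call_fmul {X : ℕ} {f g : Frac} (hf : FBd X f) (hg : FBd X g) :
    Call (prog C q) 3 (.pair (encF f) (encF g)) (encF (f * g)) (60 * (X + 3)) := by
  refine ⟨fmulE, rfl, ?_⟩
  apply Ev.le
  · repeat' first
      | exact Ev.var rfl | apply Ev.pair | apply Ev.call | apply Ev.fst | apply Ev.snd
    · exact call_cmul hf.1 hg.1
    · exact call_cmul hf.2 hg.2
  · lia

/-- The bound `Y` on the accumulator grows by `S` with each multiplication, and `Y + k * S` is the
invariant that keeps all intermediate results below `X`. -/
theorem call_fpow {X S : ℕ} {g : Frac} (hg : FBd S g) (k : ℕ) : ∀ {Y : ℕ} {f : Frac},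
    FBd Y f → Y + k * S ≤ X → S ≤ X → k ≤ X →
    Call (prog C q) 4 (.pair (encF g) (.pair (.int k) (encF f))) (encF (f * g ^ k))
      ((k + 1) * (100 * (X + 3))) := by
  induction k with
  | zero =>
    intro Y f _ _ _ _
    refine ⟨fpowE, rfl, ?_⟩
    rw [pow_zero, mul_one]
    apply Ev.le
    · apply Ev.ifPosFalse (x := 0)
      · repeat' first
          | exact Ev.var rfl | apply Ev.fst | apply Ev.snd
      · exact le_rfl
      · repeat' first
          | exact Ev.var rfl | apply Ev.fst | apply Ev.snd
    · lia
  | succ k ih =>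
    intro Y f hf hX hS hk
    rw [Nat.succ_mul] at hX
    refine ⟨fpowE, rfl, ?_⟩
    have hfg := hf.mul hg
    have h1 := ih hfg (by lia) hS (by lia)
    have h2 := call_fmul (C := C) (q := q) (X := X) (hf.mono (by lia)) (hg.mono hS)
    rw [pow_succ', ← mul_assoc]
    have hs : intSize ((k + 1 : ℕ) : ℤ) ≤ X := (intSize_le_natAbs _).trans (by lia)
    have hs1 : intSize 1 ≤ 1 := intSize_le_natAbs 1
    have hk' : ((k + 1 : ℕ) : ℤ) - 1 = k := by push_cast; ring
    apply Ev.le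
    · apply Ev.ifPosTrue (x := (k + 1 : ℕ))
      · repeat' first
          | exact Ev.var rfl | apply Ev.fst | apply Ev.snd
      · lia
      · apply Ev.call _ (hk' ▸ h1)
        repeat' first
          | exact Ev.var rfl | exact Ev.const _ | apply Ev.pair | apply Ev.sub | apply Ev.call
          | apply Ev.fst | apply Ev.snd
        exact h2
    · lia

end Specs

/-- The integers `2 ^ b`, `β'`, `γ'`, `λ'` of the dyadic approximations of the parameters. -/
structure ApproxParams where
  W : GaussianInt
  β : GaussianInt
  γ : GaussianInt
  lam : GaussianInt

/-- Approximate parameters as values. -/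
abbrev encP (P : ApproxParams) : Val :=
  .pair (encG P.W) (.pair (encG P.β) (.pair (encG P.γ) (encG P.lam)))

/-- All parameters are bounded by `2 ^ S`. -/
structure ParamBd (S : ℕ) (P : ApproxParams) : Prop where
  W : GBd S P.W
  β : GBd S P.β
  γ : GBd S P.γ
  lam : GBd S P.lam

/-- The contribution of a child whose value is the fraction `f`. -/
def stepF (P : ApproxParams) (f : Frac) : Frac :=
  (P.β * f.1 + P.W * f.2, P.W * f.1 + P.γ * f.2)

theorem FBd.stepF {S X : ℕ} {P : ApproxParams} (hP : ParamBd S P) {f : Frac} (hf : FBd X f) :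
    FBd (S + X + 1) (stepF P f) :=
  ⟨(hP.β.mul hf.1).add (hP.W.mul hf.2), (hP.W.mul hf.1).add (hP.γ.mul hf.2)⟩

/-- A row of the adjacency matrix, restricted to the columns in `l`. -/
def encRow {n : ℕ} (G : SimpleGraph (Fin n)) [DecidableRel G.Adj] (v : Fin n) (l : List (Fin n)) :
    Val := Val.ofList (l.map fun y => .int (if G.Adj v y then 1 else 0))

/-- The entry of a vertex that is present. -/
def encEntry {n : ℕ} (G : SimpleGraph (Fin n)) [DecidableRel G.Adj] (v : Fin n) (a b : ℕ) : Val :=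
  .pair (encRow G v (List.finRange n)) (.pair (.int a) (.int b))

/-- The state, restricted to the vertices in `l`. -/
def encState {n : ℕ} (G : SimpleGraph (Fin n)) [DecidableRel G.Adj] (U : Finset (Fin n))
    (A B : Fin n → ℕ) (l : List (Fin n)) : Val :=
  Val.ofList (l.map fun y => if y ∈ U then encEntry G y (A y) (B y) else .int 0)

theorem encRow_cons {n : ℕ} (G : SimpleGraph (Fin n)) [DecidableRel G.Adj] (v y : Fin n)
    (l : List (Fin n)) :
    encRow G v (y :: l) = .pair (.int (if G.Adj v y then 1 else 0)) (encRow G v l) := rfl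

theorem encState_cons {n : ℕ} (G : SimpleGraph (Fin n)) [DecidableRel G.Adj] (U : Finset (Fin n))
    (A B : Fin n → ℕ) (y : Fin n) (l : List (Fin n)) : encState G U A B (y :: l) =
      .pair (if y ∈ U then encEntry G y (A y) (B y) else .int 0) (encState G U A B l) := rfl

/-- The list consists of consecutive vertices from `i` on, up to the last one. -/
def IsTail {n : ℕ} (i : ℕ) (l : List (Fin n)) : Prop :=
  l.map Fin.val = List.range' i l.length ∧ i + l.length = n

theorem IsTail.cons {n i : ℕ} {y : Fin n} {l : List (Fin n)} (h : IsTail i (y :: l)) :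
    y.val = i ∧ IsTail (i + 1) l := by
  obtain ⟨h1, h2⟩ := h
  simp only [List.map_cons, List.length_cons, List.range'_succ, List.cons.injEq] at h1 h2
  exact ⟨h1.1, h1.2, by lia⟩

theorem isTail_finRange (n : ℕ) : IsTail 0 (List.finRange n) := by
  constructor
  · rw [List.length_finRange, List.map_coe_finRange_eq_range, List.range_eq_range']
  · simp

/-! ### Removal of a vertex from the state of the program. -/

section Specs

variable {C q n : ℕ} {G : SimpleGraph (Fin n)} [DecidableRel G.Adj]

theorem intSize_one_le : intSize 1 ≤ 1 := intSize_le_natAbs 1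

theorem intSize_zero_le : intSize 0 ≤ 0 := intSize_le_natAbs 0

theorem call_step {S X : ℕ} {P : ApproxParams} (hP : ParamBd S P) {f : Frac} (hf : FBd X f) :
    Call (prog C q) 5 (.pair (encP P) (encF f)) (encF (stepF P f)) (200 * (S + X + 3)) := by
  refine ⟨stepE, rfl, ?_⟩
  have hX : X ≤ S + X := by lia
  have hS : S ≤ S + X := by lia
  apply Ev.le
  · repeat' first
      | exact Ev.var rfl | apply Ev.pair | apply Ev.call | apply Ev.fst | apply Ev.snd
    · exact call_cmul (hP.β.mono hS) (hf.1.mono hX)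
    · exact call_cmul (hP.W.mono hS) (hf.2.mono hX)
    · exact call_cadd (hP.β.mul hf.1) (hP.W.mul hf.2)
    · exact call_cmul (hP.W.mono hS) (hf.1.mono hX)
    · exact call_cmul (hP.γ.mono hS) (hf.2.mono hX)
    · exact call_cadd (hP.W.mul hf.1) (hP.γ.mul hf.2)
  · lia

theorem ev_entry {X : ℕ} {U J : Finset (Fin n)} {A B : Fin n → ℕ} {x y : Fin n} {arg : Val}
    {t : ℤ} (hy : y ∈ U → (y ∈ J ↔ 0 < t)) (hAB : y ∈ U → A y ≤ X ∧ B y ≤ X) (hn : n ≤ X) :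
    Ev (prog C q) [.int t, .int ((x : ℤ) - y), if y ∈ U then encEntry G y (A y) (B y) else .int 0, arg]
      entryE (if y ∈ U.erase x then encEntry G y (addBefore Fin.val J x A y)
        (addAfter Fin.val J x B y) else .int 0) (50 * (X + 3)) := by
  have h1 := intSize_one_le
  have h0 := intSize_zero_le
  by_cases hU : y ∈ U
  · rw [if_pos hU]
    have hJ := hy hU
    obtain ⟨hA, hB⟩ := hAB hU
    have hA' : intSize (A y) ≤ X := (intSize_le_natAbs _).trans (by lia)
    have hB' : intSize (B y) ≤ X := (intSize_le_natAbs _).trans (by lia)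
    have hj : intSize ((x : ℤ) - y) ≤ X := (intSize_le_natAbs _).trans (by omega)
    apply Ev.le
    · apply Ev.ifPairTrue (Ev.var rfl)
      -- The sign of x − y decides: a vertex before `x` may get a + half edge, one after `x` a −
      -- half edge, and `x` itself is erased.
      rcases lt_trichotomy y x with hlt | rfl | hgt
      · have hlt' : (y : ℕ) < x := hlt
        apply Ev.ifPosTrue (Ev.var rfl) (by omega)
        rw [if_pos (Finset.mem_erase.2 ⟨hlt.ne, hU⟩)]
        have e2 : addAfter Fin.val J x B y = B y := by simp [addAfter, hlt.le]
        by_cases ht : 0 < t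
        · have e1 : addBefore Fin.val J x A y = A y + 1 := by simp [addBefore, hJ.2 ht, hlt']
          rw [e1, e2]
          simp only [encEntry, Nat.cast_add, Nat.cast_one]
          -- The cost is fixed explicitly because it becomes the common bound of all branches of the
          -- case distinction.
          apply Ev.le (C := 25 * (X + 3))
          · apply Ev.ifPosTrue (Ev.var rfl) ht
            repeat' first
              | exact Ev.var rfl | exact Ev.const _ | apply Ev.pair | apply Ev.add | apply Ev.fst
              | apply Ev.snd
          · lia
        · have e1 : addBefore Fin.val J x A y = A y := by simp [addBefore, hJ, ht]
          rw [e1, e2]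
          apply Ev.le
          · exact Ev.ifPosFalse (Ev.var rfl) (not_lt.1 ht) (Ev.var rfl)
          · lia
      · apply Ev.ifPosFalse (Ev.var rfl) (by omega)
        rw [if_neg (Finset.notMem_erase y U)]
        apply Ev.le
        · apply Ev.ifPosFalse (Ev.sub (Ev.const 0) (Ev.var rfl)) (by omega)
          exact Ev.const 0
        · lia
      · have hlt' : (x : ℕ) < y := hgt
        apply Ev.ifPosFalse (Ev.var rfl) (by omega)
        rw [if_pos (Finset.mem_erase.2 ⟨hgt.ne', hU⟩)]
        have e2 : addBefore Fin.val J x A y = A y := by simp [addBefore, hgt.le]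
        by_cases ht : 0 < t
        · have e1 : addAfter Fin.val J x B y = B y + 1 := by simp [addAfter, hJ.2 ht, hlt']
          rw [e1, e2]
          simp only [encEntry, Nat.cast_add, Nat.cast_one]
          apply Ev.le
          · apply Ev.ifPosTrue (Ev.sub (Ev.const 0) (Ev.var rfl)) (by omega)
            apply Ev.ifPosTrue (Ev.var rfl) ht
            repeat' first
              | exact Ev.var rfl | exact Ev.const _ | apply Ev.pair | apply Ev.add | apply Ev.fst
              | apply Ev.snd
          · lia
        · have e1 : addAfter Fin.val J x B y = B y := by simp [addAfter, hJ, ht]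
          rw [e1, e2]
          apply Ev.le
          · apply Ev.ifPosTrue (Ev.sub (Ev.const 0) (Ev.var rfl)) (by omega)
            exact Ev.ifPosFalse (Ev.var rfl) (not_lt.1 ht) (Ev.var rfl)
          · lia
    · lia
  · have : y ∉ U.erase x := fun h => hU (Finset.mem_of_mem_erase h)
    rw [if_neg hU, if_neg this]
    apply Ev.le
    · exact Ev.ifPairFalse (Ev.var rfl) (Ev.const 0)
    · lia

/-- `IsTail` identifies the list position with the vertex number, so the counter, lowered by one per
entry, is always `x` minus the current vertex. With `s = 0` no half edges are added and the vertex
is only erased. -/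
theorem call_update {X : ℕ} {U J : Finset (Fin n)} {A B : Fin n → ℕ} {x v : Fin n} {s : ℤ}
    (hs : s = 0 ∨ s = 1) (hJ : ∀ y ∈ U, y ∈ J ↔ s = 1 ∧ G.Adj v y)
    (hAB : ∀ y ∈ U, A y ≤ X ∧ B y ≤ X) (hn : n ≤ X) (l : List (Fin n)) : ∀ {i : ℕ}, IsTail i l →
    Call (prog C q) 6 (.pair (encRow G v l) (.pair (encState G U A B l)
        (.pair (.int ((x : ℤ) - i)) (.int s))))
      (encState G (U.erase x) (addBefore Fin.val J x A) (addAfter Fin.val J x B) l)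
      ((l.length + 1) * (100 * (X + 3))) := by
  have h1 := intSize_one_le
  have h0 := intSize_zero_le
  induction l with
  | nil =>
    intro i _
    refine ⟨updateE, rfl, ?_⟩
    apply Ev.le
    · apply Ev.ifPairFalse (x := 0)
      · repeat' first
          | exact Ev.var rfl | apply Ev.fst | apply Ev.snd
      · exact Ev.const 0
    · lia
  | cons y l ih =>
    intro i hl
    obtain ⟨rfl, hl'⟩ := hl.cons
    have hx := x.2
    have hy := y.2
    refine ⟨updateE, rfl, ?_⟩
    have hj : intSize ((x : ℤ) - y) ≤ X := (intSize_le_natAbs _).trans (by omega)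
    have h3 := ih hl'
    have hji : (x : ℤ) - y - 1 = (x : ℤ) - (y + 1 : ℕ) := by push_cast; ring
    rw [← hji] at h3
    rw [encState_cons, encState_cons, encRow_cons]
    have ht : y ∈ U → (y ∈ J ↔ 0 < (if G.Adj v y then (1 : ℤ) else 0) * s) := by
      intro hU
      rw [hJ y hU]
      rcases hs with rfl | rfl <;> by_cases h : G.Adj v y <;> simp [h]
    have hadj : intSize (if G.Adj v y then (1 : ℤ) else 0) ≤ 1 := by
      split_ifs <;> simp [h1, h0.trans]
    have hs' : intSize s ≤ 1 := by rcases hs with rfl | rfl <;> lia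
    have h4 := ev_entry (C := C) (q := q) (G := G) (x := x) (arg := .pair (.pair (.int (if G.Adj v y then 1 else 0)) (encRow G v l))
      (.pair (.pair (if y ∈ U then encEntry G y (A y) (B y) else .int 0) (encState G U A B l))
        (.pair (.int ((x : ℤ) - y)) (.int s)))) ht (hAB y) hn
    apply Ev.le
    · apply Ev.ifPairTrue
      · repeat' first
          | exact Ev.var rfl | apply Ev.fst | apply Ev.snd
      · apply Ev.pair
        · repeat' first
            | exact h4 | exact Ev.var rfl | apply Ev.letIn | apply Ev.mul | apply Ev.fst
            | apply Ev.snd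
        · apply Ev.call _ h3
          repeat' first
            | exact Ev.var rfl | exact Ev.const _ | apply Ev.pair | apply Ev.sub | apply Ev.fst
            | apply Ev.snd
    · rw [List.length_cons]; lia

end Specs

/-! ### List access, initial state and the loop over the children. -/

section Specs

variable {C q n : ℕ} {G : SimpleGraph (Fin n)} [DecidableRel G.Adj]

theorem call_nth {X : ℕ} (l : List Val) : ∀ (i : ℕ) (hi : i < l.length), i ≤ X →
    Call (prog C q) 9 (.pair (Val.ofList l) (.int i)) l[i] ((i + 1) * (20 * (X + 3))) := by
  have h1 := intSize_one_le
  induction l with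
  | nil => exact fun i hi => absurd hi (by simp)
  | cons a l ih =>
    intro i hi hX
    refine ⟨nthE, rfl, ?_⟩
    cases i with
    | zero =>
      apply Ev.le
      · apply Ev.ifPosFalse (x := 0)
        · exact Ev.snd (Ev.var rfl)
        · exact le_rfl
        · exact Ev.fst (Ev.fst (Ev.var rfl))
      · lia
    | succ i =>
      have h := ih i (by simpa using hi) (by lia)
      have hs : intSize ((i + 1 : ℕ) : ℤ) ≤ X := (intSize_le_natAbs _).trans (by omega)
      have hi' : ((i + 1 : ℕ) : ℤ) - 1 = i := by push_cast; ring
      apply Ev.le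
      · apply Ev.ifPosTrue (x := (i + 1 : ℕ))
        · repeat' first
            | exact Ev.var rfl | apply Ev.fst | apply Ev.snd
        · omega
        · apply Ev.call (hf := (hi' ▸ h))
          repeat' first
            | exact Ev.var rfl | exact Ev.const _ | apply Ev.pair | apply Ev.sub | apply Ev.fst
            | apply Ev.snd
      · lia

theorem call_init (l : List (Fin n)) :
    Call (prog C q) 10 (Val.ofList (l.map fun x => encRow G x (List.finRange n)))
      (encState G Finset.univ 0 0 l) ((l.length + 1) * 20) := by
  have h0 := intSize_zero_le
  induction l with
  | nil =>
    refine ⟨initE, rfl, ?_⟩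
    apply Ev.le
    · exact Ev.ifPairFalse (x := 0) (Ev.var rfl) (Ev.const 0)
    · lia
  | cons a l ih =>
    refine ⟨initE, rfl, ?_⟩
    rw [encState_cons, if_pos (Finset.mem_univ a)]
    apply Ev.le
    · apply Ev.ifPairTrue (Ev.var rfl)
      apply Ev.pair
      · repeat' first
          | exact Ev.var rfl | exact Ev.const _ | apply Ev.pair | apply Ev.fst
      · exact Ev.call (Ev.snd (Ev.var rfl)) ih
    · rw [List.length_cons]; lia

theorem intSize_two_pow (b : ℕ) : intSize (2 ^ b) ≤ b + 1 := by
  rw [intSize, Nat.size_le, Int.natAbs_pow]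
  exact Nat.pow_lt_pow_right (by norm_num) (Nat.lt_succ_self b)

theorem call_twoPow (b : ℕ) :
    Call (prog C q) 11 (.int b) (.int (2 ^ b)) ((b + 1) * (20 * (b + 1))) := by
  have h1 := intSize_one_le
  induction b with
  | zero =>
    refine ⟨twoPowE, rfl, ?_⟩
    apply Ev.le
    · exact Ev.ifPosFalse (x := 0) (Ev.var rfl) le_rfl (Ev.const 1)
    · lia
  | succ b ih =>
    refine ⟨twoPowE, rfl, ?_⟩
    rw [pow_succ']
    have h2 : intSize 2 ≤ 2 := intSize_le_natAbs 2
    have hb' : ((b + 1 : ℕ) : ℤ) - 1 = b := by push_cast; ring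
    have hs : intSize ((b + 1 : ℕ) : ℤ) ≤ b + 1 := (intSize_le_natAbs _).trans (by omega)
    have hp := intSize_two_pow b
    apply Ev.le
    · apply Ev.ifPosTrue (x := (b + 1 : ℕ)) (Ev.var rfl) (by omega)
      apply Ev.mul (Ev.const 2)
      exact Ev.call (Ev.sub (Ev.var rfl) (Ev.const 1)) (hb' ▸ ih)
    · nlinarith

/-- The fractions computed by the program. -/
def fracVal (P : ApproxParams) (G : SimpleGraph (Fin n)) [DecidableRel G.Adj] :
    ℕ → Finset (Fin n) → (Fin n → ℕ) → (Fin n → ℕ) → Fin n → Frac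
  | 0, _, _, _, _ => (P.lam, P.W)
  | d + 1, U, A, B, v => (P.lam, P.W) * (P.β, P.W) ^ A v * (P.W, P.γ) ^ B v *
      ∏ x ∈ U.filter (G.Adj v), stepF P (fracVal P G d (U.erase x)
        (addBefore Fin.val (U.filter (G.Adj v)) x A) (addAfter Fin.val (U.filter (G.Adj v)) x B) x)

/-- The recursive calls enter through `hc`, so this induction runs only over the columns still to be
read. Each child raises the exponent of the accumulator by `S + Y₀ + 1`; a column that is not a
child costs only list handling. -/
theorem call_loop {S X Y₀ K : ℕ} {P : ApproxParams} (hP : ParamBd S P) {k : ℤ}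
    {U : Finset (Fin n)} {A B : Fin n → ℕ} {v : Fin n} {c : Fin n → Frac}
    (hAB : ∀ y ∈ U, A y ≤ X ∧ B y ≤ X) (hn : n ≤ X)
    (hc : ∀ x ∈ U.filter (G.Adj v), FBd Y₀ (c x) ∧
      Call (prog C q) 7 (.pair (encP P) (.pair (.int k) (.pair (encEntry G x (A x) (B x))
        (encState G (U.erase x) (addBefore Fin.val (U.filter (G.Adj v)) x A)
          (addAfter Fin.val (U.filter (G.Adj v)) x B) (List.finRange n))))) (encF (c x)) K)
    (l : List (Fin n)) : ∀ {i Y : ℕ} {acc : Frac}, IsTail i l → FBd Y acc →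
    Y + (l.map fun x => if x ∈ U.filter (G.Adj v) then 1 else 0).sum * (S + Y₀ + 1) ≤ X →
    Call (prog C q) 8
      (.pair (.pair (encP P) (.pair (.int k) (.pair (encRow G v (List.finRange n))
          (encState G U A B (List.finRange n)))))
        (.pair (encRow G v l) (.pair (encState G U A B l) (.pair (.int i) (encF acc)))))
      (encF (acc * (l.map fun x => if x ∈ U.filter (G.Adj v) then stepF P (c x) else 1).prod))
      ((l.length + 1) * (100 * (X + 3)) +
        (l.map fun x => if x ∈ U.filter (G.Adj v) then 1 else 0).sum *
          (K + (n + 1) * (100 * (X + 3)) + 400 * (X + 3))) := by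
  have h1 := intSize_one_le
  have h0 := intSize_zero_le
  induction l with
  | nil =>
    intro i Y acc _ _ _
    refine ⟨loopE, rfl, ?_⟩
    rw [List.map_nil, List.prod_nil, mul_one]
    apply Ev.le
    · apply Ev.ifPairFalse (x := 0)
      · repeat' first
          | exact Ev.var rfl | apply Ev.fst | apply Ev.snd
      · repeat' first
          | exact Ev.var rfl | apply Ev.fst | apply Ev.snd
    · lia
  | cons y l ih =>
    intro i Y acc hl hacc hX
    obtain ⟨rfl, hl'⟩ := hl.cons
    have hy := y.2
    have hi : intSize ((y : ℕ) : ℤ) ≤ X := (intSize_le_natAbs _).trans (by omega)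
    have hcast : ((y : ℕ) : ℤ) + 1 = ((y + 1 : ℕ) : ℤ) := by push_cast; ring
    refine ⟨loopE, rfl, ?_⟩
    simp only [List.map_cons, List.sum_cons, List.prod_cons, List.length_cons] at hX ⊢
    rw [encState_cons, encRow_cons]
    by_cases hyJ : y ∈ U.filter (G.Adj v)
    · obtain ⟨hyU, hadj⟩ := Finset.mem_filter.1 hyJ
      obtain ⟨hcb, hcc⟩ := hc y hyJ
      have hst := hcb.stepF hP
      rw [if_pos hyJ, add_mul, one_mul] at hX
      rw [if_pos hyJ, if_pos hyJ, if_pos hyU, if_pos hadj, ← mul_assoc]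
      have h3 := ih hl' (hacc.mul hst) (by lia)
      rw [← hcast] at h3
      have hup := call_update (C := C) (q := q) (G := G) (X := X) (U := U) (A := A) (B := B)
        (x := y) (v := v) (J := U.filter (G.Adj v)) (s := 1) (Or.inr rfl)
        (fun z hz => by simp [hz]) hAB hn (List.finRange n) (isTail_finRange n)
      rw [List.length_finRange, Nat.cast_zero, sub_zero] at hup
      have hs := call_step (C := C) (q := q) hP hcb
      have hm := call_fmul (C := C) (q := q) (X := X) (hacc.mono (by lia)) (hst.mono (by lia))
      apply Ev.le
      · apply Ev.ifPairTrue
        · repeat' first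
            | exact Ev.var rfl | apply Ev.fst | apply Ev.snd
        · apply Ev.call (hf := h3)
          apply Ev.pair (Ev.fst (Ev.var rfl))
          apply Ev.pair (Ev.snd (Ev.fst (Ev.snd (Ev.var rfl))))
          apply Ev.pair (Ev.snd (Ev.fst (Ev.snd (Ev.snd (Ev.var rfl)))))
          apply Ev.pair
          · repeat' first
              | exact Ev.var rfl | exact Ev.const _ | apply Ev.add | apply Ev.fst | apply Ev.snd
          · apply Ev.ifPosTrue (x := 1) (Ev.fst (Ev.fst (Ev.snd (Ev.var rfl)))) one_pos
            apply Ev.ifPairTrue (Ev.fst (Ev.fst (Ev.snd (Ev.snd (Ev.var rfl)))))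
            apply Ev.call (hf := hm)
            apply Ev.pair
            · repeat' first
                | exact Ev.var rfl | apply Ev.fst | apply Ev.snd
            apply Ev.call (hf := hs)
            apply Ev.pair (Ev.fst (Ev.fst (Ev.var rfl)))
            apply Ev.call (hf := hcc)
            apply Ev.pair (Ev.fst (Ev.fst (Ev.var rfl)))
            apply Ev.pair (Ev.fst (Ev.snd (Ev.fst (Ev.var rfl))))
            apply Ev.pair (Ev.fst (Ev.fst (Ev.snd (Ev.snd (Ev.var rfl)))))
            apply Ev.call (hf := hup)
            repeat' first
              | exact Ev.var rfl | exact Ev.const _ | apply Ev.pair | apply Ev.fst | apply Ev.snd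
      · have hSY : S + Y₀ + 1 ≤ X := by lia
        rw [add_mul 1, one_mul]
        lia
    · rw [if_neg hyJ, zero_add] at hX
      rw [if_neg hyJ, if_neg hyJ, one_mul, zero_add]
      have h3 := ih hl' hacc hX
      rw [← hcast] at h3
      apply Ev.le
      · apply Ev.ifPairTrue
        · repeat' first
            | exact Ev.var rfl | apply Ev.fst | apply Ev.snd
        · apply Ev.call (hf := h3)
          apply Ev.pair (Ev.fst (Ev.var rfl))
          apply Ev.pair (Ev.snd (Ev.fst (Ev.snd (Ev.var rfl))))
          apply Ev.pair (Ev.snd (Ev.fst (Ev.snd (Ev.snd (Ev.var rfl)))))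
          apply Ev.pair
          · repeat' first
              | exact Ev.var rfl | exact Ev.const _ | apply Ev.add | apply Ev.fst | apply Ev.snd
          · apply Ev.le (C := 50)
            · by_cases hadj : G.Adj v y
              · have hyU : y ∉ U := fun h => hyJ (Finset.mem_filter.2 ⟨h, hadj⟩)
                rw [if_pos hadj, if_neg hyU]
                apply Ev.ifPosTrue (x := 1) (Ev.fst (Ev.fst (Ev.snd (Ev.var rfl)))) one_pos
                apply Ev.ifPairFalse (x := 0) (Ev.fst (Ev.fst (Ev.snd (Ev.snd (Ev.var rfl)))))
                repeat' first
                  | exact Ev.var rfl | apply Ev.fst | apply Ev.snd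
              · rw [if_neg hadj]
                apply Ev.le
                · apply Ev.ifPosFalse (x := 0) (Ev.fst (Ev.fst (Ev.snd (Ev.var rfl)))) le_rfl
                  repeat' first
                    | exact Ev.var rfl | apply Ev.fst | apply Ev.snd
                · lia
            · lia
      · lia

end Specs

/-- The exponent of the bound for the fractions computed at depth `d`. -/
def expo (Δ : ℕ) : ℕ → ℕ
  | 0 => 1
  | d + 1 => 1 + Δ * (expo Δ d + 2)

theorem one_le_expo (Δ d : ℕ) : 1 ≤ expo Δ d := by
  cases d <;> simp [expo]

theorem expo_le_succ (Δ d : ℕ) : expo Δ d ≤ expo Δ (d + 1) := by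
  induction d with
  | zero => exact one_le_expo Δ 1
  | succ d ih =>
    simp only [expo] at ih ⊢
    gcongr

theorem size_half {k d : ℕ} (h : Nat.size k = d + 1) : Nat.size (k / 2) = d := by
  refine le_antisymm ?_ ?_
  · have := Nat.size_le.1 h.le
    rw [Nat.size_le]
    rw [pow_succ] at this
    lia
  · cases d with
    | zero => simp
    | succ d =>
      have : 2 ^ (d + 1) ≤ k := Nat.lt_size.1 (by lia)
      refine Nat.succ_le_of_lt (Nat.lt_size.2 ?_)
      rw [pow_succ] at this
      lia

/-- Of the Δ + 1 copies of `K` in the new bound, Δ pay for the children. The remaining one is at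
least the base cost, which pays for all local work. -/
theorem node_cost_le {Δ n X a b j K : ℕ} (h : a + b + j ≤ Δ) {d : ℕ}
    (hK : K = (Δ + 1) ^ (d + 1) * ((Δ + 1) * ((n + 1) * (1000 * (X + 3))))) :
    100 + X + (a + 1) * (100 * (X + 3)) + (b + 1) * (100 * (X + 3)) + (n + 1) * (100 * (X + 3)) +
      j * (K + (n + 1) * (100 * (X + 3)) + 400 * (X + 3)) ≤
      (Δ + 1) ^ (d + 1 + 1) * ((Δ + 1) * ((n + 1) * (1000 * (X + 3)))) := by
  have e1 : (Δ + 1) ^ (d + 1 + 1) * ((Δ + 1) * ((n + 1) * (1000 * (X + 3)))) = K + Δ * K := by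
    rw [hK]
    ring
  have e2 : (Δ + 1) * ((n + 1) * (1000 * (X + 3))) ≤ K :=
    hK ▸ Nat.le_mul_of_pos_left _ (by positivity)
  rw [e1]
  obtain ⟨w, hw⟩ : ∃ w, w = X + 3 := ⟨_, rfl⟩
  have hX : 100 + X ≤ 100 * w := by lia
  rw [← hw] at e2 ⊢
  have e3 : j * (K + (n + 1) * (100 * w) + 400 * w) ≤ Δ * K + Δ * ((n + 1) * (500 * w)) := by
    have : (n + 1) * (100 * w) + 400 * w ≤ (n + 1) * (500 * w) := by nlinarith
    calc _ ≤ Δ * (K + (n + 1) * (500 * w)) := Nat.mul_le_mul (by lia) (by lia)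
      _ = _ := by ring
  have e4 : (a + 1) * (100 * w) + (b + 1) * (100 * w) ≤ (Δ + 2) * (100 * w) := by
    rw [← add_mul]
    exact Nat.mul_le_mul_right _ (by lia)
  have e5 : (Δ + 1) * ((n + 1) * (1000 * w)) = Δ * ((n + 1) * (500 * w)) +
      500 * (Δ * (n * w)) + 500 * (Δ * w) + 1000 * (n * w) + 1000 * w := by ring
  have e6 : (Δ + 2) * (100 * w) = 100 * (Δ * w) + 200 * w := by ring
  have e7 : (n + 1) * (100 * w) = 100 * (n * w) + 100 * w := by ring
  have := Nat.zero_le (Δ * (n * w))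
  have := Nat.zero_le (Δ * w)
  have := Nat.zero_le (n * w)
  linarith

/-! ### Evaluation of the truncated recursion. -/

section Specs

variable {C q n : ℕ} {G : SimpleGraph (Fin n)} [DecidableRel G.Adj]

theorem prod_ite_finRange {M : Type*} [CommMonoid M] (J : Finset (Fin n)) (f : Fin n → M) :
    ((List.finRange n).map fun x => if x ∈ J then f x else 1).prod = ∏ x ∈ J, f x := by
  rw [← Fin.prod_univ_def, Finset.prod_ite_mem, Finset.univ_inter]

theorem sum_ite_finRange (J : Finset (Fin n)) :
    ((List.finRange n).map fun x => if x ∈ J then 1 else 0).sum = J.card := by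
  rw [← Fin.sum_univ_def]
  simp

theorem FBd.prod {Y : ℕ} (J : Finset (Fin n)) {f : Fin n → Frac} (h : ∀ x ∈ J, FBd Y (f x)) :
    FBd (J.card * Y) (∏ x ∈ J, f x) := by
  induction J using Finset.induction_on with
  | empty => simpa using FBd.one
  | insert a J ha ih =>
    rw [Finset.prod_insert ha, Finset.card_insert_of_notMem ha, Nat.succ_mul, add_comm]
    exact (h a (Finset.mem_insert_self a J)).mul
      (ih fun i hi => h i (Finset.mem_insert_of_mem hi))

/-- The fuel `k` is halved at each level, so by `size_half` the depth is its number of binary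
digits. Size and cost are bounded together, since the cost of a level depends on the sizes returned
by the level below. -/
theorem call_node {Δ S X : ℕ} {P : ApproxParams} (hP : ParamBd S P) (hS : 1 ≤ S) (hn : n ≤ X)
    (hΔ : Δ ≤ X) (d : ℕ) : ∀ {k : ℕ}, Nat.size k = d → d ≤ X → expo Δ d * S ≤ X →
    ∀ {U : Finset (Fin n)} {A B : Fin n → ℕ} {v : Fin n}, NodeLoadLE G Δ U A B v →
    A v + B v + (U.filter (G.Adj v)).card ≤ Δ →
    FBd (expo Δ d * S) (fracVal P G d U A B v) ∧
    Call (prog C q) 7 (.pair (encP P) (.pair (.int k) (.pair (encEntry G v (A v) (B v))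
        (encState G U A B (List.finRange n))))) (encF (fracVal P G d U A B v))
      ((Δ + 1) ^ (d + 1) * ((Δ + 1) * ((n + 1) * (1000 * (X + 3))))) := by
  induction d with
  | zero =>
    intro k hk _ hX U A B v _ _
    rw [Nat.size_eq_zero] at hk
    subst hk
    refine ⟨⟨hP.lam.mono (by simp [expo]), hP.W.mono (by simp [expo])⟩, nodeE, rfl, ?_⟩
    apply Ev.le
    · apply Ev.ifPosFalse (x := 0) (Ev.fst (Ev.snd (Ev.var rfl))) le_rfl
      repeat' first
        | exact Ev.var rfl | apply Ev.pair | apply Ev.fst | apply Ev.snd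
    · have h0 := intSize_zero_le
      have h1 : 1000 ≤ 1000 * (X + 3) := by lia
      refine le_trans ?_ (h1.trans ?_)
      · lia
      · rw [← mul_assoc, ← mul_assoc]
        exact Nat.le_mul_of_pos_left _ (by positivity)
  | succ d ih =>
    intro k hk hd hX U A B v h hload
    have hk0 : k ≠ 0 := by
      rintro rfl
      simp at hk
    have hexp := expo_le_succ Δ d
    have hXd : expo Δ d * S ≤ X := (Nat.mul_le_mul_right S hexp).trans hX
    set J := U.filter (G.Adj v) with hJ
    -- `T` dominates the exponent of one neighbour, whether pinned (`S`) or a free child; the latter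
    -- uses 1 ≤ `S`.
    set T := (expo Δ d + 2) * S with hT
    have hT1 : S + expo Δ d * S + 1 ≤ T := by
      rw [hT]
      lia
    have hXT : expo Δ (d + 1) * S = S + Δ * T := by
      rw [expo, hT]
      ring
    have hsum : A v * S + B v * S + J.card * (S + expo Δ d * S + 1) ≤ Δ * T := by
      calc _ ≤ A v * T + B v * T + J.card * T := by gcongr <;> lia
        _ = (A v + B v + J.card) * T := by ring
        _ ≤ _ := Nat.mul_le_mul_right T hload
    have hAB : ∀ y ∈ U, A y ≤ X ∧ B y ≤ X := fun y hy => by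
      have := h y hy
      lia
    have hb0 : FBd S (P.lam, P.W) := ⟨hP.lam, hP.W⟩
    have hb1 : FBd S (P.β, P.W) := ⟨hP.β, hP.W⟩
    have hb2 : FBd S (P.W, P.γ) := ⟨hP.W, hP.γ⟩
    have hb3 := hb0.mul (hb1.pow (A v))
    have hb4 := hb3.mul (hb2.pow (B v))
    have hch : ∀ x ∈ J, FBd (expo Δ d * S) (fracVal P G d (U.erase x) (addBefore Fin.val J x A)
        (addAfter Fin.val J x B) x) ∧
      Call (prog C q) 7 (.pair (encP P) (.pair (.int (k / 2 : ℕ)) (.pair (encEntry G x (A x) (B x))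
        (encState G (U.erase x) (addBefore Fin.val J x A)
          (addAfter Fin.val J x B) (List.finRange n))))) (encF (fracVal P G d (U.erase x)
            (addBefore Fin.val J x A) (addAfter Fin.val J x B) x))
        ((Δ + 1) ^ (d + 1) * ((Δ + 1) * ((n + 1) * (1000 * (X + 3))))) := by
      intro x hx
      have h1 := ih (size_half hk) (by lia) hXd (h.child Fin.val (Finset.mem_of_mem_filter x hx))
        (h.child_load Fin.val hx).le
      -- The update does not change the counts at `x` itself, so the program may pass the entry of
      -- the child from the old state.
      have e1 : addBefore Fin.val J x A x = A x := by simp [addBefore]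
      have e2 : addAfter Fin.val J x B x = B x := by simp [addAfter]
      rw [← hJ, e1, e2] at h1
      exact h1
    have hloop := call_loop (C := C) (q := q) hP hAB hn hch (List.finRange n)
      (isTail_finRange n) hb4 (by rw [sum_ite_finRange, ← hJ]; lia)
    rw [sum_ite_finRange, prod_ite_finRange, ← hJ, List.length_finRange, Nat.cast_zero] at hloop
    have hp1 := call_fpow (C := C) (q := q) (X := X) hb1 (A v) hb0 (by lia) (by lia) (by lia)
    have hp2 := call_fpow (C := C) (q := q) (X := X) hb2 (B v) hb3 (by lia) (by lia) (by lia)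
    refine ⟨?_, nodeE, rfl, ?_⟩
    · rw [fracVal, ← hJ]
      exact (hb4.mul (FBd.prod J fun x hx => (hch x hx).1.stepF hP)).mono (by lia)
    · have hks : intSize (k : ℤ) ≤ X := by
        rw [intSize, Int.natAbs_natCast]
        lia
      have h2 : intSize 2 ≤ 2 := intSize_le_natAbs 2
      have h0 := intSize_zero_le
      have hk2 : (k : ℤ) / 2 = (k / 2 : ℕ) := by omega
      rw [fracVal, ← hJ]
      apply Ev.le
      · apply Ev.ifPosTrue (x := k) (Ev.fst (Ev.snd (Ev.var rfl))) (by omega)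
        apply Ev.call (hf := hloop)
        apply Ev.pair
        · rw [← hk2]
          repeat' first
            | exact Ev.var rfl | exact Ev.const _ | apply Ev.pair | apply Ev.div | apply Ev.fst
            | apply Ev.snd
        · apply Ev.pair (Ev.fst (Ev.fst (Ev.snd (Ev.snd (Ev.var rfl)))))
          apply Ev.pair (Ev.snd (Ev.snd (Ev.snd (Ev.var rfl))))
          apply Ev.pair (Ev.const 0)
          apply Ev.call (hf := hp2)
          apply Ev.pair
          · repeat' first
              | exact Ev.var rfl | apply Ev.pair | apply Ev.fst | apply Ev.snd
          apply Ev.pair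
          · repeat' first
              | exact Ev.var rfl | apply Ev.fst | apply Ev.snd
          apply Ev.call (hf := hp1)
          repeat' first
            | exact Ev.var rfl | apply Ev.pair | apply Ev.fst | apply Ev.snd
      · refine le_trans ?_ (node_cost_le hload rfl)
        omega

end Specs

/-! ### The product over all vertices and the whole run. -/

section Specs

variable {C q n : ℕ} {G : SimpleGraph (Fin n)} [DecidableRel G.Adj]

theorem IsTail.le {i : ℕ} {l : List (Fin n)} (h : IsTail i l) {y : Fin n} (hy : y ∈ l) : i ≤ y := by
  have h1 := List.mem_map_of_mem (f := Fin.val) hy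
  rw [h.1, List.mem_range'_1] at h1
  exact h1.1

/-- The product of the contributions of the vertices in the list. -/
def sweepVal (P : ApproxParams) (G : SimpleGraph (Fin n)) [DecidableRel G.Adj] (d : ℕ) :
    List (Fin n) → Finset (Fin n) → (Fin n → ℕ) → (Fin n → ℕ) → Frac
  | [], _, _, _ => 1
  | x :: l, U, A, B =>
    (P.γ, P.W) ^ B x * ((fracVal P G d (U.erase x) A B x).1 + (fracVal P G d (U.erase x) A B x).2,
      (fracVal P G d (U.erase x) A B x).2) *
    sweepVal P G d l (U.erase x) (addBefore Fin.val ((U.erase x).filter (G.Adj x)) x A)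
      (addAfter Fin.val ((U.erase x).filter (G.Adj x)) x B)

/-- Two updates are made per vertex: erasing `y` without half edges gives the state in which its
ratio is evaluated, and the second update adds the half edges for the rest of the sweep. -/
theorem call_sweep {Δ S X : ℕ} {P : ApproxParams} (hP : ParamBd S P) (hS : 1 ≤ S) (hn : n ≤ X)
    (hΔ : Δ ≤ X) {k : ℕ} (hk : Nat.size k ≤ X) (hX : expo Δ (Nat.size k) * S ≤ X)
    (l : List (Fin n)) : ∀ {i Y : ℕ} {acc : Frac} {U : Finset (Fin n)} {A B : Fin n → ℕ},
    IsTail i l → (∀ x ∈ l, x ∈ U) → LoadLE G Δ U A B → FBd Y acc →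
    Y + l.length * (Δ * S + expo Δ (Nat.size k) * S + 1) ≤ X →
    FBd (Y + l.length * (Δ * S + expo Δ (Nat.size k) * S + 1))
      (acc * sweepVal P G (Nat.size k) l U A B) ∧
    Call (prog C q) 12 (.pair (.pair (encP P) (.int k))
        (.pair (Val.ofList (l.map fun x => encRow G x (List.finRange n))) (.pair (.int i)
          (.pair (encState G U A B (List.finRange n)) (encF acc)))))
      (encF (acc * sweepVal P G (Nat.size k) l U A B))
      ((l.length + 1) * (((Δ + 1) ^ (Nat.size k + 1) * ((Δ + 1) * ((n + 1) * (1000 * (X + 3))))) +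
        (Δ + 1) * (100 * (X + 3)) + (n + 1) * (400 * (X + 3)))) := by
  have h1 := intSize_one_le
  have h0 := intSize_zero_le
  induction l with
  | nil =>
    intro i Y acc U A B _ _ _ hacc _
    rw [sweepVal, mul_one]
    refine ⟨by simpa using hacc, sweepE, rfl, ?_⟩
    apply Ev.le
    · apply Ev.ifPairFalse (x := 0)
      · exact Ev.fst (Ev.snd (Ev.var rfl))
      · repeat' first
          | exact Ev.var rfl | apply Ev.snd
    · have : 1 * (400 * (X + 3)) ≤ (n + 1) * (400 * (X + 3)) := Nat.mul_le_mul_right _ (by lia)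
      rw [List.length_nil, zero_add, one_mul]
      lia
  | cons y l ih =>
    intro i Y acc U A B hl hU hL hacc hYX
    obtain ⟨rfl, hl'⟩ := hl.cons
    have hy := y.2
    have hyU : y ∈ U := hU y List.mem_cons_self
    have hN := hL.nodeLoadLE hyU
    have hAB : ∀ z ∈ U, A z ≤ X ∧ B z ≤ X := fun z hz => by
      have := hL z hz
      lia
    have hABe : ∀ z ∈ U.erase y, A z ≤ X ∧ B z ≤ X := fun z hz => hAB z (Finset.mem_of_mem_erase hz)
    obtain ⟨hfb, hnode⟩ := call_node (C := C) (q := q) hP hS hn hΔ _ rfl hk hX hN (hL.node_load hyU)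
    have hBy : B y ≤ Δ := by
      have := hL y hyU
      lia
    set f := fracVal P G (Nat.size k) (U.erase y) A B y with hf
    set J := (U.erase y).filter (G.Adj y) with hJ
    set E := expo Δ (Nat.size k) * S with hE
    have hg : FBd S (P.γ, P.W) := ⟨hP.γ, hP.W⟩
    have hfs : FBd (E + 1) (f.1 + f.2, f.2) := ⟨hfb.1.add hfb.2, hfb.2.mono (by lia)⟩
    have hBS : B y * S ≤ Δ * S := Nat.mul_le_mul_right S hBy
    have hpow := hacc.mul (hg.pow (B y))
    rw [List.length_cons, Nat.succ_mul] at hYX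
    have hSX : S ≤ X := (Nat.le_mul_of_pos_left S (one_le_expo Δ (Nat.size k))).trans hX
    have hp := call_fpow (C := C) (q := q) (X := X) hg (B y) hacc (by lia) hSX (by lia)
    have hc := call_cadd (C := C) (q := q) hfb.1 hfb.2
    have hm := call_fmul (C := C) (q := q) (X := X) (hpow.mono (by lia)) (hfs.mono (by lia))
    have hnth := call_nth (C := C) (q := q) (X := X)
      ((List.finRange n).map fun z => if z ∈ U then encEntry G z (A z) (B z) else .int 0) y
      (by simp) (by lia)
    have hget : ((List.finRange n).map fun z => if z ∈ U then encEntry G z (A z) (B z) else .int 0)[(y : ℕ)]'(by simp) =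
        encEntry G y (A y) (B y) := by simp [hyU]
    rw [hget] at hnth
    have hup1 := call_update (C := C) (q := q) (G := G) (X := X) (U := U) (A := A) (B := B)
      (x := y) (v := y) (J := ∅) (s := 0) (Or.inl rfl) (fun z hz => by simp) hAB hn
      (List.finRange n) (isTail_finRange n)
    have hA0 : addBefore Fin.val ∅ y A = A := by ext z; simp [addBefore]
    have hB0 : addAfter Fin.val ∅ y B = B := by ext z; simp [addAfter]
    rw [List.length_finRange, Nat.cast_zero, sub_zero, hA0, hB0] at hup1
    have hup2 := call_update (C := C) (q := q) (G := G) (X := X) (U := U.erase y) (A := A) (B := B)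
      (x := y) (v := y) (J := J) (s := 1) (Or.inr rfl)
      (fun z hz => by rw [hJ, Finset.mem_filter]; simp [hz]) hABe hn
      (List.finRange n) (isTail_finRange n)
    -- The second update starts from a state without `y`, so its erasure has no effect.
    rw [List.length_finRange, Nat.cast_zero, sub_zero,
      Finset.erase_eq_of_notMem (Finset.notMem_erase y U)] at hup2
    have hL' : LoadLE G Δ (U.erase y) (addBefore Fin.val J y A) (addAfter Fin.val J y B) := by
      refine hN.loadLE_after fun z hz => ?_
      have hzJ : z ∈ J ↔ G.Adj y z := by rw [hJ, Finset.mem_filter]; simp [hz]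
      simp only [addBefore, addAfter, hzJ, adjInd]
      split_ifs <;> lia
    have hY' : Y + B y * S + (E + 1) + l.length * (Δ * S + E + 1) ≤
        Y + (l.length * (Δ * S + E + 1) + (Δ * S + E + 1)) := by lia
    obtain ⟨hb, h3⟩ := ih hl' (fun z hz => Finset.mem_erase.2 ⟨fun h => by
      have := hl'.le hz
      rw [h] at this
      lia, hU z (List.mem_cons_of_mem _ hz)⟩) hL' (hpow.mul hfs) (hY'.trans hYX)
    have hcast : ((y : ℕ) : ℤ) + 1 = ((y + 1 : ℕ) : ℤ) := by push_cast; ring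
    rw [← hcast] at h3
    have hval : acc * sweepVal P G (Nat.size k) (y :: l) U A B =
        acc * (P.γ, P.W) ^ B y * (f.1 + f.2, f.2) * sweepVal P G (Nat.size k) l (U.erase y)
          (addBefore Fin.val J y A) (addAfter Fin.val J y B) := by
      rw [sweepVal, ← hJ, ← hf]
      ring
    have hi : intSize ((y : ℕ) : ℤ) ≤ X := (intSize_le_natAbs _).trans (by omega)
    rw [hval]
    refine ⟨hb.mono (by rw [List.length_cons, Nat.succ_mul]; exact hY'), sweepE, rfl, ?_⟩
    apply Ev.le
    · apply Ev.ifPairTrue (Ev.fst (Ev.snd (Ev.var rfl)))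
      apply Ev.letIn
      · apply Ev.call (hf := hnth)
        repeat' first
          | exact Ev.var rfl | apply Ev.pair | apply Ev.fst | apply Ev.snd
      apply Ev.letIn
      · apply Ev.call (hf := hup1)
        repeat' first
          | exact Ev.var rfl | exact Ev.const _ | apply Ev.pair | apply Ev.fst | apply Ev.snd
      apply Ev.letIn
      · apply Ev.call (hf := hnode)
        repeat' first
          | exact Ev.var rfl | apply Ev.pair | apply Ev.fst | apply Ev.snd
      apply Ev.call (hf := h3)
      apply Ev.pair (Ev.fst (Ev.var rfl))
      apply Ev.pair (Ev.snd (Ev.fst (Ev.snd (Ev.var rfl))))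
      apply Ev.pair
      · repeat' first
          | exact Ev.var rfl | exact Ev.const _ | apply Ev.add | apply Ev.fst | apply Ev.snd
      apply Ev.pair
      · apply Ev.call (hf := hup2)
        repeat' first
          | exact Ev.var rfl | exact Ev.const _ | apply Ev.pair | apply Ev.fst | apply Ev.snd
      · apply Ev.call (hf := hm)
        apply Ev.pair
        · apply Ev.call (hf := hp)
          repeat' first
            | exact Ev.var rfl | apply Ev.pair | apply Ev.fst | apply Ev.snd
        · apply Ev.pair
          · exact Ev.call (Ev.var rfl) hc
          · exact Ev.snd (Ev.var rfl)
    · rw [List.length_cons, Nat.succ_mul (l.length + 1)]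
      have e1 : ((y : ℕ) + 1) * (20 * (X + 3)) ≤ (n + 1) * (20 * (X + 3)) :=
        Nat.mul_le_mul_right _ (by lia)
      have e2 : (B y + 1) * (100 * (X + 3)) ≤ (Δ + 1) * (100 * (X + 3)) :=
        Nat.mul_le_mul_right _ (by lia)
      have e3 : (n + 1) * (400 * (X + 3)) = (n + 1) * (20 * (X + 3)) + (n + 1) * (100 * (X + 3)) +
        (n + 1) * (100 * (X + 3)) + (n + 1) * (180 * (X + 3)) := by ring
      have e4 : 180 * (X + 3) ≤ (n + 1) * (180 * (X + 3)) := Nat.le_mul_of_pos_left _ (by positivity)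
      rw [e3]
      have e5 : E + 3 ≤ X + 3 := by lia
      obtain ⟨z, hz⟩ : ∃ z, z = (Δ + 1) ^ (Nat.size k + 1) *
        ((Δ + 1) * ((n + 1) * (1000 * (X + 3)))) := ⟨_, rfl⟩
      rw [← hz]
      clear hz
      lia

theorem call_quot {X : ℕ} {f : Frac} (hf : FBd X f) :
    Call (prog C q) 13 (encF f) (.pair (.int (f.1 * star f.2).re) (.pair (.int (f.1 * star f.2).im)
      (.int (f.2.re * f.2.re + f.2.im * f.2.im)))) (100 * (X + 3)) := by
  have h0 := intSize_zero_le
  have hst : star f.2 = ⟨f.2.re, 0 - f.2.im⟩ := by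
    ext <;> simp
  have hb : GBd X (star f.2) := by
    have := hf.2
    unfold GBd at this ⊢
    rw [Zsqrtd.re_star, Zsqrtd.im_star, Int.natAbs_neg]
    exact this
  have hc := call_cmul (C := C) (q := q) hf.1 hb
  rw [hst] at hc ⊢
  have h2 := hf.2.intSize_le
  have h3 := intSize_mul_le f.2.re f.2.re
  have h4 := intSize_mul_le f.2.im f.2.im
  refine ⟨quotE, rfl, ?_⟩
  apply Ev.le
  · apply Ev.letIn
    · apply Ev.call (hf := hc)
      repeat' first
        | exact Ev.var rfl | exact Ev.const _ | apply Ev.pair | apply Ev.sub | apply Ev.fst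
        | apply Ev.snd
    · repeat' first
        | exact Ev.var rfl | apply Ev.pair | apply Ev.add | apply Ev.mul | apply Ev.fst
        | apply Ev.snd
  · lia

theorem ev_fuel {X m : ℕ} {v w : Val} (hn : n ≤ X) (hm : m ≤ X) (q' : ℕ)
    (hX : ∀ j ≤ q', intSize ((C : ℤ) * (n + m) ^ j) ≤ X) :
    Ev (prog C q) [.pair (.int n) (.pair v (.pair (.int m) w))] (fuelE C q')
      (.int (C * (n + m) ^ q')) ((q' + 1) * (20 * (X + 3))) := by
  induction q' with
  | zero =>
    have := hX 0 le_rfl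
    rw [pow_zero, mul_one] at this ⊢
    exact (Ev.const _).le (by lia)
  | succ j ih =>
    have h1 := ih fun i hi => hX i (by lia)
    have h2 := hX j (by lia)
    have hn' : intSize (n : ℤ) ≤ X := (intSize_le_natAbs _).trans (by omega)
    have hm' : intSize (m : ℤ) ≤ X := (intSize_le_natAbs _).trans (by omega)
    have hnm : intSize ((n : ℤ) + m) ≤ 2 * X := (intSize_le_natAbs _).trans (by omega)
    rw [pow_succ, ← mul_assoc]
    apply Ev.le
    · apply Ev.mul h1
      repeat' first
        | exact Ev.var rfl | apply Ev.add | apply Ev.fst | apply Ev.snd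
    · lia

theorem runsTo_main {Δ S X m b : ℕ} {β' γ' lam' : ℤ × ℤ} {P : ApproxParams}
    (hPe : P = ⟨⟨2 ^ b, 0⟩, ⟨β'.1, β'.2⟩, ⟨γ'.1, γ'.2⟩, ⟨lam'.1, lam'.2⟩⟩)
    (hP : ParamBd S P) (hS : 1 ≤ S) (hn : n ≤ X) (hm : m ≤ X) (hb : b ≤ X)
    (hΔ : Δ ≤ X) {D : ℕ} (hD : D = Nat.size (C * (n + m) ^ q)) (hk : D ≤ X)
    (hX : n * (Δ * S + expo Δ D * S + 1) + expo Δ D * S ≤ X)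
    (hC : ∀ j ≤ q, intSize ((C : ℤ) * (n + m) ^ j) ≤ X) (hL : LoadLE G Δ Finset.univ 0 0) :
    ∃ c ≤ (n + 1) * ((Δ + 1) ^ (D + 1) * ((Δ + 1) * ((n + 1) * (1000 * (X + 3)))) +
        (Δ + 1) * (100 * (X + 3)) + (n + 1) * (400 * (X + 3))) + (X + 1) * (20 * (X + 1)) +
        (q + 1) * (20 * (X + 3)) + (n + 1) * 20 + 200 * (X + 3),
      RunsTo (prog C q) (.pair (.int n) (.pair
        (Val.ofList ((List.finRange n).map fun x => encRow G x (List.finRange n)))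
        (.pair (.int m) (.pair (.int b) (.pair (Val.ofIntPair β')
          (.pair (Val.ofIntPair γ') (Val.ofIntPair lam')))))))
        (.pair (.int (((sweepVal P G D (List.finRange n) Finset.univ 0 0).1 *
            star (sweepVal P G D (List.finRange n) Finset.univ 0 0).2).re))
          (.pair (.int (((sweepVal P G D (List.finRange n) Finset.univ 0 0).1 *
            star (sweepVal P G D (List.finRange n) Finset.univ 0 0).2).im))
          (.int ((sweepVal P G D (List.finRange n) Finset.univ 0 0).2.re *
            (sweepVal P G D (List.finRange n) Finset.univ 0 0).2.re +
            (sweepVal P G D (List.finRange n) Finset.univ 0 0).2.im *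
            (sweepVal P G D (List.finRange n) Finset.univ 0 0).2.im)))) c := by
  have h0 := intSize_zero_le
  have h1 := intSize_one_le
  subst hD
  obtain ⟨hfb, hsw⟩ := call_sweep (C := C) (q := q) (G := G) hP hS hn hΔ hk (by lia) (List.finRange n)
    (i := 0) (Y := 0) (acc := 1) (U := Finset.univ) (A := 0) (B := 0) (isTail_finRange n) (by simp)
    hL FBd.one (by rw [List.length_finRange]; lia)
  rw [List.length_finRange, one_mul] at hfb hsw
  have hq := call_quot (C := C) (q := q) hfb
  have hini := call_init (C := C) (q := q) (G := G) (List.finRange n)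
  have htp := call_twoPow (C := C) (q := q) b
  have hfu := ev_fuel (C := C) (q := q) (n := n)
    (v := Val.ofList ((List.finRange n).map fun x => encRow G x (List.finRange n)))
    (w := .pair (.int b) (.pair (Val.ofIntPair β') (.pair (Val.ofIntPair γ') (Val.ofIntPair lam'))))
    hn hm q hC
  have hcast : ((C * (n + m) ^ q : ℕ) : ℤ) = (C : ℤ) * (n + m) ^ q := by push_cast; rfl
  rw [hcast] at hsw
  rw [List.length_finRange] at hini
  change Ev (prog C q) [_] (.call 0 (.var 0)) _ _
  apply Ev.le
  · apply Ev.call (Ev.var rfl)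
    refine ⟨mainE C q, rfl, ?_⟩
    apply Ev.call (hf := hq)
    apply Ev.call (hf := hsw)
    apply Ev.pair
    · apply Ev.pair
      · rw [hPe]
        apply Ev.pair
        · apply Ev.pair
          · apply Ev.call (hf := htp)
            repeat' first
              | exact Ev.var rfl | apply Ev.fst | apply Ev.snd
          · exact Ev.const 0
        · repeat' first
            | exact Ev.var rfl | apply Ev.snd
      · exact hfu
    · apply Ev.pair (Ev.fst (Ev.snd (Ev.var rfl)))
      apply Ev.pair (Ev.const 0)
      apply Ev.pair
      · exact Ev.call (Ev.fst (Ev.snd (Ev.var rfl))) hini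
      · repeat' first
          | exact Ev.const _ | apply Ev.pair
  · have e1 : (b + 1) * (20 * (b + 1)) ≤ (X + 1) * (20 * (X + 1)) := by gcongr
    have e2 := Nat.zero_le (expo Δ (Nat.size (C * (n + m) ^ q)) * S)
    lia

end Specs

/-! ## Correctness -/

/-- The complex number that is represented by a fraction. -/
noncomputable def fval : Frac →* ℂ where
  toFun f := GaussianInt.toComplex f.1 / GaussianInt.toComplex f.2
  map_one' := by simp
  map_mul' f g := by simp [div_mul_div_comm]

theorem fval_apply (f : Frac) :
    fval f = GaussianInt.toComplex f.1 / GaussianInt.toComplex f.2 := rfl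

theorem snd_prod_ne_zero {ι : Type*} (s : Finset ι) {f : ι → Frac} (h : ∀ i ∈ s, (f i).2 ≠ 0) :
    (∏ i ∈ s, f i).2 ≠ 0 := by
  rw [Prod.snd_prod]
  exact Finset.prod_ne_zero_iff.2 h

/-- The approximate parameters as complex numbers. -/
noncomputable def ApproxParams.toSpin (P : ApproxParams) : SpinParams :=
  ⟨fval (P.β, P.W), fval (P.γ, P.W), fval (P.lam, P.W)⟩

/-- Numerator and denominator of the recursion step are both scaled by `W` times the old
denominator, so no division is performed. The new denominator is nonzero exactly because the
argument avoids the pole. -/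
theorem stepF_spec {P : ApproxParams} (hW : P.W ≠ 0) {f : Frac} (hf : f.2 ≠ 0)
    (h : fval f + P.toSpin.γ ≠ 0) : (stepF P f).2 ≠ 0 ∧ fval (stepF P f) = fac P.toSpin (fval f) := by
  have hW' : GaussianInt.toComplex P.W ≠ 0 := by simpa using hW
  have hf' : GaussianInt.toComplex f.2 ≠ 0 := by simpa using hf
  simp only [ApproxParams.toSpin, fval_apply] at h
  have h1 : GaussianInt.toComplex (stepF P f).2 = (GaussianInt.toComplex f.1 / GaussianInt.toComplex f.2
      + GaussianInt.toComplex P.γ / GaussianInt.toComplex P.W) *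
        (GaussianInt.toComplex P.W * GaussianInt.toComplex f.2) := by
    simp only [stepF, map_add, map_mul]
    field_simp
  have h2 : GaussianInt.toComplex (stepF P f).1 = (GaussianInt.toComplex P.β /
      GaussianInt.toComplex P.W * (GaussianInt.toComplex f.1 / GaussianInt.toComplex f.2) + 1) *
        (GaussianInt.toComplex P.W * GaussianInt.toComplex f.2) := by
    simp only [stepF, map_add, map_mul]
    field_simp
  constructor
  · intro h0
    rw [h0, map_zero] at h1
    exact mul_ne_zero h (mul_ne_zero hW' hf') h1.symm
  · rw [fval_apply, h1, h2, mul_div_mul_right _ _ (mul_ne_zero hW' hf')]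
    rfl

/-- The constant by which errors in the parameters grow per level of the recursion. -/
noncomputable def growth (Δ : ℕ) (κ K : ℝ) : ℝ := (Δ + 1) * facBound κ K ^ (Δ + 1)

theorem one_le_growth (Δ : ℕ) {κ K : ℝ} (hκ : 0 < κ) (hK : 0 ≤ K) : 1 ≤ growth Δ κ K := by
  have h1 := one_le_pow₀ (n := Δ + 1) (one_le_facBound hκ hK)
  have h2 : (1 : ℝ) ≤ Δ + 1 := by
    have : (0 : ℝ) ≤ Δ := Nat.cast_nonneg Δ
    linarith
  exact one_le_mul_of_one_le_of_one_le h2 h1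

section Correct

variable {n Δ : ℕ} {G : SimpleGraph (Fin n)} [DecidableRel G.Adj] {ζ : SpinParams} {Q : Set ℂ}

/-- No contraction is used: each level multiplies the error by the Lipschitz constant `growth`.
While the error stays below κ, the computed values remain away from the pole, which makes the
denominators nonzero and the Lipschitz bound valid at the next level. -/
theorem fracVal_spec (H : RecInvariant ζ Δ Q) {κ K ε : ℝ} (hκ : 0 < κ) (hK : 0 ≤ K)
    (hb : ∀ ζ' : SpinParams, paramDist ζ ζ' ≤ κ → ParamBound κ K ζ' ∧
      ∀ x x' : ℂ, ChildValue ζ Q x → ‖x - x'‖ ≤ κ → ArgBound κ K ζ' x')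
    {P : ApproxParams} (hW : P.W ≠ 0) (hP : paramDist ζ P.toSpin ≤ ε) (hε : ε ≤ κ) (d : ℕ) :
    growth Δ κ K ^ d * ε ≤ κ →
    ∀ {U : Finset (Fin n)} {A B : Fin n → ℕ} {v : Fin n}, NodeLoadLE G Δ U A B v →
      A v + B v + (U.filter (G.Adj v)).card ≤ Δ →
      (fracVal P G d U A B v).2 ≠ 0 ∧
      ‖truncVal ζ G Fin.val d U A B v - fval (fracVal P G d U A B v)‖ ≤ growth Δ κ K ^ d * ε := by
  have hε0 : 0 ≤ ε := (paramDist_nonneg _ _).trans hP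
  have hL := one_le_growth Δ hκ hK
  have hM := one_le_facBound hκ hK
  obtain ⟨hp, ha⟩ := hb ζ (by rw [paramDist_self]; exact hκ.le)
  obtain ⟨hp', ha'⟩ := hb P.toSpin (hP.trans hε)
  induction d with
  | zero =>
    intro _ U A B v _ _
    refine ⟨hW, ?_⟩
    rw [pow_zero, one_mul]
    exact (le_max_right _ _).trans ((le_max_right _ _).trans hP)
  | succ d ih =>
    intro hd U A B v h hload
    have hdd : growth Δ κ K ^ d * ε ≤ growth Δ κ K ^ (d + 1) * ε :=
      mul_le_mul_of_nonneg_right (pow_le_pow_right₀ hL (Nat.le_succ d)) hε0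
    have hεd : ε ≤ growth Δ κ K ^ d * ε := le_mul_of_one_le_left hε0 (one_le_pow₀ hL)
    set J := U.filter (G.Adj v) with hJ
    have hch : ∀ x ∈ J, _ := fun x hx => ih (hdd.trans hd)
      (h.child Fin.val (Finset.mem_of_mem_filter x hx)) (h.child_load Fin.val hx).le
    have hT : ∀ x ∈ J, _ := fun x hx => H.childValue_truncVal Fin.val d
      (h.child Fin.val (Finset.mem_of_mem_filter x hx)) (h.child_load Fin.val hx)
    rw [← hJ] at hch hT
    have harg : ∀ x ∈ J, ArgBound κ K P.toSpin _ := fun x hx =>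
      ha' _ _ (hT x hx) ((hch x hx).2.trans (hdd.trans hd))
    have hst : ∀ x ∈ J, _ := fun x hx => stepF_spec hW (hch x hx).1
      (norm_pos_iff.1 (hκ.trans_le (harg x hx).ge))
    have hγ : P.γ ≠ 0 := by
      intro h0
      have := hκ.trans_le hp'.γ_ge
      simp [ApproxParams.toSpin, fval_apply, h0] at this
    have hval : fval (fracVal P G (d + 1) U A B v) =
        nodeVal P.toSpin (A v) (B v) J fun x => fval (fracVal P G d (U.erase x)
          (addBefore Fin.val J x A) (addAfter Fin.val J x B) x) := by
      rw [fracVal, map_mul, map_mul, map_mul, map_pow, map_pow, map_prod, ← hJ, nodeVal,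
        Finset.prod_congr rfl fun x hx => (hst x hx).2]
      congr 2
      rw [← inv_pow]
      congr 1
      simp [ApproxParams.toSpin, fval_apply]
    constructor
    · rw [fracVal, ← hJ]
      refine mul_ne_zero (mul_ne_zero (mul_ne_zero hW (pow_ne_zero _ hW)) (pow_ne_zero _ hγ)) ?_
      exact snd_prod_ne_zero J fun x hx => (hst x hx).1
    · have hr : 0 ≤ growth Δ κ K ^ d * ε := hε0.trans hεd
      have := ((closePair_nodeVal hκ hK hp hp' (hP.trans hεd) (a := A v) (b := B v) (J := J)
        (fun x hx => ha _ _ (hT x hx) (by simpa using hκ.le)) harg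
        (fun x hx => (hch x hx).2)).mono (n := Δ + 1) hM hr (by lia)).sub
      rw [truncVal, ← hJ, hval]
      refine this.trans (le_of_eq ?_)
      rw [pow_succ, growth]
      push_cast
      ring

theorem norm_mul_sub_mul_le {z w z' w' : ℂ} {δ ε : ℝ} (h : ‖z' - z‖ ≤ δ * ‖z‖)
    (h' : ‖w' - w‖ ≤ ε * ‖w‖) (hδ : 0 ≤ δ) :
    ‖z' * w' - z * w‖ ≤ ((1 + δ) * (1 + ε) - 1) * ‖z * w‖ := by
  have e : z' * w' - z * w = (z' - z) * w' + z * (w' - w) := by ring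
  have h1 : ‖w'‖ ≤ (1 + ε) * ‖w‖ := by
    have := norm_add_le (w' - w) w
    rw [sub_add_cancel] at this
    linarith
  rw [e]
  refine (norm_add_le _ _).trans ?_
  rw [norm_mul, norm_mul, norm_mul]
  calc _ ≤ δ * ‖z‖ * ((1 + ε) * ‖w‖) + ‖z‖ * (ε * ‖w‖) := by gcongr
    _ = _ := by ring

/-- By `subZ_insert_eq` the partition function is the product of the factors γ^B (1 + R) along the
list, and relative errors multiply. -/
theorem sweepVal_spec (H : RecInvariant ζ Δ Q) {P : ApproxParams} {d : ℕ} {δ : ℝ} (hδ : 0 ≤ δ)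
    (hW : P.W ≠ 0)
    (h : ∀ (U : Finset (Fin n)) (A B : Fin n → ℕ) (v : Fin n), NodeLoadLE G Δ U A B v →
      A v + B v + (U.filter (G.Adj v)).card ≤ Δ → (fracVal P G d U A B v).2 ≠ 0 ∧
      ‖P.toSpin.γ ^ B v * (1 + fval (fracVal P G d U A B v)) -
        ζ.γ ^ B v * (1 + nodeRatio ζ G U A B v)‖ ≤
        δ * ‖ζ.γ ^ B v * (1 + nodeRatio ζ G U A B v)‖)
    (l : List (Fin n)) : ∀ {i : ℕ} {U : Finset (Fin n)} {A B : Fin n → ℕ}, IsTail i l →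
    (∀ x, x ∈ U ↔ x ∈ l) → LoadLE G Δ U A B →
    (sweepVal P G d l U A B).2 ≠ 0 ∧ ‖fval (sweepVal P G d l U A B) - subZ ζ G U A B‖ ≤
      ((1 + δ) ^ l.length - 1) * ‖subZ ζ G U A B‖ := by
  induction l with
  | nil =>
    intro i U A B _ hU _
    have : U = ∅ := by
      ext x
      simp [hU x]
    subst this
    simp [sweepVal, subZ_empty]
  | cons y l ih =>
    intro i U A B hl hU hL
    obtain ⟨rfl, hl'⟩ := hl.cons
    have hyU : y ∈ U := (hU y).2 List.mem_cons_self
    have hlt : ∀ z ∈ l, y < z := fun z hz => Fin.lt_def.2 (hl'.le hz)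
    have hU' : ∀ x, x ∈ U.erase y ↔ x ∈ l := by
      intro x
      rw [Finset.mem_erase, hU, List.mem_cons]
      constructor
      · rintro ⟨h1, h2⟩
        exact h2.resolve_left h1
      · exact fun hx => ⟨(hlt x hx).ne', Or.inr hx⟩
    have hN := hL.nodeLoadLE hyU
    obtain ⟨hf, hfv⟩ := h _ A B y hN (hL.node_load hyU)
    set J := (U.erase y).filter (G.Adj y) with hJ
    -- The sweep goes in increasing order, so every remaining vertex comes after `y` and the update
    -- adds only − half edges, as the product formula requires.
    have hA : ∀ z ∈ U.erase y, addBefore Fin.val J y A z = A z := fun z hz => by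
      have := hlt z ((hU' z).1 hz)
      simp [addBefore, this.le]
    have hB : ∀ z ∈ U.erase y, addAfter Fin.val J y B z = (B + adjInd G y) z := fun z hz => by
      have := hlt z ((hU' z).1 hz)
      have hzJ : z ∈ J ↔ G.Adj y z := by rw [hJ, Finset.mem_filter]; simp [hz]
      simp [addAfter, this, hzJ, adjInd]
    have hL' : LoadLE G Δ (U.erase y) (addBefore Fin.val J y A) (addAfter Fin.val J y B) :=
      hN.loadLE_after fun z hz => by
        rw [hA z hz, hB z hz, Pi.add_apply]
        lia
    obtain ⟨hs, hsv⟩ := ih hl' hU' hL'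
    rw [subZ_congr ζ G hA hB] at hsv
    have hne : subZ ζ G (U.erase y) A (B + adjInd G y) ≠ 0 := by
      rw [← subZ_congr ζ G hA hB]
      exact H.subZ_ne_zero hL'
    have hZ := subZ_insert_eq ζ G H.γ_ne (Finset.notMem_erase y U) A B hne
    rw [Finset.insert_erase hyU] at hZ
    have hfc : GaussianInt.toComplex (fracVal P G d (U.erase y) A B y).2 ≠ 0 := by simpa using hf
    constructor
    · rw [sweepVal, ← hJ]
      exact mul_ne_zero (mul_ne_zero (pow_ne_zero _ hW) hf) hs
    · have hval : fval (sweepVal P G d (y :: l) U A B) =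
          P.toSpin.γ ^ B y * (1 + fval (fracVal P G d (U.erase y) A B y)) *
            fval (sweepVal P G d l (U.erase y) (addBefore Fin.val J y A)
              (addAfter Fin.val J y B)) := by
        rw [sweepVal, map_mul, map_mul, map_pow, ← hJ]
        congr 2
        simp only [fval_apply, map_add]
        field_simp
        ring
      have hZ' : subZ ζ G U A B = ζ.γ ^ B y * (1 + nodeRatio ζ G (U.erase y) A B y) *
          subZ ζ G (U.erase y) A (B + adjInd G y) := by
        rw [hZ]
        ring
      rw [hval, hZ']
      refine (norm_mul_sub_mul_le hfv hsv hδ).trans (le_of_eq ?_)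
      rw [List.length_cons, pow_succ']
      ring

end Correct

end FPTASProgram

/-! ### The case without pinned vertices. -/

section

variable {V : Type*} [Fintype V]

theorem pinSet_none (s : Option Bool) : pinSet (fun _ : V => none) s =
    if s = none then Finset.univ else ∅ := by
  ext v
  by_cases h : s = none <;> simp [pinSet, h, eq_comm]

theorem pinCount_none (G : SimpleGraph V) [DecidableRel G.Adj] (s : Bool) :
    pinCount G (fun _ => none) s = 0 := by
  ext v
  simp [pinCount, pinSet_none]

variable [DecidableEq V]

theorem partitionZ_eq_subZ (ζ : SpinParams) (G : SimpleGraph V) [DecidableRel G.Adj] :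
    partitionZ ζ G = subZ ζ G Finset.univ 0 0 := by
  have h : pinnedZ ζ G (fun _ => none) = partitionZ ζ G := by
    rw [pinnedZ, Finset.filter_true_of_mem fun τ _ v => Or.inl rfl, partitionZ]
  rw [← h, pinnedZ_eq]
  simp [pinWeight, pinSet_none, pinCount_none, inducedEdges_empty]

theorem loadLE_univ {Δ : ℕ} {G : SimpleGraph V} [DecidableRel G.Adj]
    (hG : G ∈ boundedDegreeGraphs Δ V) : LoadLE G Δ Finset.univ 0 0 := by
  simpa [pinSet_none, pinCount_none] using loadLE_pinCount hG fun _ => none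

end

/-! ## Choice of the depth and of the precision -/

theorem two_pow_size_le {k : ℕ} (hk : 1 ≤ k) : 2 ^ Nat.size k ≤ 2 * k := by
  obtain ⟨j, hj⟩ := Nat.exists_eq_succ_of_ne_zero (Nat.size_pos.2 hk).ne'
  have : 2 ^ j ≤ k := Nat.lt_size.1 (by lia)
  rw [hj, pow_succ]
  lia

/-- Logarithmic depth is enough to make an exponentially small error polynomially small. -/
theorem exists_depth {ρ c : ℝ} (hρ : 0 < ρ) (hρ1 : ρ < 1) :
    ∃ C q : ℕ, 1 ≤ C ∧ ∀ N : ℕ, 1 ≤ N →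
      ∃ d, Nat.size (C * N ^ q) = d + 2 ∧ c * ρ ^ d * N ^ 2 ≤ 1 := by
  -- With ρ^q < 1/2, a depth of log₂ (aN²)^q makes ρ^depth smaller than 1/(aN²).
  obtain ⟨q, hq⟩ := exists_pow_lt_of_lt_one (show (0 : ℝ) < 1 / 2 by norm_num) hρ1
  have hq0 : q ≠ 0 := by
    rintro rfl
    norm_num at hq
  -- The 2 guarantees at least two binary digits, even for N = 1; `c / ρ ^ 2` pays for the two
  -- levels of depth that bring no gain.
  obtain ⟨a, ha⟩ := exists_nat_ge (max 2 (c / ρ ^ 2))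
  have ha2 : (2 : ℝ) ≤ a := (le_max_left _ _).trans ha
  have ha2' : 2 ≤ a := by exact_mod_cast ha2
  have hca : c ≤ a * ρ ^ 2 := (div_le_iff₀ (by positivity)).1 ((le_max_right _ _).trans ha)
  refine ⟨a ^ q, 2 * q, Nat.one_le_pow _ _ (by lia), fun N hN => ?_⟩
  have hN' : (1 : ℝ) ≤ N := by exact_mod_cast hN
  rw [pow_mul, ← mul_pow]
  have hlt : 1 < Nat.size ((a * N ^ 2) ^ q) := by
    rw [Nat.lt_size, pow_one]
    have h1 : 2 ≤ a * N ^ 2 := ha2'.trans (Nat.le_mul_of_pos_right _ (by positivity))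
    exact h1.trans (Nat.le_self_pow hq0 _)
  obtain ⟨d, hd⟩ := Nat.exists_eq_add_of_le' hlt
  refine ⟨d, hd, ?_⟩
  have h2 : (((a : ℝ) * N ^ 2) ^ q) < 2 ^ (d + 2) := by
    have := Nat.lt_size_self ((a * N ^ 2) ^ q)
    rw [hd] at this
    exact_mod_cast this
  have hpos : 0 < (a : ℝ) * N ^ 2 := by positivity
  have h3 : (ρ ^ (d + 2) * (a * N ^ 2)) ^ q < 1 ^ q := by
    rw [one_pow, mul_pow, ← pow_mul, mul_comm (d + 2), pow_mul]
    calc (ρ ^ q) ^ (d + 2) * ((a : ℝ) * N ^ 2) ^ q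
        ≤ (1 / 2) ^ (d + 2) * ((a : ℝ) * N ^ 2) ^ q := by gcongr
      _ < (1 / 2) ^ (d + 2) * 2 ^ (d + 2) := by gcongr
      _ = 1 := by rw [← mul_pow]; norm_num
  have h4 := lt_of_pow_lt_pow_left₀ q zero_le_one h3
  calc c * ρ ^ d * N ^ 2 ≤ a * ρ ^ 2 * ρ ^ d * N ^ 2 := by gcongr
    _ = ρ ^ (d + 2) * (a * N ^ 2) := by ring
    _ ≤ 1 := h4.le

/-- Linear precision is enough to compensate an exponential growth up to logarithmic depth. -/
theorem exists_precision (g κ : ℝ) (hg : 1 ≤ g) (hκ : 0 < κ) {C : ℕ} (hC : 1 ≤ C) (q : ℕ) :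
    ∃ a e : ℕ, ∀ N : ℕ, 1 ≤ N →
      g ^ Nat.size (C * N ^ q) * (1 / 2 ^ (a + e * N)) * N ^ 2 ≤ κ := by
  obtain ⟨l, hl⟩ := pow_unbounded_of_one_lt g (one_lt_two : (1 : ℝ) < 2)
  obtain ⟨a, ha⟩ := pow_unbounded_of_one_lt ((2 * C : ℝ) ^ l / κ) (one_lt_two : (1 : ℝ) < 2)
  -- As g < 2^l, the growth is at most (2CN^q)^l, a polynomial in N of degree ql. Together with N²
  -- this is absorbed by 2^((ql + 2)N), and `a` absorbs the constant.
  refine ⟨a, q * l + 2, fun N hN => ?_⟩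
  have hN' : (1 : ℝ) ≤ N := by exact_mod_cast hN
  have h1 : (2 : ℝ) ^ Nat.size (C * N ^ q) ≤ 2 * (C * N ^ q) := by
    exact_mod_cast two_pow_size_le (Nat.mul_pos hC (by positivity))
  have h2 : g ^ Nat.size (C * N ^ q) ≤ (2 * (C * N ^ q)) ^ l :=
    calc g ^ Nat.size (C * N ^ q) ≤ (2 ^ l) ^ Nat.size (C * N ^ q) := by gcongr
      _ = (2 ^ Nat.size (C * N ^ q)) ^ l := by rw [← pow_mul, ← pow_mul, mul_comm]
      _ ≤ _ := by gcongr
  have h3 : (N : ℝ) ≤ 2 ^ N := by exact_mod_cast Nat.lt_two_pow_self.le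
  have h4 : (N : ℝ) ^ (q * l + 2) ≤ 2 ^ ((q * l + 2) * N) := by
    rw [mul_comm (q * l + 2) N, pow_mul]
    gcongr
  rw [div_lt_iff₀ hκ] at ha
  rw [mul_one_div, div_mul_eq_mul_div, div_le_iff₀ (by positivity), pow_add]
  calc g ^ Nat.size (C * N ^ q) * N ^ 2 ≤ (2 * (C * N ^ q)) ^ l * N ^ 2 := by gcongr
    _ = (2 * C : ℝ) ^ l * (N : ℝ) ^ (q * l + 2) := by ring
    _ ≤ (2 ^ a * κ) * 2 ^ ((q * l + 2) * N) := by gcongr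
    _ = _ := by ring

/-- The exponent is 2n because every vertex contributes two erroneous factors, a power of γ and 1 +
R. The estimate is e^x − 1 ≤ 2x for 0 ≤ x ≤ 1. -/
theorem one_add_pow_sub_one_le {t : ℝ} (ht : 0 ≤ t) {n m : ℕ} (hm : 1 ≤ m)
    (h : 4 * t * (n + m : ℕ) ^ 2 ≤ 1) : (1 + t) ^ (2 * n) - 1 ≤ 1 / m := by
  have hm' : (1 : ℝ) ≤ m := by exact_mod_cast hm
  have hn : (0 : ℝ) ≤ n := Nat.cast_nonneg n
  push_cast at h
  have h1 : 4 * n * t * m ≤ 1 := by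
    have : (n : ℝ) * m ≤ (n + m) ^ 2 := by nlinarith
    nlinarith
  have h3 : 4 * n * t ≤ 4 * n * t * m := le_mul_of_one_le_right (by positivity) hm'
  have h2 : (1 + t) ^ (2 * n) ≤ Real.exp (2 * n * t) := by
    calc (1 + t) ^ (2 * n) ≤ (Real.exp t) ^ (2 * n) := by
          gcongr
          linarith [Real.add_one_le_exp t]
      _ = _ := by
        rw [← Real.exp_nat_mul]
        push_cast
        rfl
  have h4 : Real.exp (2 * n * t) ≤ 1 + 2 * (2 * n * t) := by
    have := Real.abs_exp_sub_one_le (x := 2 * n * t) (by rw [abs_of_nonneg (by positivity)]; linarith)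
    rw [abs_of_nonneg (by positivity : 0 ≤ 2 * n * t)] at this
    linarith [le_abs_self (Real.exp (2 * n * t) - 1)]
  have h5 : 4 * n * t ≤ 1 / m := by
    rw [le_div_iff₀ (by linarith)]
    exact h1
  linarith

/-! ### Dyadic parameters, the error per vertex and the polynomial cost. -/

namespace FPTASProgram

theorem expo_le (Δ d : ℕ) : expo Δ d ≤ (3 * Δ + 1) ^ d := by
  induction d with
  | zero => simp [expo]
  | succ d ih =>
    have := one_le_expo Δ d
    have h2 : expo Δ d * (3 * Δ + 1) ≤ (3 * Δ + 1) ^ d * (3 * Δ + 1) := Nat.mul_le_mul_right _ ih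
    rw [pow_succ, expo]
    nlinarith

/-- The approximate parameters given by dyadic numbers. -/
def ApproxParams.ofDyadic (b : ℕ) (β' γ' lam' : ℤ × ℤ) : ApproxParams :=
  ⟨⟨2 ^ b, 0⟩, ⟨β'.1, β'.2⟩, ⟨γ'.1, γ'.2⟩, ⟨lam'.1, lam'.2⟩⟩

theorem fval_dyadic (b : ℕ) (a : ℤ × ℤ) :
    fval (⟨a.1, a.2⟩, ⟨2 ^ b, 0⟩) = ((a.1 : ℂ) + (a.2 : ℂ) * Complex.I) / 2 ^ b := by
  simp [fval_apply, GaussianInt.toComplex_def]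

theorem paramDist_ofDyadic {ζ : SpinParams} {b : ℕ} {β' γ' lam' : ℤ × ℤ}
    (hβ : IsDyadicApprox b ζ.β β') (hγ : IsDyadicApprox b ζ.γ γ')
    (hl : IsDyadicApprox b ζ.lam lam') :
    paramDist ζ (ApproxParams.ofDyadic b β' γ' lam').toSpin ≤ 1 / 2 ^ b := by
  simp only [paramDist, ApproxParams.toSpin, ApproxParams.ofDyadic, fval_dyadic]
  exact max_le hβ (max_le hγ hl)

/-- The factor 2 in the hypothesis comes from |re| + |im| ≤ 2|w|, the 1 from a rounding error of at
most 2^(−b) ≤ 1. -/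
theorem gBd_of_dyadic {z : ℂ} {b s : ℕ} {a : ℤ × ℤ} (h : IsDyadicApprox b z a)
    (hs : 2 * (‖z‖ + 1) ≤ 2 ^ s) : GBd (b + s) ⟨a.1, a.2⟩ := by
  have hb : (1 : ℝ) ≤ 2 ^ b := one_le_pow₀ one_le_two
  have hw : ‖((a.1 : ℂ) + (a.2 : ℂ) * Complex.I)‖ ≤ (‖z‖ + 1) * 2 ^ b := by
    have h1 : ‖((a.1 : ℂ) + (a.2 : ℂ) * Complex.I) / 2 ^ b‖ ≤ ‖z‖ + 1 := by
      have h2 := norm_sub_norm_le (((a.1 : ℂ) + (a.2 : ℂ) * Complex.I) / 2 ^ b) z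
      rw [norm_sub_rev] at h2
      have h3 : (1 : ℝ) / 2 ^ b ≤ 1 := (div_le_one (by positivity)).2 hb
      have := h2.trans (h.trans h3)
      linarith
    rw [norm_div, div_le_iff₀ (by simp)] at h1
    simpa using h1
  have hre := (Complex.abs_re_le_norm _).trans hw
  have him := (Complex.abs_im_le_norm _).trans hw
  simp at hre him
  have : ((a.1.natAbs + a.2.natAbs : ℕ) : ℝ) ≤ ((2 ^ (b + s) : ℕ) : ℝ) := by
    push_cast
    rw [Nat.cast_natAbs, Nat.cast_natAbs, Int.cast_abs, Int.cast_abs, pow_add]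
    nlinarith
  exact_mod_cast this

theorem paramBd_ofDyadic {ζ : SpinParams} {b s : ℕ} {β' γ' lam' : ℤ × ℤ}
    (hβ : IsDyadicApprox b ζ.β β') (hγ : IsDyadicApprox b ζ.γ γ')
    (hl : IsDyadicApprox b ζ.lam lam')
    (hs : 2 * (‖ζ.β‖ + 1) ≤ 2 ^ s ∧ 2 * (‖ζ.γ‖ + 1) ≤ 2 ^ s ∧ 2 * (‖ζ.lam‖ + 1) ≤ 2 ^ s) :
    ParamBd (b + s) (ApproxParams.ofDyadic b β' γ' lam') where
  W := by
    have : 2 ^ b ≤ 2 ^ (b + s) := Nat.pow_le_pow_right (by norm_num) (Nat.le_add_right b s)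
    simpa [GBd, ApproxParams.ofDyadic, Int.natAbs_pow] using this
  β := gBd_of_dyadic hβ hs.1
  γ := gBd_of_dyadic hγ hs.2.1
  lam := gBd_of_dyadic hl hs.2.2

/-- The factor that the algorithm computes for a vertex has a small relative error. -/
theorem exists_vertex_error {ζ : SpinParams} {Δ : ℕ} {Q : Set ℂ} (H : RecInvariant ζ Δ Q)
    {ρ C μ κ K : ℝ} (HR : RootBound.{0} ζ Δ ρ C μ) (hκ : 0 < κ) (hK : 0 ≤ K)
    (hb : ∀ ζ' : SpinParams, paramDist ζ ζ' ≤ κ → ParamBound κ K ζ' ∧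
      ∀ x x' : ℂ, ChildValue ζ Q x → ‖x - x'‖ ≤ κ → ArgBound κ K ζ' x') :
    ∃ c : ℝ, 0 < c ∧ ∀ {P : ApproxParams} {ε : ℝ} {n d : ℕ}, P.W ≠ 0 →
      paramDist ζ P.toSpin ≤ ε → growth Δ κ K ^ (d + 2) * ε ≤ κ →
      ∀ {G : SimpleGraph (Fin n)} [DecidableRel G.Adj] (U : Finset (Fin n)) (A B : Fin n → ℕ)
        (v : Fin n), NodeLoadLE G Δ U A B v → A v + B v + (U.filter (G.Adj v)).card ≤ Δ →
        (fracVal P G (d + 2) U A B v).2 ≠ 0 ∧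
        ‖P.toSpin.γ ^ B v * (1 + fval (fracVal P G (d + 2) U A B v)) -
          ζ.γ ^ B v * (1 + nodeRatio ζ G U A B v)‖ ≤
          ((1 + c * (ρ ^ d + growth Δ κ K ^ (d + 2) * ε)) ^ 2 - 1) *
            ‖ζ.γ ^ B v * (1 + nodeRatio ζ G U A B v)‖ := by
  have hM := one_le_facBound hκ hK
  have hμ := HR.μ_pos
  have hC := HR.C_nonneg
  have hρ := HR.ρ_pos
  set M := facBound κ K with hMdef
  -- The first summand is for the relative error of γ^B, where one M^Δ is a lower bound for |γ^B| in
  -- disguise; the second is for 1 + R, whose norm is at least μ.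
  refine ⟨Δ * M ^ Δ * M ^ Δ + (C + 1) / μ, by positivity, ?_⟩
  intro P ε n d hW hP hg G _ U A B v hN hload
  have hε0 : 0 ≤ ε := (paramDist_nonneg _ _).trans hP
  have hg1 := one_le_pow₀ (n := d + 2) (one_le_growth Δ hκ hK)
  set g := growth Δ κ K ^ (d + 2) * ε with hgdef
  have hεg : ε ≤ g := le_mul_of_one_le_left hε0 hg1
  have hg0 : 0 ≤ g := hε0.trans hεg
  have hεκ : ε ≤ κ := hεg.trans hg
  obtain ⟨hf, hfv⟩ := fracVal_spec H hκ hK hb hW hP hεκ (d + 2) hg hN hload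
  refine ⟨hf, ?_⟩
  obtain ⟨h1, -, h2⟩ := HR.bounds (Fin n) G Fin.val Fin.val_injective U A B v hN hload
  replace h2 := (h2 d).2
  obtain ⟨hp, -⟩ := hb ζ (by rw [paramDist_self]; exact hκ.le)
  obtain ⟨hp', -⟩ := hb P.toSpin (hP.trans hεκ)
  obtain ⟨-, -, hc1, hc2⟩ := closePair_param hκ hK hp hp' hP
  rw [← hMdef] at hc1 hc2
  have hρd : 0 ≤ ρ ^ d := by positivity
  have hBΔ : B v ≤ Δ := by lia
  have hMB : M ^ B v ≤ M ^ Δ := pow_le_pow_right₀ hM hBΔ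
  have hγB : 1 ≤ M ^ Δ * ‖ζ.γ ^ B v‖ := by
    have h3 := (hc2.pow (by linarith) (B v)).left
    rw [inv_pow, norm_inv] at h3
    have h4 : 0 < ‖ζ.γ ^ B v‖ := norm_pos_iff.2 (pow_ne_zero _ H.γ_ne)
    rw [inv_le_comm₀ h4 (by positivity), inv_le_iff_one_le_mul₀' (by positivity)] at h3
    exact h3.trans (by gcongr)
  set c := Δ * M ^ Δ * M ^ Δ + (C + 1) / μ with hcdef
  have ha : ‖P.toSpin.γ ^ B v - ζ.γ ^ B v‖ ≤ (c * (ρ ^ d + g)) * ‖ζ.γ ^ B v‖ := by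
    have h3 := (hc1.pow (by linarith) (B v)).sub
    rw [norm_sub_rev]
    have hc' : Δ * M ^ Δ * M ^ Δ ≤ c := by
      have : 0 ≤ (C + 1) / μ := by positivity
      linarith
    calc _ ≤ B v * M ^ B v * ε := h3
      _ ≤ Δ * M ^ Δ * (ρ ^ d + g) := by
        have : (B v : ℝ) ≤ Δ := by exact_mod_cast hBΔ
        gcongr
        linarith
      _ ≤ Δ * M ^ Δ * (ρ ^ d + g) * (M ^ Δ * ‖ζ.γ ^ B v‖) :=
        le_mul_of_one_le_right (by positivity) hγB
      _ = Δ * M ^ Δ * M ^ Δ * (ρ ^ d + g) * ‖ζ.γ ^ B v‖ := by ring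
      _ ≤ _ := by gcongr
  have hb' : ‖(1 + fval (fracVal P G (d + 2) U A B v)) - (1 + nodeRatio ζ G U A B v)‖ ≤
      (c * (ρ ^ d + g)) * ‖1 + nodeRatio ζ G U A B v‖ := by
    have hc' : (C + 1) / μ ≤ c := by
      have : 0 ≤ Δ * M ^ Δ * M ^ Δ := by positivity
      linarith
    have e : (1 + fval (fracVal P G (d + 2) U A B v)) - (1 + nodeRatio ζ G U A B v) =
        -((nodeRatio ζ G U A B v - truncVal ζ G Fin.val (d + 2) U A B v) +
          (truncVal ζ G Fin.val (d + 2) U A B v - fval (fracVal P G (d + 2) U A B v))) := by ring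
    rw [e, norm_neg]
    calc _ ≤ C * ρ ^ d + g := (norm_add_le _ _).trans (add_le_add h2 hfv)
      _ ≤ (C + 1) * (ρ ^ d + g) := by nlinarith
      _ = (C + 1) / μ * (ρ ^ d + g) * μ := by field_simp
      _ ≤ _ := by gcongr
  refine (norm_mul_sub_mul_le ha hb' (by positivity)).trans (le_of_eq ?_)
  ring

theorem fval_eq_div (f : Frac) :
    (((f.1 * star f.2).re : ℂ) + ((f.1 * star f.2).im : ℂ) * Complex.I) /
      ((f.2.re * f.2.re + f.2.im * f.2.im : ℤ) : ℂ) = fval f := by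
  by_cases h : f.2 = 0
  · simp [fval_apply, h]
  have h1 : GaussianInt.toComplex f.2 ≠ 0 := by simpa using h
  have h2 : GaussianInt.toComplex (star f.2) ≠ 0 := by simpa using h
  have h3 : ((f.2.re * f.2.re + f.2.im * f.2.im : ℤ) : ℂ) =
      GaussianInt.toComplex f.2 * GaussianInt.toComplex (star f.2) := by
    simp only [GaussianInt.toComplex_def, Zsqrtd.re_star, Zsqrtd.im_star]
    push_cast
    linear_combination ((f.2.im : ℂ) ^ 2) * Complex.I_sq
  rw [h3, ← GaussianInt.toComplex_def, map_mul, mul_div_mul_right _ _ h2, fval_apply]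

theorem normSq_ne_zero {z : GaussianInt} (h : z ≠ 0) : z.re * z.re + z.im * z.im ≠ 0 := by
  intro h0
  apply h
  have h1 : z.re = 0 := by nlinarith
  have h2 : z.im = 0 := by nlinarith
  exact Zsqrtd.ext h1 h2

/-- The cost of the program is polynomially bounded. -/
theorem exists_time (Δ C q a e s : ℕ) (hs : 1 ≤ s) : ∃ time : Polynomial ℕ, ∀ n m : ℕ, 1 ≤ m →
    ∀ (G : SimpleGraph (Fin n)) [DecidableRel G.Adj] (β' γ' lam' : ℤ × ℤ),
      LoadLE G Δ Finset.univ 0 0 →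
      ParamBd (a + e * (n + m) + s) (ApproxParams.ofDyadic (a + e * (n + m)) β' γ' lam') →
      ∃ c ≤ time.eval (n + m),
        RunsTo (prog C q) (.pair (.int n) (.pair
          (Val.ofList ((List.finRange n).map fun x => encRow G x (List.finRange n)))
          (.pair (.int m) (.pair (.int (a + e * (n + m) : ℕ)) (.pair (Val.ofIntPair β')
            (.pair (Val.ofIntPair γ') (Val.ofIntPair lam')))))))
          (let F := sweepVal (ApproxParams.ofDyadic (a + e * (n + m)) β' γ' lam') G
            (Nat.size (C * (n + m) ^ q)) (List.finRange n) Finset.univ 0 0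
          .pair (.int (F.1 * star F.2).re) (.pair (.int (F.1 * star F.2).im)
            (.int (F.2.re * F.2.re + F.2.im * F.2.im)))) c := by
  -- The base 3Δ + 1 dominates both the size growth (`expo_le`) and the branching Δ + 1. Being below
  -- 2^l, its D-th power is at most (2^D)^l, which is polynomial for logarithmic D.
  obtain ⟨l, hl⟩ := pow_unbounded_of_one_lt (3 * Δ + 1) (one_lt_two : 1 < 2)
  -- The inner + 1 allows C = 0, where `two_pow_size_le` would not apply.
  obtain ⟨Ep, hEp⟩ : ∃ p : Polynomial ℕ, ∀ N, p.eval N = (2 * (C * N ^ q + 1)) ^ l :=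
    ⟨(Polynomial.C 2 * (Polynomial.C C * Polynomial.X ^ q + 1)) ^ l, fun N => by simp⟩
  obtain ⟨Xp, hXp⟩ : ∃ p : Polynomial ℕ, ∀ N, p.eval N = N + (a + e * N) + Δ + C * N ^ q +
      (N * (Δ * (a + e * N + s) + Ep.eval N * (a + e * N + s) + 1) +
        Ep.eval N * (a + e * N + s)) := by
    refine ⟨Polynomial.X + (Polynomial.C a + Polynomial.C e * Polynomial.X) + Polynomial.C Δ +
      Polynomial.C C * Polynomial.X ^ q + (Polynomial.X * (Polynomial.C Δ *
        (Polynomial.C a + Polynomial.C e * Polynomial.X + Polynomial.C s) +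
        Ep * (Polynomial.C a + Polynomial.C e * Polynomial.X + Polynomial.C s) + 1) +
        Ep * (Polynomial.C a + Polynomial.C e * Polynomial.X + Polynomial.C s)), fun N => ?_⟩
    simp only [Polynomial.eval_add, Polynomial.eval_mul, Polynomial.eval_pow, Polynomial.eval_C,
      Polynomial.eval_X, Polynomial.eval_one]
  obtain ⟨tm, htm⟩ : ∃ p : Polynomial ℕ, ∀ N, p.eval N =
      (N + 1) * ((Ep.eval N * (Δ + 1)) * ((Δ + 1) * ((N + 1) * (1000 * (Xp.eval N + 3)))) +
        (Δ + 1) * (100 * (Xp.eval N + 3)) + (N + 1) * (400 * (Xp.eval N + 3))) +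
        (Xp.eval N + 1) * (20 * (Xp.eval N + 1)) +
        (q + 1) * (20 * (Xp.eval N + 3)) + (N + 1) * 20 + 200 * (Xp.eval N + 3) := by
    refine ⟨(Polynomial.X + 1) * ((Ep * Polynomial.C (Δ + 1)) * (Polynomial.C (Δ + 1) *
      ((Polynomial.X + 1) * (Polynomial.C 1000 * (Xp + Polynomial.C 3)))) +
      Polynomial.C (Δ + 1) * (Polynomial.C 100 * (Xp + Polynomial.C 3)) +
      (Polynomial.X + 1) * (Polynomial.C 400 * (Xp + Polynomial.C 3))) +
      (Xp + 1) * (Polynomial.C 20 * (Xp + 1)) +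
      Polynomial.C (q + 1) * (Polynomial.C 20 * (Xp + Polynomial.C 3)) +
      (Polynomial.X + 1) * Polynomial.C 20 + Polynomial.C 200 * (Xp + Polynomial.C 3),
      fun N => ?_⟩
    simp only [Polynomial.eval_add, Polynomial.eval_mul, Polynomial.eval_C,
      Polynomial.eval_X, Polynomial.eval_one]
  refine ⟨tm, fun n m hm G _ β' γ' lam' hL hP => ?_⟩
  set N := n + m with hN
  have hN1 : 1 ≤ N := by lia
  set D := Nat.size (C * N ^ q) with hD
  have hDC : D ≤ C * N ^ q := by
    rw [hD, Nat.size_le]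
    exact Nat.lt_two_pow_self
  have hpow : (3 * Δ + 1) ^ D ≤ Ep.eval N := by
    rw [hEp]
    calc (3 * Δ + 1) ^ D ≤ (2 ^ l) ^ D := Nat.pow_le_pow_left hl.le _
      _ = (2 ^ D) ^ l := by rw [← pow_mul, ← pow_mul, mul_comm]
      _ ≤ _ := by
        apply Nat.pow_le_pow_left
        calc 2 ^ D ≤ 2 ^ Nat.size (C * N ^ q + 1) := Nat.pow_le_pow_right (by norm_num)
              (Nat.size_le_size (Nat.le_succ _))
          _ ≤ _ := two_pow_size_le (Nat.le_add_left 1 _)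
  have hexpo := (expo_le Δ D).trans hpow
  have hΔD : (Δ + 1) ^ (D + 1) ≤ Ep.eval N * (Δ + 1) := by
    rw [pow_succ]
    exact Nat.mul_le_mul_right _ ((Nat.pow_le_pow_left (by lia) _).trans hpow)
  have hX := hXp N
  set X := Xp.eval N with hXdef
  have hX2 : n * (Δ * (a + e * N + s) + expo Δ D * (a + e * N + s) + 1) +
      expo Δ D * (a + e * N + s) ≤ X := by
    rw [hX]
    refine le_trans ?_ (Nat.le_add_left _ _)
    gcongr
    lia
  have hC : ∀ j ≤ q, intSize ((C : ℤ) * (n + m) ^ j) ≤ X := fun j hj => by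
    have h1 : ((C : ℤ) * (n + m) ^ j) = ((C * N ^ j : ℕ) : ℤ) := by
      rw [hN]
      push_cast
      rfl
    rw [h1]
    refine (intSize_le_natAbs _).trans ?_
    rw [Int.natAbs_natCast]
    have : C * N ^ j ≤ C * N ^ q := Nat.mul_le_mul_left _ (Nat.pow_le_pow_right hN1 hj)
    lia
  obtain ⟨c, hc, hr⟩ := runsTo_main (C := C) (q := q) (n := n) (m := m) (G := G) (X := X)
    (b := a + e * N) rfl hP (by lia) (by lia) (by lia) (by lia) (by lia) hD (by lia) hX2 hC hL
  refine ⟨c, hc.trans ?_, hr⟩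
  rw [htm N, ← hXdef]
  have hnN : n ≤ N := by lia
  gcongr

end FPTASProgram

-- The order of choices matters: κ, K and c depend only on ζ and Δ, then C and q fix the depth, and
-- only then is the precision chosen against the growth at that depth.
open FPTASProgram in
theorem RecContraction.hasFPTAS {ζ : SpinParams} {Δ : ℕ} {Q : Set ℂ} {φ : ℂ → ℂ} {ρ D L : ℝ}
    (H : RecContraction ζ Δ Q φ ρ D L) : HasFPTAS ζ (boundedDegreeGraphs Δ) := by
  obtain ⟨κ, K, hκ, hK, hb⟩ := H.exists_bounds
  obtain ⟨C₀, μ, HR⟩ := RecContraction.exists_rootBound.{0} H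
  obtain ⟨c, hc, hv⟩ := exists_vertex_error H.toRecInvariant HR hκ hK hb
  have hg := one_le_growth Δ hκ hK
  -- Truncation and rounding each get half of the budget 4tN² ≤ 1; hence the 8.
  obtain ⟨C, q, hC, hdep⟩ := exists_depth (c := 8 * c) HR.ρ_pos HR.ρ_lt
  obtain ⟨a, e, hprec⟩ := exists_precision (growth Δ κ K) (min κ (1 / (8 * c))) hg
    (by positivity) hC q
  obtain ⟨s, hs⟩ := pow_unbounded_of_one_lt
    (2 * (‖ζ.β‖ + ‖ζ.γ‖ + ‖ζ.lam‖ + 1)) (one_lt_two : (1 : ℝ) < 2)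
  have hnb := norm_nonneg ζ.β
  have hng := norm_nonneg ζ.γ
  have hnl := norm_nonneg ζ.lam
  have hs1 : 1 ≤ s := by
    by_contra h
    have : s = 0 := by lia
    rw [this, pow_zero] at hs
    linarith
  obtain ⟨time, ht⟩ := exists_time Δ C q a e s hs1
  refine ⟨prog C q, Polynomial.C a + Polynomial.C e * Polynomial.X, time, ?_⟩
  intro n G hG m hm β' γ' lam' hβ' hγ' hl'
  have hev : (Polynomial.C a + Polynomial.C e * Polynomial.X : Polynomial ℕ).eval (n + m) =
    a + e * (n + m) := by simp
  rw [hev] at hβ' hγ' hl' ⊢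
  classical
  have hL := loadLE_univ hG
  set P := ApproxParams.ofDyadic (a + e * (n + m)) β' γ' lam' with hPdef
  have hPd := paramDist_ofDyadic hβ' hγ' hl'
  have hPB : ParamBd (a + e * (n + m) + s) P := paramBd_ofDyadic hβ' hγ' hl'
    ⟨by linarith, by linarith, by linarith⟩
  obtain ⟨cost, hcost, hrun⟩ := ht n m hm G β' γ' lam' hL hPB
  obtain ⟨d, hd, hdρ⟩ := hdep (n + m) (by lia)
  have hpr := hprec (n + m) (by lia)
  rw [hd] at hrun hpr
  rw [← hPdef] at hPd hrun
  set ε : ℝ := 1 / 2 ^ (a + e * (n + m)) with hε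
  have hN1 : (1 : ℝ) ≤ ((n + m : ℕ) : ℝ) ^ 2 := by
    have : 1 ≤ (n + m) ^ 2 := Nat.one_le_pow _ _ (by lia)
    exact_mod_cast this
  have hge : 0 ≤ growth Δ κ K ^ (d + 2) * ε := by
    have : 0 ≤ growth Δ κ K := by linarith
    positivity
  have hgκ : growth Δ κ K ^ (d + 2) * ε ≤ κ :=
    (le_mul_of_one_le_right hge hN1).trans (hpr.trans (min_le_left _ _))
  have hW : P.W ≠ 0 := by
    intro h0
    have : (2 : ℤ) ^ (a + e * (n + m)) = 0 := congrArg Zsqrtd.re h0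
    simp at this
  have hρ := HR.ρ_pos
  set t := c * (ρ ^ d + growth Δ κ K ^ (d + 2) * ε) with htdef
  have ht0 : 0 ≤ t := by positivity
  have htN : 4 * t * ((n + m : ℕ) : ℝ) ^ 2 ≤ 1 := by
    have h1 := hpr.trans (min_le_right _ _)
    rw [le_div_iff₀ (by positivity)] at h1
    rw [htdef]
    linarith
  have h0 : IsTail 0 (List.finRange n) := isTail_finRange n
  -- With this δ the total factor (1 + δ)^n is (1 + t)^(2n).
  obtain ⟨hne, hF⟩ := sweepVal_spec (δ := (1 + t) ^ 2 - 1) H.toRecInvariant (by nlinarith) hW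
    (fun U A B v => hv hW hPd hgκ U A B v) (List.finRange n) h0 (fun x => by simp) hL
  set F := sweepVal P G (d + 2) (List.finRange n) Finset.univ 0 0 with hFdef
  refine ⟨(F.1 * star F.2).re, (F.1 * star F.2).im, F.2.re * F.2.re + F.2.im * F.2.im, cost,
    normSq_ne_zero hne, ?_, hcost, ?_⟩
  · convert hrun using 1
    rw [fptasInput, Val.ofGraph, List.ofFn_eq_map]
    congr 4
    funext x
    rw [List.ofFn_eq_map]
    rfl
  · rw [fval_eq_div, partitionZ_eq_subZ]
    refine hF.trans (mul_le_mul_of_nonneg_right ?_ (norm_nonneg _))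
    rw [List.length_finRange, add_sub_cancel, ← pow_mul]
    exact one_add_pow_sub_one_le ht0 hm htN

theorem mainTheorem6 (ζ : SpinParams) (hγ : ζ.γ ≠ 0) (Δ : ℕ) (h : ComplexContraction ζ Δ) :
    StrongSpatialMixing.{u} ζ (boundedDegreeGraphs Δ) ∧ HasFPTAS ζ (boundedDegreeGraphs Δ) := by
  obtain ⟨Q, φ, ρ, D, L, H⟩ := h.exists_recContraction hγ
  obtain ⟨C, μ, HR⟩ := RecContraction.exists_rootBound.{u} H
  exact ⟨HR.strongSpatialMixing H.toRecInvariant, H.hasFPTAS⟩
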